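/- **Definitions.** Let $C$ be a purely one-dimensional scheme of finite type over $\mathbb{C}$. The analytic branches of $C$ at a point $p$ are the minimal primes of $\widehat{\mathcal O}_{C,p}$. The \emph{intersection graph} $\Gamma(C)$ is the bipartite graph whose green vertices $G(C)$ are the irreducible components of $C$, whose yellow vertices $Y(C)$ are the points at which $C$ has more than one analytic branch, and whose edges are the pairs $(y,b)$ with $y\in Y(C)$ and $b$ an analytic branch of $C$ at $y$; the edge $(y,b)$ joins $y$ to the component containing $b$. Write $E_y$ for the set of edges at $y$, $\chi(\Gamma(C))=\#G(C)+\#Y(C)-\#\{\text{edges}\}$, and for $g\in G(C)$ let $m(g)$ be the length of the local ring of $C$ at the generic point of the component $g$. A finite map $f\colon C_1\to C_2$ of such curves induces a map $\Gamma_f\colon\Gamma(C_1)\to\Gamma(C_2)$ of the underlying topological spaces as follows. A green vertex $g$ goes to the component $f(g)$. If all branches of $C_1$ at $y\in Y(C_1)$ map to the same branch of $C_2$, then $y$ and all edges at $y$ go to the green vertex of the component containing that branch; otherwise $y$ goes to the yellow vertex $f(y)$ and an edge $(y,b)$ goes to the edge $(f(y),f(b))$. For $y\in Y(C_1)$ put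 $\zeta_f(y)=\#E_y-\#\Gamma_f(E_y)$ if $\Gamma_f(y)$ is yellow and $\zeta_f(y)=0$ otherwise; for $g\in G(C_1)$ put $\zeta_f(g)=\deg\bigl(f|_{g^{\mathrm{red}}}\bigr)-1$, where $g^{\mathrm{red}}$ is the component with its reduced structure and the degree is that of the map onto its image. **Theorem.** Let $T$ be a smooth connected curve over $\mathbb{C}$ with a closed point $0\in T$, and let $X\to T$ be a flat map from an irreducible S2 surface $X$ (separated and of finite type over $\mathbb{C}$) such that the non-normal locus of $X$ is contained in the central fiber $X_0$. Let $\nu\colon X^\nu\to X$ be the normalization, and assume that the central fiber $X^\nu_0$ of $X^\nu\to T$ is reduced. Then the graphs $\Gamma(X^\nu_0)$ and $\Gamma(X_0)$ are finite, the induced map $\Gamma_\nu\colon\Gamma(X^\nu_0)\to\Gamma(X_0)$ is well defined, and: 1. $\Gamma_\nu$ is surjective. 2. $$\chi(\Gamma(X^\nu_0))\le\chi(\Gamma(X_0))+\sum_{g\in G(X_0)}(m(g)-1)-\sum_{g\in G(X^\nu_0)}\zeta_\nu(g)-\sum_{y\in Y(X^\nu_0)}\zeta_\nu(y).$$ 3.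 If $\chi(\Gamma(X^\nu_0))=\chi(\Gamma(X_0))+\sum_{g\in G(X_0)}(m(g)-1)$, then $\zeta_\nu(y)=\zeta_\nu(g)=0$ for all $y\in Y(X^\nu_0)$ and all $g\in G(X^\nu_0)$. -/

import Mathlib

open AlgebraicGeometry CategoryTheory

namespace IntersectionGraph

/-! ### Completed local rings and their functoriality -/

theorem maximalIdeal_pow_le_comap {R S : Type*} [CommRing R] [CommRing S] [IsLocalRing R]
    [IsLocalRing S] (φ : R →+* S) [IsLocalHom φ] (n : ℕ) :
    IsLocalRing.maximalIdeal R ^ n ≤ (IsLocalRing.maximalIdeal S ^ n).comap φ :=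
  Ideal.map_le_iff_le_comap.mp <| by
    rw [Ideal.map_pow]
    exact Ideal.pow_right_mono (((IsLocalRing.local_hom_TFAE φ).out 0 2).mp ‹_›) n

/-- The map `R̂ → R ⧸ 𝔪ⁿ → S ⧸ 𝔫ⁿ` induced by a local homomorphism `R → S`. -/
noncomputable def completionMapAux {R S : Type*} [CommRing R] [CommRing S] [IsLocalRing R]
    [IsLocalRing S] (φ : R →+* S) [IsLocalHom φ] (n : ℕ) :
    AdicCompletion (IsLocalRing.maximalIdeal R) R →+* S ⧸ IsLocalRing.maximalIdeal S ^ n :=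
  (Ideal.quotientMap (IsLocalRing.maximalIdeal S ^ n) φ (maximalIdeal_pow_le_comap φ n)).comp
    (AdicCompletion.evalₐ (IsLocalRing.maximalIdeal R) n : _ →+* _)

theorem completionMapAux_compat {R S : Type*} [CommRing R] [CommRing S] [IsLocalRing R]
    [IsLocalRing S] (φ : R →+* S) [IsLocalHom φ] {m n : ℕ} (hmn : m ≤ n) :
    (Ideal.Quotient.factorPow (IsLocalRing.maximalIdeal S) hmn).comp (completionMapAux φ n) =
      completionMapAux φ m := by
  ext x
  obtain ⟨a, rfl⟩ := AdicCompletion.mk_surjective _ _ x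
  have ha : Ideal.Quotient.mk (IsLocalRing.maximalIdeal R ^ m) (a m) =
      Ideal.Quotient.mk (IsLocalRing.maximalIdeal R ^ m) (a n) := by
    have h := a.2 hmn
    rw [SModEq.sub_mem] at h
    exact Ideal.Quotient.eq.mpr (by simpa using h)
  have ha' := congrArg (Ideal.quotientMap (IsLocalRing.maximalIdeal S ^ m) φ
    (maximalIdeal_pow_le_comap φ m)) ha
  simpa [completionMapAux, AdicCompletion.evalₐ_mk] using ha'.symm

/-- The ring homomorphism between the completions (at the maximal ideals) induced by a local
homomorphism of local rings. -/
noncomputable def completionMap {R S : Type*} [CommRing R] [CommRing S] [IsLocalRing R]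
    [IsLocalRing S] (φ : R →+* S) [IsLocalHom φ] :
    AdicCompletion (IsLocalRing.maximalIdeal R) R →+*
      AdicCompletion (IsLocalRing.maximalIdeal S) S :=
  AdicCompletion.liftRingHom (IsLocalRing.maximalIdeal S) (completionMapAux φ)
    (fun hmn => completionMapAux_compat φ hmn)

/-- The completion of the local ring of `C` at `x` with respect to its maximal ideal. -/
abbrev CompletedStalk (C : Scheme.{0}) (x : C) : Type :=
  AdicCompletion (IsLocalRing.maximalIdeal (C.presheaf.stalk x)) (C.presheaf.stalk x)

/-- The analytic branches of `C` at `x`: the minimal primes of the completed local ring. -/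
def branches (C : Scheme.{0}) (x : C) : Set (PrimeSpectrum (CompletedStalk C x)) :=
  {b | b.asIdeal ∈ minimalPrimes (CompletedStalk C x)}

/-- The generic point of the irreducible component of `C` on which a branch at `x` lies: the
point of `C` given by the contraction of the branch to the local ring at `x`. -/
noncomputable def branchComponent (C : Scheme.{0}) (x : C)
    (b : PrimeSpectrum (CompletedStalk C x)) : C :=
  C.fromSpecStalk x (PrimeSpectrum.comap (algebraMap (C.presheaf.stalk x) (CompletedStalk C x)) b)

/-- The image of a branch of `C₁` at `x` under `f : C₁ ⟶ C₂`: its contraction along the map of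
completed local rings. -/
noncomputable def branchMap {C₁ C₂ : Scheme.{0}} (f : C₁ ⟶ C₂) (x : C₁)
    (b : PrimeSpectrum (CompletedStalk C₁ x)) : PrimeSpectrum (CompletedStalk C₂ (f x)) :=
  PrimeSpectrum.comap (completionMap (f.stalkMap x).hom) b

/-! ### The intersection graph of a purely one-dimensional scheme -/

/-- Green vertices: the irreducible components of `C`, represented by their generic points. -/
def greenVertices (C : Scheme.{0}) : Set C := genericPoints C

/-- Yellow vertices: the points at which `C` has more than one analytic branch. -/
def yellowVertices (C : Scheme.{0}) : Set C := {y | (branches C y).Nontrivial}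

/-- Edges: pairs `(y, b)` of a yellow vertex `y` and an analytic branch `b` of `C` at `y`. Such an
edge joins the yellow vertex `y` to the green vertex `branchComponent C y b`. -/
def edges (C : Scheme.{0}) : Set (Σ y : C, PrimeSpectrum (CompletedStalk C y)) :=
  {e | e.1 ∈ yellowVertices C ∧ e.2 ∈ branches C e.1}

/-- The Euler characteristic of the intersection graph. -/
noncomputable def eulerChar (C : Scheme.{0}) : ℤ :=
  (greenVertices C).ncard + (yellowVertices C).ncard - (edges C).ncard

/-- Candidates for the cells (vertices and open edges) of the intersection graph, seen as a
one-dimensional cell complex. -/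
inductive Cell (C : Scheme.{0}) : Type
  | green (g : C) : Cell C
  | yellow (y : C) : Cell C
  | edge (y : C) (b : PrimeSpectrum (CompletedStalk C y)) : Cell C

/-- The intersection graph `Γ(C)`, as the set of its cells. -/
def cells (C : Scheme.{0}) : Set (Cell C) := fun c =>
  match c with
  | .green g => g ∈ greenVertices C
  | .yellow y => y ∈ yellowVertices C
  | .edge y b => (⟨y, b⟩ : Σ y : C, PrimeSpectrum (CompletedStalk C y)) ∈ edges C

/-- All the branches of `C₁` at `y` map to one and the same branch of `C₂`. -/
def Collapses {C₁ C₂ : Scheme.{0}} (f : C₁ ⟶ C₂) (y : C₁) : Prop :=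
  ∃ b' : PrimeSpectrum (CompletedStalk C₂ (f y)), ∀ b ∈ branches C₁ y, branchMap f y b = b'

open Classical in
/-- The map `Γ_f` of intersection graphs induced by a finite map of curves. As a map of the
underlying topological spaces it sends cells to cells, and may contract edges to vertices. -/
noncomputable def graphMap {C₁ C₂ : Scheme.{0}} (f : C₁ ⟶ C₂) : Cell C₁ → Cell C₂
  | .green g => .green (f g)
  | .yellow y =>
      if h : Collapses f y then .green (branchComponent C₂ (f y) h.choose) else .yellow (f y)
  | .edge y b =>
      if h : Collapses f y then .green (branchComponent C₂ (f y) h.choose)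
      else .edge (f y) (branchMap f y b)

/-- The set `E_y` of edges adjacent to a yellow vertex `y`. -/
def edgesAt (C : Scheme.{0}) (y : C) : Set (Cell C) := Cell.edge y '' branches C y

open Classical in
/-- The branch injectivity failure of `Γ_f` at a yellow vertex `y`: it is `#E_y - #Γ_f(E_y)` if
`Γ_f(y)` is yellow, and `0` otherwise. -/
noncomputable def branchFailure {C₁ C₂ : Scheme.{0}} (f : C₁ ⟶ C₂) (y : C₁) : ℤ :=
  if Collapses f y then 0
  else ((edgesAt C₁ y).ncard : ℤ) - ((graphMap f '' edgesAt C₁ y).ncard : ℤ)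

/-- The component injectivity failure of `Γ_f` at a green vertex `g`: the degree of `f` on the
reduced component with generic point `g`, that is `[κ(g) : κ(f(g))]`, minus one. -/
noncomputable def componentFailure {C₁ C₂ : Scheme.{0}} (f : C₁ ⟶ C₂) (g : C₁) : ℤ :=
  (f.residueDegree g : ℤ) - 1

/-- The multiplicity of a green vertex `g` of `C`: the length of the local ring of `C` at `g`. -/
noncomputable def multiplicity (C : Scheme.{0}) (g : C) : ℕ :=
  (Module.length (C.presheaf.stalk g) (C.presheaf.stalk g)).toNat

/-! ### S2 schemes, normalizations, fibres -/

/-- `x` is a normal point of `X`: the local ring at `x` is an integrally closed domain. -/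
def IsNormalAt (X : Scheme.{0}) (x : X) : Prop :=
  IsDomain (X.presheaf.stalk x) ∧ IsIntegrallyClosed (X.presheaf.stalk x)

/-- Serre's condition S2: every local ring has depth at least `min(2, dim)`, i.e. it admits a
regular sequence in its maximal ideal of each length `n ≤ 2` that is at most its dimension. -/
def IsS2 (X : Scheme.{0}) : Prop :=
  ∀ (x : X) (n : ℕ), n ≤ 2 → (n : WithBot ℕ∞) ≤ ringKrullDim (X.presheaf.stalk x) →
    ∃ rs : List (X.presheaf.stalk x), rs.length = n ∧
      (∀ r ∈ rs, r ∈ IsLocalRing.maximalIdeal (X.presheaf.stalk x)) ∧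
      RingTheory.Sequence.IsRegular (X.presheaf.stalk x) rs

/-- `ν : X' ⟶ X` is the normalization of the variety `X`: an integral birational morphism from a
normal integral scheme. -/
structure IsNormalization {X' X : Scheme.{0}} (ν : X' ⟶ X) : Prop where
  isIntegral : IsIntegral X'
  isNormal : ∀ x : X', IsNormalAt X' x
  isIntegralHom : IsIntegralHom ν
  birational : ∃ U : X.Opens, Dense (U : Set X) ∧ IsIso (ν ∣_ U)

/-- The morphism induced by `ν : X' ⟶ X` on the fibres over `t` of `ν ≫ f` and of `f`. -/
noncomputable def fiberMap {X' X T : Scheme.{0}} (ν : X' ⟶ X) (f : X ⟶ T) (t : T) :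
    (ν ≫ f).fiber t ⟶ f.fiber t :=
  Limits.pullback.map _ _ _ _ ν (𝟙 _) (𝟙 _) (by simp) (by simp)

end IntersectionGraph

/-!
Everything is local on the central fibre `C = X₀`. Let `R` be the local ring of `X` at a point `x`
of `C`, let `t` be the image of a parameter of `T` at `0` (a nonzerodivisor by flatness), and let
`R'` be the semilocal ring of `X'` over `x`, a finite extension of `R` in its fraction field
(`nonempty_semilocalRing`). Its localizations `S i` at the maximal ideals are the local rings of
`X'` over `x`, and the local rings of the fibres are `R ⧸ (t)` and `S i ⧸ (t)`. Since `X` is normal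
off the fibre, `tⁿ R' ⊆ R` for some `n` (`exists_pow_smul_mem_range`).

The main point is that the branches of `C` at `x` are connected by the points of `X'₀` above:
for every partition of the set of branches into two nonempty parts, some point above has branches
mapping to both parts (`exists_branches_separated`). This is a variant of Hartshorne's
connectedness theorem (`eq_empty_or_eq_univ_of_depth`). The ring `R̂ ⊗ R'` is the product of the
completions of the `S i`. If a set of factors could be split off, its idempotent `e` would satisfy
`𝔪ᵏ e ⊆ R̂` for some `k`, because the ideal of elements of `R̂` that multiply `e` into `R̂` contains
`tⁿ` and lies in no nonmaximal prime that contains `t`. As `R` has depth two, this forces `e ∈ R̂`,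
and the local ring `R̂` has no nontrivial idempotents. Depth two fails only at the generic points of
`C`, where `R` is one-dimensional; there `R' ⧸ tR'` and `R ⧸ tR` have the same length
(`length_quotient_smul_eq`), so the degrees over a component add up to at most its multiplicity
(`sum_finrank_le_length`). These facts are collected in `IsBranchConnectedAt` and
`isBranchConnectedAt_fiberMap`.

Surjectivity of `Γ_ν` follows by applying connectedness to a single branch. For the Euler
characteristic, a family of sets `H i` that connects a set of `n` elements satisfies
`n - 1 ≤ ∑ (#H i - 1)` (`ncard_le_of_connected`). Applied to the images of the sets of branches at
the points above, this bounds the contribution of the yellow vertices of `C`, and the bound on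
degrees takes care of the green vertices. The failures `ζ` are nonnegative, hence vanish if they
add up to zero.

Finiteness of the graphs comes from finiteness of normalization: at all but finitely many points
of a curve over a field of characteristic zero, the maximal ideal of the local ring is principal up
to nilpotents, and then there is only one branch (`exists_finite_subsingleton_minimalPrimes`).
-/

namespace IntersectionGraph

open IsLocalRing
open scoped TensorProduct nonZeroDivisors

/-! ### Completions of Noetherian local rings -/

/-- An adic completion of a Noetherian ring is a quotient of a power series ring over it. -/
theorem isNoetherianRing_adicCompletion {R : Type*} [CommRing R] [IsNoetherianRing R]
    (I : Ideal R) : IsNoetherianRing (AdicCompletion I R) := by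
  obtain ⟨n, a, ha⟩ := Submodule.fg_iff_exists_fin_generating_family.mp
    ((isNoetherianRing_iff_ideal_fg R).mp inferInstance I)
  let A := MvPolynomial (Fin n) R
  let J : Ideal A := MvPolynomial.idealOfVars (Fin n) R
  let θ : A →+* R := (MvPolynomial.aeval a : A →ₐ[R] R)
  have hθ : J.map θ = I := by
    rw [← ha]
    change Ideal.map θ (Ideal.span _) = Ideal.span _
    rw [Ideal.map_span, ← Set.range_comp]
    congr 2
    ext i
    exact MvPolynomial.aeval_X a i
  have hle (k : ℕ) : J ^ k ≤ (I ^ k).comap θ := by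
    rw [← Ideal.map_le_iff_le_comap, Ideal.map_pow, hθ]
  let F (k : ℕ) : AdicCompletion J A →+* R ⧸ I ^ k :=
    (Ideal.quotientMap (I ^ k) θ (hle k)).comp (AdicCompletion.evalₐ J k : _ →+* _)
  have hF {k l : ℕ} (hkl : k ≤ l) : (Ideal.Quotient.factorPow I hkl).comp (F l) = F k := by
    ext x
    obtain ⟨b, rfl⟩ := AdicCompletion.mk_surjective _ _ x
    have hb : Ideal.Quotient.mk (J ^ k) (b k) = Ideal.Quotient.mk (J ^ k) (b l) := by
      have h := b.2 hkl
      rw [SModEq.sub_mem] at h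
      exact Ideal.Quotient.eq.mpr (by simpa using h)
    have hb' := congrArg (Ideal.quotientMap (I ^ k) θ (hle k)) hb
    simpa [F, AdicCompletion.evalₐ_mk] using hb'.symm
  let ψ : AdicCompletion J A →+* AdicCompletion I R := AdicCompletion.liftRingHom I F hF
  have hψ (p : A) : ψ (algebraMap A _ p) = algebraMap R _ (θ p) := by
    refine AdicCompletion.ext_evalₐ fun k => ?_
    simp [ψ, F, AdicCompletion.evalₐ_liftRingHom, AdicCompletion.algebraMap_apply]
  have hIfg : I.FG := (isNoetherianRing_iff_ideal_fg R).mp inferInstance I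
  have hJfg : J.FG := MvPolynomial.idealOfVars_fg _ _
  have hmap : (J.map (algebraMap A (AdicCompletion J A))).map ψ =
      I.map (algebraMap R (AdicCompletion I R)) := by
    have h : ψ.comp (algebraMap A _) = (algebraMap R (AdicCompletion I R)).comp θ :=
      RingHom.ext hψ
    rw [Ideal.map_map, h, ← Ideal.map_map, hθ]
  have h1 : IsAdicComplete (J.map (algebraMap A (AdicCompletion J A))) (AdicCompletion J A) :=
    AdicCompletion.isAdicComplete_self J hJfg
  have h2 : IsAdicComplete (I.map (algebraMap R (AdicCompletion I R))) (AdicCompletion I R) :=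
    AdicCompletion.isAdicComplete_self I hIfg
  have h3 : IsHausdorff ((J.map (algebraMap A (AdicCompletion J A))).map ψ)
      (AdicCompletion I R) := hmap ▸ h2.toIsHausdorff
  have hsurj : Function.Surjective ψ := by
    refine surjective_of_mk_map_comp_surjective
      (I := J.map (algebraMap A (AdicCompletion J A))) ψ fun y => ?_
    obtain ⟨y, rfl⟩ := Ideal.Quotient.mk_surjective y
    obtain ⟨r, hr⟩ := Ideal.Quotient.mk_surjective (AdicCompletion.evalOneₐ I y)
    refine ⟨algebraMap A _ (MvPolynomial.C r), ?_⟩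
    rw [RingHom.comp_apply, Ideal.Quotient.eq, hmap, ← AdicCompletion.ker_evalOneₐ_eq_map I hIfg,
      RingHom.mem_ker, hψ]
    have hθC : θ (MvPolynomial.C r) = r := MvPolynomial.aeval_C a r
    simp [hθC, AdicCompletion.algebraMap_apply, AdicCompletion.evalOneₐ_of, ← hr]
  have : IsNoetherianRing (AdicCompletion J A) :=
    isNoetherianRing_of_ringEquiv (MvPowerSeries (Fin n) R)
      (MvPowerSeries.toAdicCompletionAlgEquiv (Fin n) R).toRingEquiv
  exact isNoetherianRing_of_surjective _ _ ψ hsurj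

instance {R : Type*} [CommRing R] [IsLocalRing R] [IsNoetherianRing R] :
    IsNoetherianRing (AdicCompletion (maximalIdeal R) R) :=
  isNoetherianRing_adicCompletion _

section
variable {R S : Type*} [CommRing R] [IsLocalRing R] [CommRing S] [IsLocalRing S]

theorem evalₐ_completionMap (φ : R →+* S) [IsLocalHom φ] (n : ℕ)
    (x : AdicCompletion (maximalIdeal R) R) :
    AdicCompletion.evalₐ (maximalIdeal S) n (completionMap φ x) =
      Ideal.quotientMap (maximalIdeal S ^ n) φ (maximalIdeal_pow_le_comap φ n)
        (AdicCompletion.evalₐ (maximalIdeal R) n x) := by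
  simp [completionMap, completionMapAux, AdicCompletion.evalₐ_liftRingHom]

@[simp]
theorem completionMap_algebraMap (φ : R →+* S) [IsLocalHom φ] (r : R) :
    completionMap φ (algebraMap R _ r) = algebraMap S _ (φ r) := by
  refine AdicCompletion.ext_evalₐ fun n => ?_
  rw [evalₐ_completionMap]
  simp [AdicCompletion.algebraMap_apply]

theorem completionMap_comp {A : Type*} [CommRing A] [IsLocalRing A] (φ : R →+* S) [IsLocalHom φ]
    (ψ : S →+* A) [IsLocalHom ψ] [IsLocalHom (ψ.comp φ)] :
    completionMap (ψ.comp φ) = (completionMap ψ).comp (completionMap φ) := by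
  ext1 x
  refine AdicCompletion.ext_evalₐ fun n => ?_
  rw [RingHom.comp_apply, evalₐ_completionMap, evalₐ_completionMap, evalₐ_completionMap]
  obtain ⟨r, hr⟩ := Ideal.Quotient.mk_surjective (AdicCompletion.evalₐ (maximalIdeal R) n x)
  rw [← hr]
  simp

theorem map_maximalIdeal_le (φ : R →+* S) [IsLocalHom φ] :
    (maximalIdeal R).map φ ≤ maximalIdeal S :=
  ((local_hom_TFAE φ).out 0 2).mp ‹_›

theorem map_maximalIdeal_of_surjective (φ : R →+* S) [IsLocalHom φ]
    (hφ : Function.Surjective φ) : (maximalIdeal R).map φ = maximalIdeal S := by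
  refine le_antisymm (map_maximalIdeal_le φ) fun s hs => ?_
  obtain ⟨r, rfl⟩ := hφ s
  exact Ideal.mem_map_of_mem _ ((mem_maximalIdeal r).mpr fun h =>
    (mem_maximalIdeal _).mp hs (h.map φ))

variable [IsNoetherianRing R] [IsNoetherianRing S]

theorem evalₐ_eq_zero_iff (n : ℕ) (x : AdicCompletion (maximalIdeal R) R) :
    AdicCompletion.evalₐ (maximalIdeal R) n x = 0 ↔
      x ∈ maximalIdeal (AdicCompletion (maximalIdeal R) R) ^ n := by
  have h := AdicCompletion.pow_smul_top_eq_ker_eval (I := maximalIdeal R) (M := R) (n := n)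
    (maximalIdeal R).fg_of_isNoetherianRing
  rw [AdicCompletion.maximalIdeal_eq_map, ← Ideal.map_pow, ← Submodule.restrictScalars_mem R,
    ← Ideal.smul_top_eq_map, h, LinearMap.mem_ker]
  have hle : maximalIdeal R ^ n • (⊤ : Ideal R) ≤ maximalIdeal R ^ n := by simp
  rw [← AdicCompletion.factor_eval_eq_evalₐ _ x hle]
  have heq : maximalIdeal R ^ n • (⊤ : Ideal R) = maximalIdeal R ^ n := by simp
  have hinj : Function.Injective (Ideal.Quotient.factor hle) := by
    rw [injective_iff_map_eq_zero]
    intro z hz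
    obtain ⟨z, rfl⟩ := Ideal.Quotient.mk_surjective z
    rw [Ideal.Quotient.factor_mk, Ideal.Quotient.eq_zero_iff_mem] at hz
    rw [Ideal.Quotient.eq_zero_iff_mem, heq]
    exact hz
  exact map_eq_zero_iff _ hinj

theorem exists_sub_algebraMap_mem_pow (n : ℕ) (x : AdicCompletion (maximalIdeal R) R) :
    ∃ r : R, x - algebraMap R _ r ∈ maximalIdeal (AdicCompletion (maximalIdeal R) R) ^ n := by
  obtain ⟨r, hr⟩ := Ideal.Quotient.mk_surjective (AdicCompletion.evalₐ (maximalIdeal R) n x)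
  refine ⟨r, ?_⟩
  rw [← evalₐ_eq_zero_iff, map_sub, ← hr]
  simp [AdicCompletion.algebraMap_apply]

theorem algebraMap_mem_pow_iff (n : ℕ) (r : R) :
    algebraMap R (AdicCompletion (maximalIdeal R) R) r ∈
      maximalIdeal (AdicCompletion (maximalIdeal R) R) ^ n ↔ r ∈ maximalIdeal R ^ n := by
  rw [← evalₐ_eq_zero_iff, AdicCompletion.algebraMap_apply]
  simp [Ideal.Quotient.eq_zero_iff_mem]

theorem completionMap_maximalIdeal_le (φ : R →+* S) [IsLocalHom φ] :
    (maximalIdeal (AdicCompletion (maximalIdeal R) R)).map (completionMap φ) ≤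
      maximalIdeal (AdicCompletion (maximalIdeal S) S) := by
  rw [AdicCompletion.maximalIdeal_eq_map, AdicCompletion.maximalIdeal_eq_map, Ideal.map_map,
    Ideal.map_le_iff_le_comap]
  intro r hr
  rw [Ideal.mem_comap, RingHom.comp_apply, completionMap_algebraMap]
  exact Ideal.mem_map_of_mem _ (map_maximalIdeal_le φ (Ideal.mem_map_of_mem _ hr))

instance isLocalHom_completionMap (φ : R →+* S) [IsLocalHom φ] :
    IsLocalHom (completionMap φ) :=
  ((local_hom_TFAE _).out 0 2).mpr (completionMap_maximalIdeal_le φ)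

theorem completionMap_surjective (φ : R →+* S) [IsLocalHom φ] (hφ : Function.Surjective φ) :
    Function.Surjective (completionMap φ) := by
  have hm := map_maximalIdeal_of_surjective φ hφ
  have hmap : (maximalIdeal (AdicCompletion (maximalIdeal R) R)).map (completionMap φ) =
      maximalIdeal (AdicCompletion (maximalIdeal S) S) := by
    have h : (completionMap φ).comp (algebraMap R _) = (algebraMap S _).comp φ :=
      RingHom.ext (completionMap_algebraMap φ)
    rw [AdicCompletion.maximalIdeal_eq_map, AdicCompletion.maximalIdeal_eq_map, Ideal.map_map,
      h, ← Ideal.map_map, hm]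
  have : IsHausdorff ((maximalIdeal (AdicCompletion (maximalIdeal R) R)).map (completionMap φ))
      (AdicCompletion (maximalIdeal S) S) := hmap ▸ inferInstance
  refine surjective_of_mk_map_comp_surjective
    (I := maximalIdeal (AdicCompletion (maximalIdeal R) R)) _ fun y => ?_
  obtain ⟨y, rfl⟩ := Ideal.Quotient.mk_surjective y
  obtain ⟨s, hs⟩ := exists_sub_algebraMap_mem_pow 1 y
  obtain ⟨r, rfl⟩ := hφ s
  refine ⟨algebraMap R _ r, ?_⟩
  rw [RingHom.comp_apply, eq_comm, Ideal.Quotient.eq, hmap, completionMap_algebraMap]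
  simpa using hs

/-- The completion of `R ⧸ (t)` is the quotient of the completion of `R` by `t`. -/
theorem ker_completionMap (φ : R →+* S) [IsLocalHom φ] (hφ : Function.Surjective φ) (t : R)
    (ht : RingHom.ker φ = Ideal.span {t}) :
    RingHom.ker (completionMap φ) = Ideal.span {algebraMap R _ t} := by
  refine le_antisymm (fun x hx => ?_) ?_
  · have hxn (n : ℕ) : x ∈ Ideal.span {algebraMap R _ t} ⊔
        maximalIdeal (AdicCompletion (maximalIdeal R) R) ^ n := by
      obtain ⟨r, hr⟩ := exists_sub_algebraMap_mem_pow n x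
      have h1 : algebraMap S (AdicCompletion (maximalIdeal S) S) (φ r) ∈
          maximalIdeal (AdicCompletion (maximalIdeal S) S) ^ n := by
        have := Ideal.pow_right_mono (completionMap_maximalIdeal_le φ) n
          (by rw [← Ideal.map_pow]; exact Ideal.mem_map_of_mem _ hr)
        rw [map_sub, RingHom.mem_ker.mp hx, completionMap_algebraMap, zero_sub] at this
        simpa using this
      rw [algebraMap_mem_pow_iff] at h1
      have hm : (maximalIdeal R ^ n).map φ = maximalIdeal S ^ n := by
        rw [Ideal.map_pow, map_maximalIdeal_of_surjective φ hφ]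
      rw [← hm, Ideal.mem_map_iff_of_surjective _ hφ] at h1
      obtain ⟨r', hr', h⟩ := h1
      have h2 : r - r' ∈ Ideal.span {t} := by
        rw [← ht, RingHom.mem_ker, map_sub, h, sub_self]
      have h3 : x = algebraMap R _ (r - r') + (algebraMap R _ r' + (x - algebraMap R _ r)) := by
        rw [map_sub]; ring
      rw [h3]
      refine Submodule.add_mem_sup ?_ (Ideal.add_mem _ ((algebraMap_mem_pow_iff n r').mpr hr') hr)
      rw [← Set.image_singleton, ← Ideal.map_span]
      exact Ideal.mem_map_of_mem _ h2
    have := IsHausdorff.haus (I := maximalIdeal (AdicCompletion (maximalIdeal R) R))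
      (M := AdicCompletion (maximalIdeal R) R ⧸
        Ideal.span {algebraMap R (AdicCompletion (maximalIdeal R) R) t}) inferInstance
      (Ideal.Quotient.mk _ x) (fun n => by
        rw [SModEq.zero, Ideal.smul_top_eq_map]
        have h := Ideal.mem_map_of_mem (Ideal.Quotient.mk
          (Ideal.span {algebraMap R (AdicCompletion (maximalIdeal R) R) t})) (hxn n)
        rw [Ideal.map_sup, Ideal.map_quotient_self, bot_sup_eq] at h
        exact h)
    rwa [Ideal.Quotient.eq_zero_iff_mem] at this
  · rw [Ideal.span_singleton_le_iff_mem, RingHom.mem_ker, completionMap_algebraMap]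
    have : φ t = 0 := by
      rw [← RingHom.mem_ker, ht]; exact Ideal.mem_span_singleton_self t
    rw [this, map_zero]
end

/-! ### Completing a finite algebra over a local ring -/

section
/-- An element outside of a maximal ideal is invertible modulo each power of this ideal. -/
theorem exists_mul_sub_one_mem_pow {A : Type*} [CommRing A] (m : Ideal A) [m.IsMaximal] {b : A}
    (hb : b ∉ m) (n : ℕ) : ∃ c, b * c - 1 ∈ m ^ n := by
  obtain ⟨c, i, hi, h⟩ := Ideal.IsMaximal.exists_inv ‹m.IsMaximal› hb
  have h1 : m ⊔ Ideal.span {b} = ⊤ := by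
    rw [Ideal.eq_top_iff_one, ← h, add_comm]
    exact Submodule.add_mem_sup hi (Ideal.mul_mem_left _ _ (Ideal.mem_span_singleton_self b))
  have h2 : (1 : A) ∈ m ^ n ⊔ Ideal.span {b} := by
    rw [Ideal.pow_sup_eq_top h1]; exact Submodule.mem_top
  obtain ⟨x, hx, y, hy, hxy⟩ := Submodule.mem_sup.mp h2
  obtain ⟨c, rfl⟩ := Ideal.mem_span_singleton'.mp hy
  refine ⟨c, ?_⟩
  have : b * c - 1 = -x := by linear_combination hxy
  rw [this]
  exact neg_mem hx

variable {A S : Type*} [CommRing A] [CommRing S] [IsLocalRing S] [Algebra A S] (m : Ideal A)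
  [m.IsMaximal] [IsLocalization.AtPrime S m]

/-- `A ⧸ mⁿ → S ⧸ mⁿS` is surjective for the localization `S` of `A` at a maximal ideal `m`. -/
theorem exists_sub_algebraMap_mem_maximalIdeal_pow (m : Ideal A)
    [m.IsMaximal] [IsLocalization.AtPrime S m] (s : S) (n : ℕ) :
    ∃ a : A, s - algebraMap A S a ∈ maximalIdeal S ^ n := by
  obtain ⟨a, b, rfl⟩ := IsLocalization.exists_mk'_eq m.primeCompl s
  obtain ⟨c, hc⟩ := exists_mul_sub_one_mem_pow m b.2 n
  refine ⟨a * c, ?_⟩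
  have h : IsLocalization.mk' S a b - algebraMap A S (a * c) =
      -(IsLocalization.mk' S a b * algebraMap A S (b * c - 1)) := by
    have := IsLocalization.mk'_spec S a b
    rw [map_sub, map_mul, map_mul, map_one, mul_sub, ← mul_assoc, this]
    ring
  rw [h, ← IsLocalization.AtPrime.map_eq_maximalIdeal m S, ← Ideal.map_pow]
  exact neg_mem (Ideal.mul_mem_left _ _ (Ideal.mem_map_of_mem _ hc))

theorem algebraMap_mem_maximalIdeal_pow_iff (a : A) (n : ℕ) :
    algebraMap A S a ∈ maximalIdeal S ^ n ↔ a ∈ m ^ n := by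
  rw [← IsLocalization.AtPrime.map_eq_maximalIdeal m S, ← Ideal.map_pow]
  refine ⟨fun h => ?_, Ideal.mem_map_of_mem _⟩
  rw [IsLocalization.mem_map_algebraMap_iff m.primeCompl] at h
  obtain ⟨⟨x, b⟩, h⟩ := h
  rw [← map_mul, IsLocalization.eq_iff_exists m.primeCompl] at h
  obtain ⟨d, hd⟩ := h
  have hdb : (d * b : A) ∉ m := (d * b).2
  obtain ⟨c, hc⟩ := exists_mul_sub_one_mem_pow m hdb n
  have : a = d * x * c - a * (d * b * c - 1) := by
    simp only at hd
    linear_combination c * hd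
  rw [this]
  exact sub_mem (Ideal.mul_mem_right _ _ (Ideal.mul_mem_left _ _ x.2)) (Ideal.mul_mem_left _ _ hc)
end

section
/-- The product of all maximal ideals of a finite algebra over a local ring `R` is nilpotent
modulo the maximal ideal of `R`. -/
theorem exists_prod_pow_le {R R' : Type*} [CommRing R] [IsLocalRing R] [IsNoetherianRing R]
    [CommRing R'] [Algebra R R'] [Module.Finite R R'] {ι : Type*} [Fintype ι] (m : ι → Ideal R')
    (hmax : ∀ n : Ideal R', n.IsMaximal → ∃ i, n = m i) :
    ∃ N, (∏ i, m i) ^ N ≤ (maximalIdeal R).map (algebraMap R R') := by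
  have : IsNoetherianRing R' := IsNoetherianRing.of_finite R R'
  refine Ideal.exists_pow_le_of_le_radical_of_fg ?_ (Ideal.fg_of_isNoetherianRing _)
  rw [Ideal.radical_eq_sInf]
  refine le_sInf fun q ⟨hq, hqp⟩ => ?_
  have hc : (q.comap (algebraMap R R')).IsMaximal := by
    have : q.comap (algebraMap R R') = maximalIdeal R :=
      le_antisymm (le_maximalIdeal (Ideal.comap_ne_top _ hqp.ne_top)) (Ideal.map_le_iff_le_comap.mp hq)
    rw [this]; infer_instance
  obtain ⟨i, rfl⟩ := hmax q (Ideal.isMaximal_of_isIntegral_of_isMaximal_comap q hc)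
  exact Ideal.prod_le_inf.trans (Finset.inf_le (Finset.mem_univ i))

/-- The map `R̂ ⊗ R' → Ŝ` for a local ring `S` over the finite `R`-algebra `R'`. -/
noncomputable def tensorToCompletion (R R' S : Type) [CommRing R] [IsLocalRing R] [CommRing R']
    [Algebra R R'] [CommRing S] [IsLocalRing S] [Algebra R' S] [Algebra R S] [IsScalarTower R R' S]
    [IsLocalHom (algebraMap R S)] :
    AdicCompletion (maximalIdeal R) R ⊗[R] R' →ₐ[R] AdicCompletion (maximalIdeal S) S :=
  Algebra.TensorProduct.lift
    { completionMap (algebraMap R S) with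
      commutes' := fun r => completionMap_algebraMap (algebraMap R S) r }
    ((IsScalarTower.toAlgHom R S (AdicCompletion (maximalIdeal S) S)).comp
      (IsScalarTower.toAlgHom R R' S))
    fun _ _ => Commute.all _ _

variable {R R' : Type} [CommRing R] [IsLocalRing R] [CommRing R'] [Algebra R R']

@[simp]
theorem tensorToCompletion_tmul (S : Type) [CommRing S] [IsLocalRing S] [Algebra R' S] [Algebra R S]
    [IsScalarTower R R' S] [IsLocalHom (algebraMap R S)]
    (x : AdicCompletion (maximalIdeal R) R) (z : R') :
    tensorToCompletion R R' S (x ⊗ₜ z) =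
      completionMap (algebraMap R S) x * algebraMap S _ (algebraMap R' S z) := by
  simp [tensorToCompletion]
  rfl

/-- Elements of `R̂ ⊗ R'` are approximated by elements of `R'`. -/
theorem exists_sub_one_tmul_mem_map_pow [IsNoetherianRing R] (k : ℕ)
    (z : AdicCompletion (maximalIdeal R) R ⊗[R] R') :
    ∃ r : R', z - 1 ⊗ₜ r ∈ ((maximalIdeal R) ^ k).map
      (algebraMap R (AdicCompletion (maximalIdeal R) R ⊗[R] R')) := by
  induction z with
  | zero => exact ⟨0, by simp⟩
  | add x y hx hy =>
    obtain ⟨a, ha⟩ := hx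
    obtain ⟨b, hb⟩ := hy
    refine ⟨a + b, ?_⟩
    rw [TensorProduct.tmul_add, add_sub_add_comm]
    exact add_mem ha hb
  | tmul x y =>
    obtain ⟨r, hr⟩ := exists_sub_algebraMap_mem_pow k x
    refine ⟨r • y, ?_⟩
    rw [AdicCompletion.maximalIdeal_eq_map, ← Ideal.map_pow] at hr
    have h := Ideal.mem_map_of_mem (algebraMap _ (AdicCompletion (maximalIdeal R) R ⊗[R] R')) hr
    rw [Ideal.map_map, ← IsScalarTower.algebraMap_eq] at h
    have h2 := Ideal.mul_mem_right (1 ⊗ₜ[R] y) _ h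
    convert h2 using 1
    rw [TensorProduct.tmul_smul, TensorProduct.smul_tmul', map_sub, sub_mul]
    simp [Algebra.TensorProduct.algebraMap_apply, Algebra.smul_def]

theorem map_maximalIdeal_pow_le (R S : Type) [CommRing R] [IsLocalRing R] [CommRing S]
    [IsLocalRing S] [IsNoetherianRing S] [Algebra R S] [IsLocalHom (algebraMap R S)] (k : ℕ) :
    (maximalIdeal R ^ k).map (algebraMap R (AdicCompletion (maximalIdeal S) S)) ≤
      maximalIdeal (AdicCompletion (maximalIdeal S) S) ^ k := by
  rw [Ideal.map_pow, IsScalarTower.algebraMap_eq R S, ← Ideal.map_map]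
  refine Ideal.pow_right_mono ?_ k
  rw [AdicCompletion.maximalIdeal_eq_map]
  exact Ideal.map_mono (map_maximalIdeal_le _)

variable [IsNoetherianRing R] [Module.Finite R R'] {ι : Type} [Finite ι]
  (S : ι → Type) [∀ i, CommRing (S i)] [∀ i, IsLocalRing (S i)]
  [∀ i, IsNoetherianRing (S i)] [∀ i, Algebra R' (S i)] [∀ i, Algebra R (S i)]
  [∀ i, IsScalarTower R R' (S i)] [∀ i, IsLocalHom (algebraMap R (S i))]
  (m : ι → Ideal R') [∀ i, (m i).IsMaximal] [∀ i, IsLocalization.AtPrime (S i) (m i)]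

include m in
/-- The map `R̂ ⊗ R' → ∏ i, Ŝ i` is injective, where `S i` are the localizations of `R'` at its
maximal ideals. -/
theorem tensorToCompletion_pi_injective
    (hmax : ∀ n : Ideal R', n.IsMaximal → ∃ i, n = m i) (hinj : Function.Injective m)
    (z : AdicCompletion (maximalIdeal R) R ⊗[R] R') (hz : ∀ i, tensorToCompletion R R' (S i) z = 0) :
    z = 0 := by
  have := Fintype.ofFinite ι
  obtain ⟨N, hN⟩ := exists_prod_pow_le (R := R) m hmax
  have hcop (k : ℕ) : (⨅ i, m i ^ k) = (∏ i, m i) ^ k := by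
    rw [← Finset.prod_pow, Ideal.prod_eq_iInf_of_pairwise_isCoprime
      fun i _ j _ hij => (Ideal.isCoprime_of_isMaximal (hinj.ne hij)).pow]
    simp
  -- an element of `R'` close to `z` lies in high powers of all `m i`, hence is itself close to zero
  have hzk (k : ℕ) : z ∈ (maximalIdeal R ^ k).map
      (algebraMap R (AdicCompletion (maximalIdeal R) R ⊗[R] R')) := by
    obtain ⟨r, hr⟩ := exists_sub_one_tmul_mem_map_pow (N * k + k) z
    have hri (i : ι) : r ∈ m i ^ (N * k) := by
      have h1 := Ideal.mem_map_of_mem (tensorToCompletion R R' (S i)) hr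
      rw [map_sub, hz i, tensorToCompletion_tmul, map_one, one_mul, zero_sub, neg_mem_iff] at h1
      have h2 : ((maximalIdeal R ^ (N * k + k)).map (algebraMap R
          (AdicCompletion (maximalIdeal R) R ⊗[R] R'))).map (tensorToCompletion R R' (S i)) ≤
          maximalIdeal (AdicCompletion (maximalIdeal (S i)) (S i)) ^ (N * k) := by
        rw [Ideal.map_le_iff_le_comap, Ideal.map_le_iff_le_comap]
        intro a ha
        rw [Ideal.mem_comap, Ideal.mem_comap, AlgHom.commutes]
        exact Ideal.pow_le_pow_right (Nat.le_add_right _ _)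
          (map_maximalIdeal_pow_le R (S i) _ (Ideal.mem_map_of_mem _ ha))
      rw [← algebraMap_mem_maximalIdeal_pow_iff (S := S i), ← algebraMap_mem_pow_iff]
      exact h2 h1
    have hr2 : r ∈ (maximalIdeal R ^ k).map (algebraMap R R') := by
      have : r ∈ ⨅ i, m i ^ (N * k) := by simpa using hri
      rw [hcop, pow_mul] at this
      rw [Ideal.map_pow]
      exact Ideal.pow_right_mono hN k this
    have hr3 : (1 : AdicCompletion (maximalIdeal R) R) ⊗ₜ[R] r ∈ (maximalIdeal R ^ k).map
        (algebraMap R (AdicCompletion (maximalIdeal R) R ⊗[R] R')) := by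
      have := Ideal.mem_map_of_mem (Algebra.TensorProduct.includeRight :
        R' →ₐ[R] AdicCompletion (maximalIdeal R) R ⊗[R] R') hr2
      have h := (Algebra.TensorProduct.includeRight :
        R' →ₐ[R] AdicCompletion (maximalIdeal R) R ⊗[R] R').comp_algebraMap
      rw [← h, ← Ideal.map_map]
      exact this
    have hr4 := Ideal.map_mono (f := algebraMap R (AdicCompletion (maximalIdeal R) R ⊗[R] R'))
      (Ideal.pow_le_pow_right (I := maximalIdeal R) (Nat.le_add_left k (N * k))) hr
    simpa using add_mem hr4 hr3
  have := IsHausdorff.haus (I := maximalIdeal (AdicCompletion (maximalIdeal R) R))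
      (M := AdicCompletion (maximalIdeal R) R ⊗[R] R') inferInstance z
  refine this fun k => ?_
  rw [SModEq.zero, Ideal.smul_top_eq_map, AdicCompletion.maximalIdeal_eq_map, ← Ideal.map_pow,
    Ideal.map_map, ← IsScalarTower.algebraMap_eq]
  exact hzk k

include m in
/-- The map `R̂ ⊗ R' → ∏ i, Ŝ i` is surjective. By completeness it suffices to check this modulo the
maximal ideal of `R`, where it follows from the Chinese remainder theorem. -/
theorem tensorToCompletion_pi_surjective
    (hmax : ∀ n : Ideal R', n.IsMaximal → ∃ i, n = m i) (hinj : Function.Injective m)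
    (x : ∀ i, AdicCompletion (maximalIdeal (S i)) (S i)) :
    ∃ z, ∀ i, tensorToCompletion R R' (S i) z = x i := by
  have := Fintype.ofFinite ι
  obtain ⟨N, hN⟩ := exists_prod_pow_le (R := R) m hmax
  let Φ : AdicCompletion (maximalIdeal R) R ⊗[R] R' →ₗ[R]
      ∀ i, AdicCompletion (maximalIdeal (S i)) (S i) :=
    LinearMap.pi fun i => (tensorToCompletion R R' (S i)).toLinearMap
  let e := (AdicCompletion.ofTensorProductEquivOfFiniteNoetherian (maximalIdeal R) R')
  let Ψ : AdicCompletion (maximalIdeal R) R' →ₗ[R]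
      ∀ i, AdicCompletion (maximalIdeal (S i)) (S i) :=
    Φ ∘ₗ (e.symm.toLinearMap.restrictScalars R)
  have hle (i : ι) (k : ℕ) : maximalIdeal R ^ k • (⊤ : Submodule R
      (AdicCompletion (maximalIdeal (S i)) (S i))) ≤ (maximalIdeal
      (AdicCompletion (maximalIdeal (S i)) (S i)) ^ k).restrictScalars R := by
    rw [Ideal.smul_top_eq_map]
    exact map_maximalIdeal_pow_le R (S i) k
  have hN' (i : ι) : maximalIdeal (S i) ^ N ≤ (maximalIdeal R).map (algebraMap R (S i)) := by
    classical
    have h := Ideal.map_mono (f := algebraMap R' (S i)) hN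
    rw [Ideal.map_map, ← IsScalarTower.algebraMap_eq, Ideal.map_pow] at h
    refine le_trans (Ideal.pow_right_mono ?_ N) h
    change _ ≤ Ideal.mapHom (algebraMap R' (S i)) (∏ i, m i)
    rw [map_prod, Finset.prod_eq_single i]
    · exact (IsLocalization.AtPrime.map_eq_maximalIdeal (m i) (S i)).ge
    · intro j _ hji
      obtain ⟨b, hb, hbi⟩ := Set.not_subset.mp fun h : (m j : Set R') ⊆ m i =>
        hji (hinj (Ideal.IsMaximal.eq_of_le inferInstance (Ideal.IsMaximal.ne_top inferInstance) h))
      refine Ideal.one_eq_top (R := S i) ▸ Ideal.eq_top_of_isUnit_mem _ (Ideal.mem_map_of_mem _ hb)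
        (IsLocalization.map_units (M := (m i).primeCompl) (S i) ⟨b, hbi⟩)
    · simp
  have h1 : IsAdicComplete (maximalIdeal R) (AdicCompletion (maximalIdeal R) R') :=
    AdicCompletion.isAdicComplete (maximalIdeal R).fg_of_isNoetherianRing
  have h2 : IsHausdorff (maximalIdeal R) (∀ i, AdicCompletion (maximalIdeal (S i)) (S i)) := by
    refine ⟨fun y hy => funext fun i => ?_⟩
    refine IsHausdorff.haus (I := maximalIdeal (AdicCompletion (maximalIdeal (S i)) (S i)))
      inferInstance _ fun k => ?_
    rw [SModEq.zero, smul_eq_mul, Ideal.mul_top]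
    have := hy k
    rw [SModEq.zero] at this
    refine hle i k ?_
    have h := Submodule.mem_map_of_mem (f := LinearMap.proj i) this
    rw [Submodule.map_smul''] at h
    exact Submodule.smul_mono le_rfl le_top h
  have h3 : Function.Surjective Ψ := by
    refine surjective_of_mkQ_comp_surjective (I := maximalIdeal R) fun y => ?_
    obtain ⟨y, rfl⟩ := Submodule.mkQ_surjective _ y
    have hy (i : ι) : ∃ r : R', y i - algebraMap (S i) _ (algebraMap R' (S i) r) ∈
        maximalIdeal (AdicCompletion (maximalIdeal (S i)) (S i)) ^ N := by
      obtain ⟨s, hs⟩ := exists_sub_algebraMap_mem_pow N (y i)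
      obtain ⟨r, hr⟩ := exists_sub_algebraMap_mem_maximalIdeal_pow (m i) s N
      refine ⟨r, ?_⟩
      have := add_mem hs ((algebraMap_mem_pow_iff N _).mpr hr)
      simpa using this
    choose r hr using hy
    obtain ⟨r', hr'⟩ := Ideal.exists_forall_sub_mem_ideal (I := fun i => m i ^ N)
      (fun i j hij => (Ideal.isCoprime_of_isMaximal (hinj.ne hij)).pow) r
    refine ⟨e (1 ⊗ₜ r'), ?_⟩
    have hΨ : Ψ (e (1 ⊗ₜ r')) = fun i => algebraMap (S i) _ (algebraMap R' (S i) r') := by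
      ext1 i
      simp [Ψ, Φ]
    rw [LinearMap.comp_apply, hΨ, eq_comm, Submodule.mkQ_apply, Submodule.mkQ_apply,
      Submodule.Quotient.eq]
    set w : ∀ i, AdicCompletion (maximalIdeal (S i)) (S i) :=
      y - fun i => algebraMap (S i) _ (algebraMap R' (S i) r') with hw
    have hd (i : ι) : w i ∈
        maximalIdeal R • (⊤ : Submodule R (AdicCompletion (maximalIdeal (S i)) (S i))) := by
      have h4 : w i ∈ maximalIdeal (AdicCompletion (maximalIdeal (S i)) (S i)) ^ N := by
        have := sub_mem (hr i) ((algebraMap_mem_pow_iff N _).mpr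
          ((algebraMap_mem_maximalIdeal_pow_iff (S := S i) (m i) _ N).mpr (hr' i)))
        simpa [hw] using this
      rw [Ideal.smul_top_eq_map, Submodule.restrictScalars_mem,
        IsScalarTower.algebraMap_eq R (S i), ← Ideal.map_map]
      rw [AdicCompletion.maximalIdeal_eq_map, ← Ideal.map_pow] at h4
      exact Ideal.map_mono (hN' i) h4
    classical
    rw [← Finset.univ_sum_single w]
    refine sum_mem fun i _ => ?_
    have h := Submodule.mem_map_of_mem
      (f := LinearMap.single R (fun i => AdicCompletion (maximalIdeal (S i)) (S i)) i) (hd i)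
    rw [Submodule.map_smul''] at h
    exact Submodule.smul_mono le_rfl le_top h
  obtain ⟨w, hw⟩ := h3 x
  exact ⟨e.symm w, fun i => congrFun hw i⟩

end

/-! ### Connectedness: lifting idempotents through depth two -/

theorem completionMap_eq_tensorToCompletion_comp (R R' S : Type) [CommRing R] [IsLocalRing R]
    [CommRing R'] [Algebra R R'] [CommRing S] [IsLocalRing S] [Algebra R' S] [Algebra R S]
    [IsScalarTower R R' S] [IsLocalHom (algebraMap R S)] :
    completionMap (algebraMap R S) =
      (tensorToCompletion R R' S).toRingHom.comp (algebraMap _ _) := by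
  ext1 r
  simp [Algebra.TensorProduct.algebraMap_apply]

section
variable {R R' : Type} [CommRing R] [IsLocalRing R] [CommRing R'] [Algebra R R']
  [IsNoetherianRing R]

/-- If `R` has depth at least two, an element of `R̂ ⊗ R'` lies in `R̂` as soon as its multiples
by a power of the maximal ideal do. -/
theorem mem_range_algebraMap_of_pow_le (a b : R) (ha : a ∈ maximalIdeal R) (hb : b ∈ maximalIdeal R)
    (hab : RingTheory.Sequence.IsWeaklyRegular R [a, b]) (haR' : IsSMulRegular R' a)
    (hR' : Function.Injective (algebraMap R R'))
    (e : AdicCompletion (maximalIdeal R) R ⊗[R] R') (k : ℕ)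
    (hk : ∀ r ∈ maximalIdeal (AdicCompletion (maximalIdeal R) R) ^ k,
      algebraMap _ (AdicCompletion (maximalIdeal R) R ⊗[R] R') r * e ∈
        (algebraMap (AdicCompletion (maximalIdeal R) R)
          (AdicCompletion (maximalIdeal R) R ⊗[R] R')).range) :
    e ∈ (algebraMap (AdicCompletion (maximalIdeal R) R)
      (AdicCompletion (maximalIdeal R) R ⊗[R] R')).range := by
  have hinj : Function.Injective (algebraMap (AdicCompletion (maximalIdeal R) R)
      (AdicCompletion (maximalIdeal R) R ⊗[R] R')) :=
    Algebra.TensorProduct.includeLeft_injective (S := AdicCompletion (maximalIdeal R) R) hR'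
  have haM : IsSMulRegular (AdicCompletion (maximalIdeal R) R ⊗[R] R') a := by
    have := Module.Flat.lTensor_preserves_injective_linearMap
      (M := AdicCompletion (maximalIdeal R) R) (LinearMap.lsmul R R' a) haR'
    intro x y hxy
    refine this ?_
    have h (z : AdicCompletion (maximalIdeal R) R ⊗[R] R') :
        LinearMap.lTensor (AdicCompletion (maximalIdeal R) R) (LinearMap.lsmul R R' a) z =
          a • z := by
      induction z with
      | zero => simp
      | add x y hx hy => rw [map_add, hx, hy, smul_add]
      | tmul x y => simp
    rw [h, h]; exact hxy
  have hreg := hab.of_flat (S := AdicCompletion (maximalIdeal R) R)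
  -- if `az = u` and `bz = v` are in `R̂`, then `bu = av`, so `a` divides `u` and `z = u / a`
  have hstep (z : AdicCompletion (maximalIdeal R) R ⊗[R] R')
      (u v : AdicCompletion (maximalIdeal R) R) (hu : algebraMap _ _ u = a • z)
      (hv : algebraMap _ _ v = b • z) :
      z ∈ (algebraMap (AdicCompletion (maximalIdeal R) R)
        (AdicCompletion (maximalIdeal R) R ⊗[R] R')).range := by
    rw [List.map_cons, List.map_singleton, RingTheory.Sequence.isWeaklyRegular_cons_iff,
      RingTheory.Sequence.isWeaklyRegular_singleton_iff] at hreg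
    have hs (c : R) (w : AdicCompletion (maximalIdeal R) R ⊗[R] R') :
      c • w = algebraMap R _ c * w := Algebra.smul_def c w
    have h1 : algebraMap R _ b * u = algebraMap R _ a * v := by
      refine hinj ?_
      rw [map_mul, map_mul, hu, hv, ← IsScalarTower.algebraMap_apply,
        ← IsScalarTower.algebraMap_apply]
      rw [hs, hs]
      ring
    have h2 : (Submodule.Quotient.mk u : QuotSMulTop (algebraMap R (AdicCompletion (maximalIdeal R) R) a)
        (AdicCompletion (maximalIdeal R) R)) = 0 := by
      refine hreg.2 ?_
      simp only [smul_zero]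
      rw [← Submodule.Quotient.mk_smul, smul_eq_mul, h1, Submodule.Quotient.mk_eq_zero]
      exact Submodule.smul_mem_pointwise_smul _ _ _ Submodule.mem_top
    rw [Submodule.Quotient.mk_eq_zero] at h2
    obtain ⟨w, -, hw⟩ := h2
    refine ⟨w, haM ?_⟩
    change a • _ = a • _
    rw [← hu, ← hw, hs, IsScalarTower.algebraMap_apply R
      (AdicCompletion (maximalIdeal R) R), ← map_mul]
    rfl
  induction k with
  | zero => simpa only [map_one, one_mul] using hk 1 (by simp)
  | succ k ih =>
    refine ih fun s hs => ?_
    have h (c : R) (hc : c ∈ maximalIdeal R) :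
        c • (algebraMap _ (AdicCompletion (maximalIdeal R) R ⊗[R] R') s * e) ∈
        (algebraMap (AdicCompletion (maximalIdeal R) R)
          (AdicCompletion (maximalIdeal R) R ⊗[R] R')).range := by
      have := hk (algebraMap R _ c * s) (by
        rw [pow_succ']
        refine Ideal.mul_mem_mul ?_ hs
        rw [AdicCompletion.maximalIdeal_eq_map]
        exact Ideal.mem_map_of_mem _ hc)
      rw [map_mul, mul_assoc, ← IsScalarTower.algebraMap_apply, ← Algebra.smul_def] at this
      exact this
    obtain ⟨u, hu⟩ := h a ha
    obtain ⟨v, hv⟩ := h b hb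
    exact hstep _ u v hu hv

variable [Module.Finite R R'] {ι : Type} [Finite ι]
  (S : ι → Type) [∀ i, CommRing (S i)] [∀ i, IsLocalRing (S i)]
  [∀ i, IsNoetherianRing (S i)] [∀ i, Algebra R' (S i)] [∀ i, Algebra R (S i)]
  [∀ i, IsScalarTower R R' (S i)] [∀ i, IsLocalHom (algebraMap R (S i))]
  (m : ι → Ideal R') [∀ i, (m i).IsMaximal] [∀ i, IsLocalization.AtPrime (S i) (m i)]

include m in
theorem tensorToCompletion_surjective
    (hmax : ∀ n : Ideal R', n.IsMaximal → ∃ i, n = m i) (hinj : Function.Injective m) (i : ι) :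
    Function.Surjective (tensorToCompletion R R' (S i)) := fun y => by
  classical
  obtain ⟨z, hz⟩ := tensorToCompletion_pi_surjective (R := R) S m hmax hinj (Pi.single i y)
  exact ⟨z, by simpa using hz i⟩

include m in
/-- Lying over for the factors of `R̂ ⊗ R'` selected by an idempotent `e`. -/
theorem exists_prime_comap_completionMap_eq
    (hmax : ∀ n : Ideal R', n.IsMaximal → ∃ i, n = m i) (hinj : Function.Injective m)
    (A : Set ι) (e : AdicCompletion (maximalIdeal R) R ⊗[R] R')
    (he1 : ∀ i ∈ A, tensorToCompletion R R' (S i) e = 1)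
    (he0 : ∀ i ∉ A, tensorToCompletion R R' (S i) e = 0)
    (P : Ideal (AdicCompletion (maximalIdeal R) R)) [P.IsPrime]
    (hP : ∀ r, algebraMap _ (AdicCompletion (maximalIdeal R) R ⊗[R] R') r * e = 0 → r ∈ P) :
    ∃ i ∈ A, ∃ q : Ideal (AdicCompletion (maximalIdeal (S i)) (S i)), q.IsPrime ∧
      q.comap (completionMap (algebraMap R (S i))) = P := by
  have := Fintype.ofFinite ι
  have hidem : (1 - e) * e = 0 := by
    refine tensorToCompletion_pi_injective S m hmax hinj _ fun i => ?_
    by_cases hi : i ∈ A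
    · simp [he1 i hi]
    · simp [he0 i hi]
  obtain ⟨Q, hQ, hQp, hQP⟩ := Ideal.exists_ideal_over_prime_of_isIntegral
    (S := AdicCompletion (maximalIdeal R) R ⊗[R] R') P (Ideal.span {1 - e}) (by
      intro r hr
      obtain ⟨x, hx⟩ := Ideal.mem_span_singleton'.mp (Ideal.mem_comap.mp hr)
      refine hP r ?_
      rw [← hx, mul_assoc, hidem, mul_zero])
  have h1e : 1 - e ∈ Q := hQ (Ideal.mem_span_singleton_self _)
  -- the kernels of the projections to the factors have product zero
  have hker : ∃ i, RingHom.ker (tensorToCompletion R R' (S i)) ≤ Q := by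
    by_contra! h
    choose z hz using fun i => Set.not_subset.mp (h i)
    have h0 : ∏ i, z i = 0 := by
      refine tensorToCompletion_pi_injective S m hmax hinj _ fun i => ?_
      rw [map_prod]
      exact Finset.prod_eq_zero (Finset.mem_univ i) (hz i).1
    obtain ⟨i, -, hi⟩ := (hQp.prod_mem_iff).mp (h0 ▸ Q.zero_mem)
    exact (hz i).2 hi
  obtain ⟨i, hi⟩ := hker
  have hiA : i ∈ A := by
    by_contra hiA
    refine hQp.ne_top ((Ideal.eq_top_iff_one _).mpr ?_)
    simpa using add_mem h1e (hi (he0 i hiA : e ∈ RingHom.ker _))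
  have hsurj := tensorToCompletion_surjective (R := R) S m hmax hinj i
  refine ⟨i, hiA, Q.map (tensorToCompletion R R' (S i)),
    Ideal.map_isPrime_of_surjective hsurj hi, ?_⟩
  rw [completionMap_eq_tensorToCompletion_comp R R' (S i), ← Ideal.comap_comap]
  have h3 : (Q.map (tensorToCompletion R R' (S i))).comap
      (tensorToCompletion R R' (S i)).toRingHom = Q := by
    refine (Ideal.comap_map_of_surjective _ hsurj Q).trans ?_
    exact sup_eq_left.mpr hi
  rw [h3, hQP]

include m in
theorem completionMap_isIntegral
    (hmax : ∀ n : Ideal R', n.IsMaximal → ∃ i, n = m i) (hinj : Function.Injective m) (i : ι) :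
    (completionMap (algebraMap R (S i))).IsIntegral := by
  have hsurj := tensorToCompletion_surjective (R := R) S m hmax hinj i
  rw [completionMap_eq_tensorToCompletion_comp R R' (S i)]
  exact RingHom.IsIntegral.trans _ _ (algebraMap_isIntegral_iff.mpr inferInstance)
    (RingHom.isIntegral_of_surjective _ hsurj)

include m in
/-- Connectedness in depth two: the factors of `R̂ ⊗ R'` cannot be divided into two nonempty parts
in such a way that no nonmaximal prime of `R̂` containing `t` lies below both of them. -/
theorem eq_empty_or_eq_univ_of_depth
    (hmax : ∀ n : Ideal R', n.IsMaximal → ∃ i, n = m i) (hinj : Function.Injective m)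
    (hR' : Function.Injective (algebraMap R R'))
    (t : R) (n : ℕ) (ht : ∀ z : R', t ^ n • z ∈ (algebraMap R R').range)
    (a b : R) (ha : a ∈ maximalIdeal R) (hb : b ∈ maximalIdeal R)
    (hab : RingTheory.Sequence.IsWeaklyRegular R [a, b]) (haR' : IsSMulRegular R' a)
    (A : Set ι)
    (hA : ∀ P : Ideal (AdicCompletion (maximalIdeal R) R), P.IsPrime → algebraMap R _ t ∈ P →
      P ≠ maximalIdeal _ →
      (∃ i ∈ A, ∃ q : Ideal (AdicCompletion (maximalIdeal (S i)) (S i)), q.IsPrime ∧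
        q.comap (completionMap (algebraMap R (S i))) = P) →
      (∃ i ∉ A, ∃ q : Ideal (AdicCompletion (maximalIdeal (S i)) (S i)), q.IsPrime ∧
        q.comap (completionMap (algebraMap R (S i))) = P) → False) :
    A = ∅ ∨ A = Set.univ := by
  classical
  have hinjM : Function.Injective (algebraMap (AdicCompletion (maximalIdeal R) R)
      (AdicCompletion (maximalIdeal R) R ⊗[R] R')) :=
    Algebra.TensorProduct.includeLeft_injective (S := AdicCompletion (maximalIdeal R) R) hR'
  -- the idempotent of `R̂ ⊗ R'` that selects the factors in `A`
  obtain ⟨e, he⟩ := tensorToCompletion_pi_surjective (R := R) S m hmax hinj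
    (fun i => if i ∈ A then 1 else 0)
  -- the ideal of the elements of `R̂` that multiply `e` into `R̂`
  let J : Ideal (AdicCompletion (maximalIdeal R) R) :=
    { carrier := {r | algebraMap _ (AdicCompletion (maximalIdeal R) R ⊗[R] R') r * e ∈
        (algebraMap (AdicCompletion (maximalIdeal R) R)
          (AdicCompletion (maximalIdeal R) R ⊗[R] R')).range}
      add_mem' := fun {x y} hx hy => by
        simp only [Set.mem_ofPred_eq, map_add, add_mul]
        exact add_mem hx hy
      zero_mem' := by
        rw [Set.mem_ofPred_eq, map_zero, zero_mul]
        exact zero_mem _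
      smul_mem' := fun c x hx => by
        simp only [Set.mem_ofPred_eq, smul_eq_mul, map_mul, mul_assoc]
        exact mul_mem ⟨c, rfl⟩ hx }
  have htJ : algebraMap R _ t ^ n ∈ J := by
    have h (z : AdicCompletion (maximalIdeal R) R ⊗[R] R') : t ^ n • z ∈
        (algebraMap (AdicCompletion (maximalIdeal R) R)
          (AdicCompletion (maximalIdeal R) R ⊗[R] R')).range := by
      induction z with
      | zero => simp
      | add x y hx hy => rw [smul_add]; exact add_mem hx hy
      | tmul x y =>
        obtain ⟨r, hr⟩ := ht y
        refine ⟨r • x, ?_⟩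
        rw [← TensorProduct.tmul_smul, ← hr, Algebra.TensorProduct.algebraMap_apply, Algebra.algebraMap_self,
          RingHom.id_apply, TensorProduct.smul_tmul, Algebra.algebraMap_eq_smul_one]
    have := h e
    have hs : t ^ n • e = algebraMap R _ (t ^ n) * e := Algebra.smul_def (t ^ n) e
    rw [hs, IsScalarTower.algebraMap_apply R (AdicCompletion (maximalIdeal R) R),
      map_pow] at this
    exact this
  -- a nonmaximal prime above `J` contains `t`, and lies below factors in `A` and outside of `A`
  have hle : maximalIdeal (AdicCompletion (maximalIdeal R) R) ≤ J.radical := by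
    rw [Ideal.radical_eq_sInf]
    refine le_sInf fun P ⟨hJP, hP⟩ => ?_
    by_contra hPm
    have hPne : P ≠ maximalIdeal _ := fun h => hPm h.ge
    refine hA P hP (hP.mem_of_pow_mem n (hJP htJ)) hPne ?_ ?_
    · refine exists_prime_comap_completionMap_eq S m hmax hinj A e (fun i hi => by simp [he, hi])
        (fun i hi => by simp [he, hi]) P fun r hr => hJP ?_
      exact ⟨0, by rw [map_zero, hr]⟩
    · refine exists_prime_comap_completionMap_eq S m hmax hinj Aᶜ (1 - e)
        (fun i hi => by simp [he, show i ∉ A from hi])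
        (fun i hi => by simp [he, show i ∈ A by simpa using hi]) P fun r hr => hJP ?_
      exact ⟨r, by linear_combination hr⟩
  obtain ⟨k, hk⟩ := Ideal.exists_pow_le_of_le_radical_of_fg hle (Ideal.fg_of_isNoetherianRing _)
  obtain ⟨r, hr⟩ := mem_range_algebraMap_of_pow_le a b ha hb hab haR' hR' e k
    fun r hr => hk hr
  have hri (i : ι) : completionMap (algebraMap R (S i)) r = if i ∈ A then 1 else 0 := by
    rw [← he i, ← hr, completionMap_eq_tensorToCompletion_comp R R' (S i)]
    rfl
  -- `e` lies in the local ring `R̂`, so `e` or `1 - e` is a unit there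
  rcases IsLocalRing.isUnit_or_isUnit_one_sub_self r with hu | hu
  · refine Or.inr (Set.eq_univ_of_forall fun i => ?_)
    by_contra hi
    have := hu.map (completionMap (algebraMap R (S i)))
    simp [hri, hi] at this
  · refine Or.inl (Set.eq_empty_of_forall_notMem fun i hi => ?_)
    have := hu.map (completionMap (algebraMap R (S i)))
    simp [hri, hi] at this

end

/-! ### Dimension and minimal primes of completions -/

section
variable {A : Type*} [CommRing A] [IsLocalRing A] [IsNoetherianRing A]

theorem comap_algebraMap_ne_maximalIdeal (P : Ideal (AdicCompletion (maximalIdeal A) A))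
    [P.IsPrime] (hP : P ≠ maximalIdeal _) : P.comap (algebraMap A _) ≠ maximalIdeal A := by
  intro h
  refine hP (le_antisymm (le_maximalIdeal (Ideal.IsPrime.ne_top ‹_›)) ?_)
  rw [AdicCompletion.maximalIdeal_eq_map, Ideal.map_le_iff_le_comap, h]

/-- A one-dimensional Noetherian local ring has a parameter, by prime avoidance. -/
theorem exists_pow_le_span_singleton [Ring.KrullDimLE 1 A] :
    ∃ (x : A) (k : ℕ), x ∈ maximalIdeal A ∧ maximalIdeal A ^ k ≤ Ideal.span {x} := by
  suffices h : ∃ x ∈ maximalIdeal A, maximalIdeal A ≤ (Ideal.span {x}).radical by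
    obtain ⟨x, hx, h⟩ := h
    obtain ⟨k, hk⟩ := Ideal.exists_pow_le_of_le_radical_of_fg h (Ideal.fg_of_isNoetherianRing _)
    exact ⟨x, k, hx, hk⟩
  have hdim := Ring.krullDimLE_one_iff.mp ‹Ring.KrullDimLE 1 A›
  by_cases hm : maximalIdeal A ∈ minimalPrimes A
  · refine ⟨0, zero_mem _, ?_⟩
    rw [Ideal.radical_eq_sInf]
    refine le_sInf fun P ⟨_, hP⟩ => ?_
    exact hm.2 ⟨hP, bot_le⟩ (le_maximalIdeal hP.ne_top)
  · have hfin := minimalPrimes.finite_of_isNoetherianRing A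
    have : ¬ ((maximalIdeal A : Set A) ⊆ ⋃ p ∈ (hfin.toFinset : Set (Ideal A)),
        ((id p : Ideal A) : Set A)) := by
      rw [Ideal.subset_union_prime (f := id) (maximalIdeal A) (maximalIdeal A)
        (fun i hi _ _ => (hfin.mem_toFinset.mp hi).1.1)]
      rintro ⟨p, hp, hle⟩
      have hp' := hfin.mem_toFinset.mp hp
      have : p = maximalIdeal A := le_antisymm (le_maximalIdeal hp'.1.1.ne_top) hle
      exact hm (this ▸ hp')
    obtain ⟨x, hx, hx'⟩ := Set.not_subset.mp this
    refine ⟨x, hx, ?_⟩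
    rw [Ideal.radical_eq_sInf]
    refine le_sInf fun P ⟨hxP, hP⟩ => ?_
    rcases hdim P hP with h | h
    · refine absurd ?_ hx'
      simp only [Set.mem_iUnion]
      exact ⟨P, by simpa using h, hxP (Ideal.mem_span_singleton_self x)⟩
    · exact (eq_maximalIdeal h).ge

/-- By Krull's principal ideal theorem, completing does not raise the dimension of a
one-dimensional Noetherian local ring. -/
theorem krullDimLE_one_adicCompletion [Ring.KrullDimLE 1 A] :
    Ring.KrullDimLE 1 (AdicCompletion (maximalIdeal A) A) := by
  obtain ⟨x, k, hx, hk⟩ := exists_pow_le_span_singleton (A := A)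
  rw [Ring.krullDimLE_one_iff]
  intro P hP
  by_cases hPm : P = maximalIdeal _
  · exact Or.inr (hPm ▸ inferInstance)
  left
  have hmem : maximalIdeal (AdicCompletion (maximalIdeal A) A) ∈
      (Ideal.span {algebraMap A (AdicCompletion (maximalIdeal A) A) x}).minimalPrimes := by
    refine ⟨⟨inferInstance, ?_⟩, fun Q ⟨hQ, hxQ⟩ _ => ?_⟩
    · rw [Ideal.span_singleton_le_iff_mem, AdicCompletion.maximalIdeal_eq_map]
      exact Ideal.mem_map_of_mem _ hx
    · refine hQ.le_of_pow_le (n := k) ?_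
      rw [AdicCompletion.maximalIdeal_eq_map, ← Ideal.map_pow]
      refine (Ideal.map_mono hk).trans ?_
      rwa [Ideal.map_span, Set.image_singleton]
  have h1 := Ideal.height_le_one_of_isPrincipal_of_mem_minimalPrimes _ _ hmem
  have hlt : P < maximalIdeal _ := lt_of_le_of_ne (le_maximalIdeal hP.ne_top) hPm
  rw [← Ideal.height_eq_zero_iff]
  exact Order.lt_one_iff.mp ((Ideal.height_le_iff (n := 1)).mp h1 P hP hlt)

theorem krullDimLE_zero_adicCompletion_iff :
    Ring.KrullDimLE 0 (AdicCompletion (maximalIdeal A) A) ↔ Ring.KrullDimLE 0 A := by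
  rw [← isArtinianRing_iff_krullDimLE_zero, ← isArtinianRing_iff_krullDimLE_zero,
    isArtinianRing_iff_isNilpotent_maximalIdeal, isArtinianRing_iff_isNilpotent_maximalIdeal]
  constructor
  · rintro ⟨k, hk⟩
    refine ⟨k, ?_⟩
    rw [Ideal.zero_eq_bot, eq_bot_iff]
    intro r hr
    have h0 : algebraMap A (AdicCompletion (maximalIdeal A) A) r = 0 := by
      have := (algebraMap_mem_pow_iff k r).mpr hr
      rwa [hk] at this
    refine IsHausdorff.haus (I := maximalIdeal A) inferInstance r fun n => ?_
    rw [SModEq.zero, smul_eq_mul, Ideal.mul_top, ← algebraMap_mem_pow_iff, h0]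
    exact zero_mem _
  · rintro ⟨k, hk⟩
    refine ⟨k, ?_⟩
    rw [AdicCompletion.maximalIdeal_eq_map, ← Ideal.map_pow, hk]
    exact Ideal.map_bot

/-- If the maximal ideal is principal up to nilpotents there is only one analytic branch. -/
theorem subsingleton_minimalPrimes_adicCompletion (x : A) (N : Ideal A) (hN : IsNilpotent N)
    (hm : maximalIdeal A = Ideal.span {x} ⊔ N) :
    (minimalPrimes (AdicCompletion (maximalIdeal A) A)).Subsingleton := by
  set B := AdicCompletion (maximalIdeal A) A
  let N' := N.map (algebraMap A B)
  have hN' (P : Ideal B) (hP : P.IsPrime) : N' ≤ P := by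
    obtain ⟨k, hk⟩ := hN
    refine hP.le_of_pow_le (n := k) ?_
    rw [← Ideal.map_pow, hk, Ideal.zero_eq_bot, Ideal.map_bot]
    exact bot_le
  have hm' : maximalIdeal B = Ideal.span {algebraMap A B x} ⊔ N' := by
    have h := congrArg (Ideal.map (algebraMap A B)) hm
    rw [Ideal.map_sup, Ideal.map_span, Set.image_singleton] at h
    exact AdicCompletion.maximalIdeal_eq_map.trans h
  -- by Nakayama's lemma, a prime other than the maximal ideal is contained in the nilpotent `N'`
  have key (P : Ideal B) (hP : P.IsPrime) (hPm : P ≠ maximalIdeal B) : P ≤ N' := by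
    have hx : algebraMap A B x ∉ P := fun hx => hPm <|
      le_antisymm (le_maximalIdeal hP.ne_top) (by
        rw [hm', sup_le_iff, Ideal.span_singleton_le_iff_mem]
        exact ⟨hx, hN' P hP⟩)
    refine Submodule.le_of_le_smul_of_le_jacobson_bot (I := maximalIdeal B)
      (Ideal.fg_of_isNoetherianRing _) (maximalIdeal_le_jacobson _) fun y hy => ?_
    have hy' := le_maximalIdeal hP.ne_top hy
    rw [hm'] at hy'
    obtain ⟨z, hz, w, hw, rfl⟩ := Submodule.mem_sup.mp hy'
    obtain ⟨c, rfl⟩ := Ideal.mem_span_singleton'.mp hz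
    have hc : c ∈ P := by
      have : c * algebraMap A B x ∈ P := by
        have := sub_mem hy (hN' P hP hw)
        simpa using this
      exact (hP.mem_or_mem this).resolve_right hx
    rw [add_comm]
    refine Submodule.add_mem_sup hw ?_
    rw [smul_eq_mul, mul_comm]
    refine Ideal.mul_mem_mul hc ?_
    rw [hm']
    exact Ideal.mem_sup_left (Ideal.mem_span_singleton_self _)
  intro P hP Q hQ
  by_cases hPm : P = maximalIdeal B
  · refine le_antisymm (hP.2 hQ.1 ?_) (hPm ▸ le_maximalIdeal hQ.1.1.ne_top)
    exact hPm ▸ le_maximalIdeal hQ.1.1.ne_top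
  · exact le_antisymm ((key P hP.1.1 hPm).trans (hN' Q hQ.1.1))
      (hQ.2 hP.1 ((key P hP.1.1 hPm).trans (hN' Q hQ.1.1)))
end

/-! ### Branches of a fibre -/

theorem completionMap_comm {R S R₀ S₀ : Type*} [CommRing R] [IsLocalRing R] [CommRing S]
    [IsLocalRing S] [CommRing R₀] [IsLocalRing R₀] [CommRing S₀] [IsLocalRing S₀] (φ : R →+* S)
    [IsLocalHom φ] (π : R →+* R₀) [IsLocalHom π] (π' : S →+* S₀) [IsLocalHom π'] (φ₀ : R₀ →+* S₀)
    [IsLocalHom φ₀] (hcomm : φ₀.comp π = π'.comp φ) :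
    (completionMap φ₀).comp (completionMap π) = (completionMap π').comp (completionMap φ) := by
  have h1 : IsLocalHom (φ₀.comp π) := RingHom.isLocalHom_comp _ _
  have h2 : IsLocalHom (π'.comp φ) := RingHom.isLocalHom_comp _ _
  rw [← completionMap_comp, ← completionMap_comp]
  congr 1

section
variable {R S R₀ S₀ : Type*} [CommRing R] [IsLocalRing R] [IsNoetherianRing R]
  [CommRing S] [IsLocalRing S] [IsNoetherianRing S]
  [CommRing R₀] [IsLocalRing R₀] [IsNoetherianRing R₀]
  [CommRing S₀] [IsLocalRing S₀] [IsNoetherianRing S₀]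
  (φ : R →+* S) [IsLocalHom φ] (π : R →+* R₀) [IsLocalHom π] (π' : S →+* S₀) [IsLocalHom π']
  (φ₀ : R₀ →+* S₀) [IsLocalHom φ₀]

theorem comap_maximalIdeal_completionMap {A B : Type*} [CommRing A] [IsLocalRing A]
    [IsNoetherianRing A] [CommRing B] [IsLocalRing B] [IsNoetherianRing B] (φ : A →+* B)
    [IsLocalHom φ] : (maximalIdeal _).comap (completionMap φ) = maximalIdeal _ :=
  ((local_hom_TFAE (completionMap φ)).out 0 4).mp (isLocalHom_completionMap φ)

/-- A prime of `Ŝ` above a branch of `R₀ = R ⧸ (t)` yields a branch of `S₀ = S ⧸ (t)` above it. -/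
theorem exists_minimalPrime_comap_eq (hcomm : φ₀.comp π = π'.comp φ) (t : R)
    (hπ : Function.Surjective π) (hkπ : RingHom.ker π = Ideal.span {t})
    (hπ' : Function.Surjective π') (hkπ' : RingHom.ker π' = Ideal.span {φ t})
    (P : Ideal (AdicCompletion (maximalIdeal R₀) R₀)) (hP : P ∈ minimalPrimes _)
    (q : Ideal (AdicCompletion (maximalIdeal S) S)) [q.IsPrime]
    (hq : q.comap (completionMap φ) = P.comap (completionMap π)) :
    ∃ q₀ ∈ minimalPrimes (AdicCompletion (maximalIdeal S₀) S₀),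
      q₀.comap (completionMap φ₀) = P := by
  have hsurj := completionMap_surjective π hπ
  have hsurj' := completionMap_surjective π' hπ'
  have hker : RingHom.ker (completionMap π') ≤ q := by
    rw [ker_completionMap π' hπ' (φ t) hkπ', Ideal.span_singleton_le_iff_mem,
      ← completionMap_algebraMap, ← Ideal.mem_comap, hq, Ideal.mem_comap,
      completionMap_algebraMap]
    have : π t = 0 := by
      rw [← RingHom.mem_ker, hkπ]; exact Ideal.mem_span_singleton_self t
    rw [this, map_zero]
    exact zero_mem _
  have hprime : (q.map (completionMap π')).IsPrime := Ideal.map_isPrime_of_surjective hsurj' hker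
  obtain ⟨q₀, hq₀, hle⟩ := Ideal.exists_minimalPrimes_le (J := q.map (completionMap π')) bot_le
  refine ⟨q₀, hq₀, ?_⟩
  have := hq₀.1.1
  have hle' : q₀.comap (completionMap φ₀) ≤ P := by
    rw [← Ideal.comap_le_comap_iff_of_surjective _ hsurj, ← hq, Ideal.comap_comap,
      completionMap_comm φ π π' φ₀ hcomm, ← Ideal.comap_comap]
    refine Ideal.comap_mono ((Ideal.comap_mono hle).trans ?_)
    rw [Ideal.comap_map_of_surjective _ hsurj']
    exact sup_le le_rfl hker
  exact le_antisymm hle' (hP.2 ⟨inferInstance, bot_le⟩ hle')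

set_option linter.unusedSectionVars false in
theorem isIntegral_completionMap_of_comm (hcomm : φ₀.comp π = π'.comp φ)
    (hπ' : Function.Surjective π') (hφ : (completionMap φ).IsIntegral) :
    (completionMap φ₀).IsIntegral := by
  refine RingHom.IsIntegral.tower_top (completionMap π) _ ?_
  rw [completionMap_comm φ π π' φ₀ hcomm]
  exact hφ.trans _ _ (RingHom.isIntegral_of_surjective _ (completionMap_surjective π' hπ'))

/-- A branch of `S₀` maps to a branch of the one-dimensional ring `R₀`, unless `S₀` has only one
branch. -/
theorem comap_mem_minimalPrimes [Ring.KrullDimLE 1 R₀] (hint : (completionMap φ₀).IsIntegral)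
    (hS : (minimalPrimes (AdicCompletion (maximalIdeal S₀) S₀)).Nontrivial)
    (q : Ideal (AdicCompletion (maximalIdeal S₀) S₀)) (hq : q ∈ minimalPrimes _) :
    q.comap (completionMap φ₀) ∈ minimalPrimes _ ∧ q.comap (completionMap φ₀) ≠ maximalIdeal _ := by
  have := hq.1.1
  have hqm : q.comap (completionMap φ₀) ≠ maximalIdeal _ := by
    intro h
    have hmax : q.IsMaximal :=
      Ideal.isMaximal_of_isIntegral_of_isMaximal_comap' _ hint q (h ▸ inferInstance)
    obtain ⟨q', hq', hne⟩ := hS.exists_ne q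
    refine hne (le_antisymm ?_ (hq.2 hq'.1 ?_))
    all_goals exact eq_maximalIdeal hmax ▸ le_maximalIdeal hq'.1.1.ne_top
  refine ⟨?_, hqm⟩
  have := krullDimLE_one_adicCompletion (A := R₀)
  refine (Ring.krullDimLE_one_iff.mp this _ inferInstance).resolve_right fun h => ?_
  exact hqm (eq_maximalIdeal h)

/-- A nonmaximal branch of a one-dimensional local ring contracts to a minimal prime. -/
theorem comap_algebraMap_mem_minimalPrimes [Ring.KrullDimLE 1 R₀]
    (P : Ideal (AdicCompletion (maximalIdeal R₀) R₀)) [P.IsPrime] (hPm : P ≠ maximalIdeal _) :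
    P.comap (algebraMap R₀ _) ∈ minimalPrimes R₀ :=
  (Ring.krullDimLE_one_iff.mp ‹_› _ inferInstance).resolve_right fun h =>
    comap_algebraMap_ne_maximalIdeal P hPm (eq_maximalIdeal h)
end

section
variable {R R' : Type} [CommRing R] [IsLocalRing R] [CommRing R'] [Algebra R R']
  [IsNoetherianRing R] [Module.Finite R R'] {ι : Type} [Finite ι]
  (S : ι → Type) [∀ i, CommRing (S i)] [∀ i, IsLocalRing (S i)]
  [∀ i, IsNoetherianRing (S i)] [∀ i, Algebra R' (S i)] [∀ i, Algebra R (S i)]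
  [∀ i, IsScalarTower R R' (S i)] [∀ i, IsLocalHom (algebraMap R (S i))]
  (m : ι → Ideal R') [∀ i, (m i).IsMaximal] [∀ i, IsLocalization.AtPrime (S i) (m i)]
  {R₀ : Type} [CommRing R₀] [IsLocalRing R₀] [IsNoetherianRing R₀]
  (S₀ : ι → Type) [∀ i, CommRing (S₀ i)] [∀ i, IsLocalRing (S₀ i)] [∀ i, IsNoetherianRing (S₀ i)]
  (π : R →+* R₀) [IsLocalHom π] (π' : ∀ i, S i →+* S₀ i) [∀ i, IsLocalHom (π' i)]
  (φ₀ : ∀ i, R₀ →+* S₀ i) [∀ i, IsLocalHom (φ₀ i)]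

include m in
/-- Every branch of `R₀` lies below a branch of some `S₀ i`. -/
theorem exists_branch_above
    (hmax : ∀ n : Ideal R', n.IsMaximal → ∃ i, n = m i) (hinj : Function.Injective m)
    (hR' : Function.Injective (algebraMap R R')) (t : R)
    (hcomm : ∀ i, (φ₀ i).comp π = (π' i).comp (algebraMap R (S i)))
    (hπ : Function.Surjective π) (hkπ : RingHom.ker π = Ideal.span {t})
    (hπ' : ∀ i, Function.Surjective (π' i))
    (hkπ' : ∀ i, RingHom.ker (π' i) = Ideal.span {algebraMap R (S i) t})
    (P : Ideal (AdicCompletion (maximalIdeal R₀) R₀)) (hP : P ∈ minimalPrimes _) :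
    ∃ i, ∃ q₀ ∈ minimalPrimes (AdicCompletion (maximalIdeal (S₀ i)) (S₀ i)),
      q₀.comap (completionMap (φ₀ i)) = P := by
  have hinjM : Function.Injective (algebraMap (AdicCompletion (maximalIdeal R) R)
      (AdicCompletion (maximalIdeal R) R ⊗[R] R')) :=
    Algebra.TensorProduct.includeLeft_injective (S := AdicCompletion (maximalIdeal R) R) hR'
  have := hP.1.1
  obtain ⟨i, -, q, hq, hqP⟩ := exists_prime_comap_completionMap_eq S m hmax hinj Set.univ
    (1 : AdicCompletion (maximalIdeal R) R ⊗[R] R') (fun i _ => map_one _) (fun i hi => by simp at hi)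
    (P.comap (completionMap π)) (fun r hr => by
      rw [mul_one] at hr
      rw [(map_eq_zero_iff _ hinjM).mp hr]
      exact zero_mem _)
  exact ⟨i, exists_minimalPrime_comap_eq (algebraMap R (S i)) π (π' i) (φ₀ i) (hcomm i) t hπ hkπ
    (hπ' i) (hkπ' i) P hP q hqP⟩

include m in
/-- The branches of `R₀` are connected through the points `S₀ i`: given a set `I` of branches
that is neither empty nor everything, some `S₀ i` has branches mapping both into `I` and outside
of it. -/
theorem exists_branches_separated
    (hmax : ∀ n : Ideal R', n.IsMaximal → ∃ i, n = m i) (hinj : Function.Injective m)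
    (hR' : Function.Injective (algebraMap R R')) (t : R)
    (hcomm : ∀ i, (φ₀ i).comp π = (π' i).comp (algebraMap R (S i)))
    (hπ : Function.Surjective π) (hkπ : RingHom.ker π = Ideal.span {t})
    (hπ' : ∀ i, Function.Surjective (π' i))
    (hkπ' : ∀ i, RingHom.ker (π' i) = Ideal.span {algebraMap R (S i) t})
    (n : ℕ) (ht : ∀ z : R', t ^ n • z ∈ (algebraMap R R').range) [Ring.KrullDimLE 1 R₀]
    (a b : R) (ha : a ∈ maximalIdeal R) (hb : b ∈ maximalIdeal R)
    (hab : RingTheory.Sequence.IsWeaklyRegular R [a, b]) (haR' : IsSMulRegular R' a)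
    (I : Set (Ideal (AdicCompletion (maximalIdeal R₀) R₀)))
    (P₁ P₂ : Ideal (AdicCompletion (maximalIdeal R₀) R₀)) (hP₁ : P₁ ∈ minimalPrimes _)
    (hP₂ : P₂ ∈ minimalPrimes _) (h₁ : P₁ ∈ I) (h₂ : P₂ ∉ I) :
    ∃ i, (∃ q₁ ∈ minimalPrimes (AdicCompletion (maximalIdeal (S₀ i)) (S₀ i)),
        q₁.comap (completionMap (φ₀ i)) ∈ I) ∧
      ∃ q₂ ∈ minimalPrimes (AdicCompletion (maximalIdeal (S₀ i)) (S₀ i)),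
        q₂.comap (completionMap (φ₀ i)) ∉ I := by
  by_contra! hcon
  let A : Set ι := {i | ∃ q₁ ∈ minimalPrimes (AdicCompletion (maximalIdeal (S₀ i)) (S₀ i)),
    q₁.comap (completionMap (φ₀ i)) ∈ I}
  have hdim := Ring.krullDimLE_one_iff.mp (krullDimLE_one_adicCompletion (A := R₀))
  have hsurj := completionMap_surjective π hπ
  have hA := eq_empty_or_eq_univ_of_depth S m hmax hinj hR' t n ht a b ha hb hab haR' A (by
    rintro P hP htP hPm ⟨i, hi, q, hq, hqP⟩ ⟨j, hj, q', hq', hqP'⟩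
    have hker : RingHom.ker (completionMap π) ≤ P := by
      rw [ker_completionMap π hπ t hkπ, Ideal.span_singleton_le_iff_mem]
      exact htP
    have hprime : (P.map (completionMap π)).IsPrime := Ideal.map_isPrime_of_surjective hsurj hker
    have hcm : (P.map (completionMap π)).comap (completionMap π) = P := by
      rw [Ideal.comap_map_of_surjective _ hsurj]
      exact sup_eq_left.mpr hker
    have hmin : P.map (completionMap π) ∈ minimalPrimes _ := by
      refine (hdim _ hprime).resolve_right fun h => hPm ?_
      rw [← hcm, eq_maximalIdeal h]
      exact comap_maximalIdeal_completionMap π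
    obtain ⟨p, hp, hpP⟩ := exists_minimalPrime_comap_eq (algebraMap R (S i)) π (π' i) (φ₀ i)
      (hcomm i) t hπ hkπ (hπ' i) (hkπ' i) _ hmin q (hqP.trans hcm.symm)
    obtain ⟨p', hp', hpP'⟩ := exists_minimalPrime_comap_eq (algebraMap R (S j)) π (π' j) (φ₀ j)
      (hcomm j) t hπ hkπ (hπ' j) (hkπ' j) _ hmin q' (hqP'.trans hcm.symm)
    refine hj ⟨p', hp', ?_⟩
    rw [hpP', ← hpP]
    exact hcon i hi p hp)
  obtain ⟨i, q, hq, hqP⟩ := exists_branch_above S m S₀ π π' φ₀ hmax hinj hR' t hcomm hπ hkπ hπ'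
    hkπ' P₁ hP₁
  obtain ⟨j, q', hq', hqP'⟩ := exists_branch_above S m S₀ π π' φ₀ hmax hinj hR' t hcomm hπ hkπ hπ'
    hkπ' P₂ hP₂
  rcases hA with hA | hA
  · exact (hA ▸ (⟨q, hq, hqP ▸ h₁⟩ : i ∈ A) : i ∈ (∅ : Set ι))
  · exact h₂ (hqP' ▸ hcon j (hA ▸ Set.mem_univ j : j ∈ A) q' hq')

include m in
/-- In depth two, if some `S₀ i` is zero-dimensional, then so is `R₀`: no nonmaximal prime of `R̂`
containing `t` lies below `Ŝ i`, so by connectedness `i` is the only index. -/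
theorem krullDimLE_zero_of_depth
    (hmax : ∀ n : Ideal R', n.IsMaximal → ∃ i, n = m i) (hinj : Function.Injective m)
    (hR' : Function.Injective (algebraMap R R')) (t : R)
    (hπ : Function.Surjective π) (hkπ : RingHom.ker π = Ideal.span {t})
    (hπ' : ∀ i, Function.Surjective (π' i))
    (hkπ' : ∀ i, RingHom.ker (π' i) = Ideal.span {algebraMap R (S i) t})
    (n : ℕ) (ht : ∀ z : R', t ^ n • z ∈ (algebraMap R R').range)
    (a b : R) (ha : a ∈ maximalIdeal R) (hb : b ∈ maximalIdeal R)
    (hab : RingTheory.Sequence.IsWeaklyRegular R [a, b]) (haR' : IsSMulRegular R' a)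
    (i : ι) (hi : Ring.KrullDimLE 0 (S₀ i)) : Ring.KrullDimLE 0 R₀ := by
  rw [← krullDimLE_zero_adicCompletion_iff, Ring.krullDimLE_zero_iff] at hi
  have hsurj := completionMap_surjective π hπ
  -- all primes of `Ŝ i` above a prime containing `t` are maximal
  have key (P : Ideal (AdicCompletion (maximalIdeal R) R)) (htP : algebraMap R _ t ∈ P)
      (q : Ideal (AdicCompletion (maximalIdeal (S i)) (S i))) (hq : q.IsPrime)
      (hqP : q.comap (completionMap (algebraMap R (S i))) = P) : P = maximalIdeal _ := by
    have hsurj' := completionMap_surjective (π' i) (hπ' i)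
    have hker : RingHom.ker (completionMap (π' i)) ≤ q := by
      rw [ker_completionMap (π' i) (hπ' i) _ (hkπ' i), Ideal.span_singleton_le_iff_mem,
        ← completionMap_algebraMap, ← Ideal.mem_comap, hqP]
      exact htP
    have hmx := hi _ (Ideal.map_isPrime_of_surjective hsurj' hker)
    have hqm : q.IsMaximal := by
      have := Ideal.comap_isMaximal_of_surjective (completionMap (π' i)) hsurj' (K := q.map (completionMap (π' i)))
      rw [Ideal.comap_map_of_surjective _ hsurj'] at this
      rwa [sup_eq_left.mpr (show Ideal.comap _ ⊥ ≤ q from hker)] at this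
    rw [← hqP, eq_maximalIdeal hqm]
    exact comap_maximalIdeal_completionMap _
  have hA := eq_empty_or_eq_univ_of_depth S m hmax hinj hR' t n ht a b ha hb hab haR' {i} (by
    rintro P hP htP hPm ⟨j, rfl, q, hq, hqP⟩ -
    exact hPm (key P htP q hq hqP))
  rw [← krullDimLE_zero_adicCompletion_iff, Ring.krullDimLE_zero_iff]
  intro P hP
  have hinjM : Function.Injective (algebraMap (AdicCompletion (maximalIdeal R) R)
      (AdicCompletion (maximalIdeal R) R ⊗[R] R')) :=
    Algebra.TensorProduct.includeLeft_injective (S := AdicCompletion (maximalIdeal R) R) hR'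
  obtain ⟨j, -, q, hq, hqP⟩ := exists_prime_comap_completionMap_eq S m hmax hinj Set.univ
    (1 : AdicCompletion (maximalIdeal R) R ⊗[R] R') (fun i _ => map_one _) (fun i hi => by simp at hi)
    (P.comap (completionMap π)) (fun r hr => by
      rw [mul_one] at hr
      rw [(map_eq_zero_iff _ hinjM).mp hr]
      exact zero_mem _)
  obtain rfl : j = i := by
    rcases hA with h | h
    · simp at h
    · have : j ∈ ({i} : Set ι) := h ▸ Set.mem_univ j
      exact this
  have h := key (P.comap (completionMap π)) (by
    have : π t = 0 := by
      rw [← RingHom.mem_ker, hkπ]; exact Ideal.mem_span_singleton_self t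
    rw [Ideal.mem_comap, completionMap_algebraMap, this, map_zero]
    exact zero_mem _) q hq hqP
  have hmx : (P.comap (completionMap π)).IsMaximal := h ▸ inferInstance
  rw [← Ideal.map_comap_of_surjective _ hsurj P]
  exact (Ideal.map_eq_top_or_isMaximal_of_surjective _ hsurj hmx).resolve_left (by
    rw [Ideal.map_comap_of_surjective _ hsurj]; exact hP.ne_top)
end

/-! ### Finiteness of normalization, and of the multibranch points of a curve -/

theorem isLocalization_algebraMapSubmonoid_of_isIntegral (A B K : Type*) [CommRing A] [IsDomain A]
    [CommRing B] [IsDomain B] [Algebra A B] [FaithfulSMul A B] [Algebra.IsIntegral A B]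
    [Field K] [Algebra B K] [IsFractionRing B K] :
    IsLocalization (Algebra.algebraMapSubmonoid B A⁰) K := by
  have hle : Algebra.algebraMapSubmonoid B A⁰ ≤ B⁰ := by
    rintro _ ⟨a, ha, rfl⟩
    exact mem_nonZeroDivisors_of_ne_zero
      ((map_ne_zero_iff _ (FaithfulSMul.algebraMap_injective A B)).mpr
        (nonZeroDivisors.ne_zero ha))
  have : IsLocalization B⁰ (Localization (Algebra.algebraMapSubmonoid B A⁰)) := by
    refine IsLocalization.of_le_of_exists_dvd (Algebra.algebraMapSubmonoid B A⁰) _ hle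
      fun b hb => ?_
    obtain ⟨a, ha, hab⟩ := (Algebra.IsAlgebraic.isAlgebraic (R := A) b).exists_nonzero_dvd hb
    exact ⟨_, ⟨a, mem_nonZeroDivisors_of_ne_zero ha, rfl⟩, hab⟩
  exact IsLocalization.isLocalization_of_algEquiv _
    (IsLocalization.algEquiv B⁰ (Localization (Algebra.algebraMapSubmonoid B A⁰)) K)

/-- Finiteness of normalization in characteristic zero, for an integral extension inside the
fraction field. -/
theorem finite_of_isIntegral_of_injective (k B B' K : Type) [Field k] [CharZero k] [CommRing B]
    [IsDomain B] [Algebra k B] [Algebra.FiniteType k B] [Field K] [Algebra B K]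
    [IsFractionRing B K] [CommRing B'] [Algebra B B'] [Algebra B' K] [IsScalarTower B B' K]
    (hinj : Function.Injective (algebraMap B' K)) [Algebra.IsIntegral B B'] :
    Module.Finite B B' := by
  -- Noether normalization reduces to the separable extension of a polynomial ring
  obtain ⟨s, g, hg, hfin⟩ := exists_finite_inj_algHom_of_fg k B
  let A := MvPolynomial (Fin s) k
  let F := FractionRing A
  algebraize [g.toRingHom]
  have : Module.Finite A B := hfin
  let : Algebra A K := ((algebraMap B K).comp g.toRingHom).toAlgebra
  have : IsScalarTower A B K := IsScalarTower.of_algebraMap_eq fun _ => rfl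
  let : Algebra A B' := ((algebraMap B B').comp g.toRingHom).toAlgebra
  have : IsScalarTower A B B' := IsScalarTower.of_algebraMap_eq fun _ => rfl
  have : IsScalarTower A B' K := IsScalarTower.of_algebraMap_eq fun x => by
    change algebraMap B K (g x) = algebraMap B' K (algebraMap B B' (g x))
    rw [IsScalarTower.algebraMap_apply B B' K]
  have hAB : Function.Injective (algebraMap A B) := hg
  have hAK : Function.Injective (algebraMap A K) := (IsFractionRing.injective B K).comp hAB
  have : FaithfulSMul A K := (faithfulSMul_iff_algebraMap_injective A K).mpr hAK
  have : FaithfulSMul A B := (faithfulSMul_iff_algebraMap_injective A B).mpr hAB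
  let : Algebra F K := FractionRing.liftAlgebra A K
  have : CharZero A := charZero_of_injective_algebraMap (MvPolynomial.C_injective (Fin s) k)
  have : CharZero F := charZero_of_injective_algebraMap (IsFractionRing.injective A F)
  have : IsLocalization (Algebra.algebraMapSubmonoid B A⁰) K :=
    isLocalization_algebraMapSubmonoid_of_isIntegral A B K
  have : Module.Finite F K := Module.Finite.of_isLocalization A B A⁰
  have hNoeth : IsNoetherian A (integralClosure A K) :=
    IsIntegralClosure.isNoetherian A F K (integralClosure A K)
  have : Algebra.IsIntegral A B' := Algebra.IsIntegral.trans B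
  let φ : B' →ₐ[A] integralClosure A K := (IsScalarTower.toAlgHom A B' K).codRestrict _
    fun x => (Algebra.IsIntegral.isIntegral (R := A) x).map (IsScalarTower.toAlgHom A B' K)
  have hφ : Function.Injective φ := fun x y h => hinj (congrArg Subtype.val h)
  have : IsNoetherian A B' := isNoetherian_of_injective φ.toLinearMap hφ
  exact Module.Finite.of_restrictScalars_finite A B B'

/-- A one-dimensional domain of finite type over a field of characteristic zero is regular outside
the zeros of some nonzero element. -/
theorem exists_ne_zero_isPrincipal_maximalIdeal (k D : Type) [Field k] [CharZero k] [CommRing D]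
    [IsDomain D] [Algebra k D] [Algebra.FiniteType k D] [Ring.DimensionLEOne D] :
    ∃ c : D, c ≠ 0 ∧ ∀ (p : Ideal D) [p.IsPrime], c ∉ p →
      (maximalIdeal (Localization.AtPrime p)).IsPrincipal := by
  classical
  let K := FractionRing D
  have : Algebra.IsIntegral D (integralClosure D K) := inferInstance
  have hfin : Module.Finite D (integralClosure D K) :=
    finite_of_isIntegral_of_injective k D (integralClosure D K) K Subtype.val_injective
  have hNoeth : IsNoetherianRing D := Algebra.FiniteType.isNoetherianRing k D
  obtain ⟨S, hS⟩ := hfin.fg_top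
  -- `c` is a nonzero element of the conductor of the normalization
  obtain ⟨c, hc⟩ := IsLocalization.exist_integer_multiples_of_finset D⁰
    (S.image (Subtype.val : integralClosure D K → K))
  have hc' (x : K) (hx : IsIntegral D x) : ∃ d : D, algebraMap D K d = algebraMap D K c * x := by
    have : (⟨x, hx⟩ : integralClosure D K) ∈ Submodule.span D (S : Set (integralClosure D K)) :=
      hS ▸ Submodule.mem_top
    have key : ∀ y ∈ Submodule.span D (S : Set (integralClosure D K)),
        ∃ d : D, algebraMap D K d = algebraMap D K c * y.1 := by
      intro y hy
      induction hy using Submodule.span_induction with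
      | mem y hy =>
        obtain ⟨d, hd⟩ := hc y.1 (Finset.mem_image_of_mem _ hy)
        exact ⟨d, by rw [hd, Algebra.smul_def]⟩
      | zero => exact ⟨0, by simp⟩
      | add y z _ _ hy hz =>
        obtain ⟨d, hd⟩ := hy
        obtain ⟨e, he⟩ := hz
        exact ⟨d + e, by simp [hd, he, mul_add]⟩
      | smul r y _ hy =>
        obtain ⟨d, hd⟩ := hy
        exact ⟨r * d, by simp [hd, Algebra.smul_def]; ring⟩
    exact key _ this
  refine ⟨c, nonZeroDivisors.ne_zero c.2, fun p _ hcp => ?_⟩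
  have hle : p.primeCompl ≤ D⁰ := p.primeCompl_le_nonZeroDivisors
  let Dp := Localization.AtPrime p
  have : IsNoetherianRing Dp := IsLocalization.isNoetherianRing p.primeCompl Dp hNoeth
  have : IsDomain Dp := IsLocalization.isDomain_localization hle
  let : Algebra Dp K := (IsLocalization.lift (M := p.primeCompl) (S := Dp) (g := algebraMap D K)
    fun y => IsLocalization.map_units K (⟨y.1, hle y.2⟩ : D⁰)).toAlgebra
  have : IsScalarTower D Dp K := IsScalarTower.of_algebraMap_eq fun x =>
    (IsLocalization.lift_eq _ x).symm
  have : IsFractionRing Dp K := IsFractionRing.isFractionRing_of_isDomain_of_isLocalization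
    p.primeCompl Dp K
  suffices h : IsIntegrallyClosed Dp ∧ ∀ P : Ideal Dp, P ≠ ⊥ → P.IsPrime → P = maximalIdeal Dp from
    ((tfae_of_isNoetherianRing_of_isLocalRing_of_isDomain Dp).out 3 4).mp h
  refine ⟨?_, ?_⟩
  · rw [isIntegrallyClosed_iff K]
    intro x hx
    obtain ⟨s, hs⟩ := IsIntegral.exists_multiple_integral_of_isLocalization p.primeCompl x hx
    obtain ⟨d, hd⟩ := hc' _ hs
    refine ⟨IsLocalization.mk' Dp d ((⟨c, hcp⟩ : p.primeCompl) * s), ?_⟩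
    have hu : IsUnit (algebraMap D K ((c : D) * s)) := IsLocalization.map_units K
      (⟨_, hle ((⟨(c : D), hcp⟩ : p.primeCompl) * s).2⟩ : D⁰)
    refine hu.mul_left_cancel ?_
    rw [IsScalarTower.algebraMap_apply D Dp K, ← map_mul]
    have := IsLocalization.mk'_spec' Dp d ((⟨c, hcp⟩ : p.primeCompl) * s)
    erw [this]
    rw [← IsScalarTower.algebraMap_apply D Dp K, ← IsScalarTower.algebraMap_apply D Dp K, hd,
      Submonoid.smul_def, Algebra.smul_def, map_mul]
    ring
  · intro P hP hPr
    have : Ring.DimensionLEOne Dp := Ring.DimensionLEOne.localization Dp hle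
    exact eq_maximalIdeal (Ring.DimensionLEOne.maximalOfPrime hP hPr)

/-- If `p` contains exactly one minimal prime `q` of `C` and `(C ⧸ q)_p` is regular, then the
maximal ideal of `C_p` is principal up to nilpotents. -/
theorem exists_maximalIdeal_eq_span_sup (C A : Type) [CommRing C] [IsNoetherianRing C] [CommRing A]
    [IsLocalRing A] [Algebra C A] (q : Ideal C) [q.IsPrime] (P : Ideal (C ⧸ q)) [P.IsPrime]
    [IsLocalization.AtPrime A (P.comap (Ideal.Quotient.mk q))]
    (hq : ∀ q' ∈ minimalPrimes C, q' ≤ P.comap (Ideal.Quotient.mk q) → q' = q)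
    (hp : (maximalIdeal (Localization.AtPrime P)).IsPrincipal) :
    ∃ (x : A) (N : Ideal A), IsNilpotent N ∧ maximalIdeal A = Ideal.span {x} ⊔ N := by
  let D := C ⧸ q
  let Dp := Localization.AtPrime P
  have hN : IsNoetherianRing A :=
    IsLocalization.isNoetherianRing (P.comap (Ideal.Quotient.mk q)).primeCompl A ‹_›
  have hu (y : (P.comap (Ideal.Quotient.mk q)).primeCompl) :
      IsUnit (((algebraMap D Dp).comp (Ideal.Quotient.mk q)) y) :=
    IsLocalization.map_units Dp (⟨Ideal.Quotient.mk q y, y.2⟩ : P.primeCompl)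
  let ψ : A →+* Dp := IsLocalization.lift hu
  have hψ (c : C) : ψ (algebraMap C A c) = algebraMap D Dp (Ideal.Quotient.mk q c) :=
    IsLocalization.lift_eq hu c
  have hsurj : Function.Surjective ψ := by
    intro z
    obtain ⟨d, s, rfl⟩ := IsLocalization.exists_mk'_eq P.primeCompl z
    obtain ⟨c, rfl⟩ := Ideal.Quotient.mk_surjective d
    obtain ⟨s, hs⟩ := s
    obtain ⟨s, rfl⟩ := Ideal.Quotient.mk_surjective s
    refine ⟨IsLocalization.mk' A c (⟨s, hs⟩ : (P.comap (Ideal.Quotient.mk q)).primeCompl), ?_⟩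
    rw [IsLocalization.lift_mk'_spec]
    exact (IsLocalization.mk'_spec' Dp _ (⟨_, hs⟩ : P.primeCompl)).symm
  have hinj : Function.Injective (algebraMap D Dp) :=
    IsLocalization.injective Dp P.primeCompl_le_nonZeroDivisors
  have hker : RingHom.ker ψ ≤ nilradical A := by
    intro a ha
    rw [nilradical, Ideal.radical_eq_sInf, Submodule.mem_sInf]
    rintro Q ⟨-, hQ⟩
    obtain ⟨q', hq', hle⟩ := Ideal.exists_minimalPrimes_le (J := Ideal.comap (algebraMap C A) Q) bot_le
    obtain rfl := hq q' hq' (hle.trans (by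
      have h := (IsLocalization.AtPrime.under_maximalIdeal A (P.comap (Ideal.Quotient.mk q)))
      exact h ▸ Ideal.comap_mono (le_maximalIdeal hQ.ne_top)))
    obtain ⟨c, s, rfl⟩ := IsLocalization.exists_mk'_eq (P.comap (Ideal.Quotient.mk q')).primeCompl a
    have hc : ψ (algebraMap C A c) = 0 := by
      rw [← IsLocalization.mk'_spec' A c s, map_mul, RingHom.mem_ker.mp ha, mul_zero]
    rw [hψ, map_eq_zero_iff _ hinj, Ideal.Quotient.eq_zero_iff_mem] at hc
    have := hle hc
    rw [Ideal.mem_comap, ← IsLocalization.mk'_spec' A c s] at this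
    refine (hQ.mem_or_mem this).resolve_left fun h => hQ.ne_top ?_
    exact Ideal.eq_top_of_isUnit_mem _ h (IsLocalization.map_units A s)
  obtain ⟨y, hy⟩ := hp
  obtain ⟨x, rfl⟩ := hsurj y
  refine ⟨x, RingHom.ker ψ, ?_, ?_⟩
  · obtain ⟨n, hn⟩ := IsNoetherianRing.isNilpotent_nilradical A
    exact ⟨n, le_bot_iff.mp ((Ideal.pow_right_mono hker n).trans hn.le)⟩
  · have : ((maximalIdeal Dp).comap ψ).IsMaximal := Ideal.comap_isMaximal_of_surjective ψ hsurj
    rw [← eq_maximalIdeal this, hy, ← Ideal.comap_map_of_surjective' ψ hsurj, Ideal.map_span,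
      Set.image_singleton]

/-- A curve of finite type over a field of characteristic zero has only finitely many points with
several analytic branches. -/
theorem exists_finite_subsingleton_minimalPrimes (k C : Type) [Field k] [CharZero k] [CommRing C]
    [Algebra k C] [Algebra.FiniteType k C] [Ring.KrullDimLE 1 C] :
    ∃ F : Set (Ideal C), F.Finite ∧ ∀ (p : Ideal C) [p.IsPrime], p ∉ F →
      ∀ (A : Type) [CommRing A] [IsLocalRing A] [Algebra C A] [IsLocalization.AtPrime A p],
        (minimalPrimes (AdicCompletion (maximalIdeal A) A)).Subsingleton := by
  have hN : IsNoetherianRing C := Algebra.FiniteType.isNoetherianRing k C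
  have hdim := Ring.krullDimLE_one_iff.mp ‹Ring.KrullDimLE 1 C›
  have h1 (q : Ideal C) [q.IsPrime] : Ring.DimensionLEOne (C ⧸ q) := by
    refine ⟨fun {P} hP hPr => ?_⟩
    have hlt : q < P.comap (Ideal.Quotient.mk q) := by
      refine lt_of_le_of_ne (Ideal.mk_ker.symm.le.trans (Ideal.comap_mono bot_le)) fun h => hP ?_
      rw [eq_bot_iff, ← Ideal.comap_le_comap_iff_of_surjective _ Ideal.Quotient.mk_surjective,
        ← h]
      exact Ideal.mk_ker.ge
    have := (hdim (P.comap (Ideal.Quotient.mk q)) inferInstance).resolve_left fun h =>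
      hlt.not_ge (h.2 ⟨‹_›, bot_le⟩ hlt.le)
    rw [← Ideal.map_comap_of_surjective _ Ideal.Quotient.mk_surjective P]
    exact (Ideal.map_eq_top_or_isMaximal_of_surjective _ Ideal.Quotient.mk_surjective
      this).resolve_left (by
        rw [Ideal.map_comap_of_surjective _ Ideal.Quotient.mk_surjective]; exact hPr.ne_top)
  have h2 (q : Ideal C) (hq : q.IsPrime) : ∃ c : C, c ∉ q ∧ ∀ (P : Ideal (C ⧸ q)) [P.IsPrime],
      Ideal.Quotient.mk q c ∉ P → (maximalIdeal (Localization.AtPrime P)).IsPrincipal := by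
    obtain ⟨c, hc, h⟩ := exists_ne_zero_isPrincipal_maximalIdeal k (C ⧸ q)
    obtain ⟨c, rfl⟩ := Ideal.Quotient.mk_surjective c
    exact ⟨c, fun hcq => hc (Ideal.Quotient.eq_zero_iff_mem.mpr hcq), h⟩
  choose! c hc hc' using h2
  have hfin := minimalPrimes.finite_of_isNoetherianRing C
  -- a prime strictly above a minimal one is minimal over each larger ideal that it contains
  have hmin (q p I : Ideal C) (hq : q.IsPrime) (hp : p.IsPrime) (hqI : q < I) (hIp : I ≤ p) :
      p ∈ I.minimalPrimes := by
    refine ⟨⟨hp, hIp⟩, fun p' ⟨hp', hIp'⟩ _ => ?_⟩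
    have := (hdim p' hp').resolve_left fun h =>
      (hqI.trans_le hIp').not_ge (h.2 ⟨hq, bot_le⟩ (hqI.trans_le hIp').le)
    exact (this.eq_of_le hp.ne_top ‹_›).ge
  -- the exceptions are the singular points of the components and the intersection points of two
  -- components
  refine ⟨(⋃ q ∈ minimalPrimes C, (q ⊔ Ideal.span {c q}).minimalPrimes) ∪
    ⋃ q ∈ minimalPrimes C, ⋃ q' ∈ minimalPrimes C, (q ⊔ q').minimalPrimes,
    (hfin.biUnion fun q _ => Ideal.finite_minimalPrimes_of_isNoetherianRing C _).union
      (hfin.biUnion fun q _ => hfin.biUnion fun q' _ =>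
        Ideal.finite_minimalPrimes_of_isNoetherianRing C _), ?_⟩
  intro p hp hpF A _ _ _ _
  simp only [Set.mem_union, Set.mem_iUnion, not_or, not_exists] at hpF
  obtain ⟨q, hq, hqp⟩ := Ideal.exists_minimalPrimes_le (J := p) bot_le
  have := hq.1.1
  have hker : RingHom.ker (Ideal.Quotient.mk q) ≤ p := by rwa [Ideal.mk_ker]
  obtain ⟨P, hP, rfl⟩ : ∃ P : Ideal (C ⧸ q), P.IsPrime ∧ p = P.comap (Ideal.Quotient.mk q) :=
    ⟨p.map (Ideal.Quotient.mk q), Ideal.map_isPrime_of_surjective Ideal.Quotient.mk_surjective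
      hker, by
      rw [Ideal.comap_map_of_surjective' _ Ideal.Quotient.mk_surjective, sup_eq_left.mpr hker]⟩
  have hAN : IsNoetherianRing A :=
    IsLocalization.isNoetherianRing (P.comap (Ideal.Quotient.mk q)).primeCompl A ‹_›
  obtain ⟨x, N, hNil, hm⟩ := exists_maximalIdeal_eq_span_sup C A q P (fun q' hq' hle => by
    by_contra hne
    refine hpF.2 q hq q' hq' (hmin q _ _ this hp (lt_of_le_of_ne le_sup_left fun h => hne ?_)
      (sup_le hqp hle))
    exact le_antisymm (h ▸ le_sup_right) (hq.2 hq'.1 (h ▸ le_sup_right))) (hc' q this P fun hcP =>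
      hpF.1 q hq (hmin q _ _ this hp (lt_of_le_of_ne le_sup_left fun h => hc q this
        (h.ge (Ideal.mem_sup_right (Ideal.mem_span_singleton_self _))))
        (sup_le hqp ((Ideal.span_singleton_le_iff_mem _).mpr hcP))))
  exact subsingleton_minimalPrimes_adicCompletion x N hNil hm

/-! ### Lengths and degrees of residue field extensions -/

theorem isArtinianRing_quotient_span_pow {R : Type*} [CommRing R] [IsLocalRing R]
    [IsNoetherianRing R] (t : R) (ht : t ∈ maximalIdeal R)
    [IsArtinianRing (R ⧸ Ideal.span {t})] (n : ℕ) : IsArtinianRing (R ⧸ Ideal.span {t ^ n}) := by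
  rcases Nat.eq_zero_or_pos n with rfl | hn
  · rw [pow_zero, Ideal.span_singleton_one]
    infer_instance
  have htn : t ^ n ∈ maximalIdeal R := Ideal.pow_mem_of_mem _ ht n hn
  have : Nontrivial (R ⧸ Ideal.span {t ^ n}) := Ideal.Quotient.nontrivial_iff.mpr fun h =>
    (maximalIdeal.isMaximal R).ne_top
      (top_le_iff.mp (h ▸ (Ideal.span_singleton_le_iff_mem _).mpr htn))
  have : IsLocalRing (R ⧸ Ideal.span {t ^ n}) :=
    .of_surjective' (Ideal.Quotient.mk _) Ideal.Quotient.mk_surjective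
  have hloc : IsLocalHom (Ideal.Quotient.mk (Ideal.span {t ^ n})) :=
    .of_surjective _ Ideal.Quotient.mk_surjective
  obtain ⟨k, hk⟩ := exists_maximalIdeal_pow_le_of_isArtinianRing_quotient (Ideal.span {t})
  rw [isArtinianRing_iff_isNilpotent_maximalIdeal]
  refine ⟨k * n, ?_⟩
  rw [← map_maximalIdeal_of_surjective _ Ideal.Quotient.mk_surjective, ← Ideal.map_pow,
    Ideal.zero_eq_bot, Ideal.map_eq_bot_iff_le_ker, Ideal.mk_ker, pow_mul]
  exact (Ideal.pow_right_mono hk n).trans_eq (Ideal.span_singleton_pow _ _)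

/-- If `R ⊆ M` with `tⁿ M ⊆ R`, then `M ⧸ tM` and `R ⧸ tR` have the same length. Both are
compared with `M ⧸ tR`, using that `M ⧸ R` has finite length. -/
theorem length_quotient_smul_eq {R M : Type*} [CommRing R] [IsLocalRing R] [IsNoetherianRing R]
    [AddCommGroup M] [Module R M] [Module.Finite R M] (f : R →ₗ[R] M)
    (hf : Function.Injective f) (t : R) (ht : t ∈ maximalIdeal R)
    [IsArtinianRing (R ⧸ Ideal.span {t})] (hM : IsSMulRegular M t) (n : ℕ)
    (hn : ∀ z : M, t ^ n • z ∈ LinearMap.range f) :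
    Module.length R (M ⧸ LinearMap.range (LinearMap.lsmul R M t)) =
      Module.length R (R ⧸ Ideal.span {t}) := by
  set T := LinearMap.lsmul R M t
  set N := LinearMap.range f
  have := isArtinianRing_quotient_span_pow t ht n
  have hfin : Module.length R (M ⧸ N) ≠ ⊤ := by
    have htor : Module.IsTorsionBySet R (M ⧸ N) (Ideal.span {t ^ n} : Ideal R) := by
      rw [Module.isTorsionBySet_span_singleton_iff]
      intro x
      obtain ⟨z, rfl⟩ := N.mkQ_surjective x
      rw [← map_smul]
      exact (Submodule.Quotient.mk_eq_zero N).mpr (hn z)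
    let : Module (R ⧸ Ideal.span {t ^ n}) (M ⧸ N) := htor.module
    have : IsScalarTower R (R ⧸ Ideal.span {t ^ n}) (M ⧸ N) := htor.isScalarTower
    have : Module.Finite (R ⧸ Ideal.span {t ^ n}) (M ⧸ N) := .of_restrictScalars_finite R _ _
    rw [Module.length_eq_of_surjective (R := R ⧸ Ideal.span {t ^ n}) Ideal.Quotient.mk_surjective]
    exact Module.length_ne_top
  have hTN : N.map T ≤ N := by
    rintro _ ⟨_, ⟨r, rfl⟩, rfl⟩
    exact ⟨t • r, map_smul f t r⟩
  have h1 : Module.length R (M ⧸ N.map T) =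
      Module.length R (R ⧸ Ideal.span {t}) + Module.length R (M ⧸ N) := by
    have hle : Ideal.span {t} ≤ (N.map T).comap f := by
      rw [Ideal.span_singleton_le_iff_mem]
      exact ⟨f 1, ⟨1, rfl⟩, by simp [T, ← map_smul]⟩
    refine Module.length_eq_add_of_exact (Submodule.mapQ _ _ f hle) (Submodule.factor hTN)
      ?_ (Submodule.factor_surjective hTN) ?_
    · rw [← LinearMap.ker_eq_bot, LinearMap.ker_eq_bot']
      intro x hx
      obtain ⟨r, rfl⟩ := Submodule.mkQ_surjective _ x
      obtain ⟨_, ⟨s, rfl⟩, hs⟩ := (Submodule.Quotient.mk_eq_zero _).mp hx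
      refine (Submodule.Quotient.mk_eq_zero _).mpr ?_
      have : t * s = r := hf ((map_smul f t s).trans hs)
      exact this ▸ Ideal.mul_mem_right _ _ (Ideal.mem_span_singleton_self t)
    · intro x
      obtain ⟨z, rfl⟩ := Submodule.mkQ_surjective _ x
      constructor
      · intro hz
        obtain ⟨r, rfl⟩ := (Submodule.Quotient.mk_eq_zero N).mp hz
        exact ⟨Submodule.Quotient.mk r, rfl⟩
      · rintro ⟨y, hy⟩
        obtain ⟨r, rfl⟩ := Submodule.mkQ_surjective _ y
        rw [← hy]
        exact (Submodule.Quotient.mk_eq_zero N).mpr ⟨r, rfl⟩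
  have hTr : N.map T ≤ LinearMap.range T := LinearMap.map_le_range
  have h2 : Module.length R (M ⧸ N.map T) =
      Module.length R (M ⧸ N) + Module.length R (M ⧸ LinearMap.range T) := by
    refine Module.length_eq_add_of_exact (Submodule.mapQ N (N.map T) T (Submodule.le_comap_map _ _))
      (Submodule.factor hTr) ?_ (Submodule.factor_surjective hTr) ?_
    · rw [← LinearMap.ker_eq_bot, LinearMap.ker_eq_bot']
      intro x hx
      obtain ⟨z, rfl⟩ := Submodule.mkQ_surjective _ x
      obtain ⟨w, hw, hs⟩ := (Submodule.Quotient.mk_eq_zero _).mp hx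
      refine (Submodule.Quotient.mk_eq_zero _).mpr ?_
      exact hM hs ▸ hw
    · intro x
      obtain ⟨z, rfl⟩ := Submodule.mkQ_surjective _ x
      constructor
      · intro hz
        obtain ⟨r, rfl⟩ := (Submodule.Quotient.mk_eq_zero (LinearMap.range T)).mp hz
        exact ⟨Submodule.Quotient.mk r, rfl⟩
      · rintro ⟨y, hy⟩
        obtain ⟨r, rfl⟩ := Submodule.mkQ_surjective _ y
        rw [← hy]
        exact (Submodule.Quotient.mk_eq_zero (LinearMap.range T)).mpr ⟨r, rfl⟩
  rw [h1, add_comm] at h2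
  exact (WithTop.add_left_cancel hfin h2).symm

/-- If `R'` is a finite extension of `R` with `tⁿ R' ⊆ R`, then the degrees of its residue fields
add up to at most the length of `R ⧸ (t)`: the product of these fields is a quotient of `R' ⧸ tR'`,
which has the same length as `R ⧸ tR`. -/
theorem sum_finrank_le_length {R R' κ : Type} [CommRing R] [IsLocalRing R] [IsNoetherianRing R]
    [CommRing R'] [Algebra R R'] [Module.Finite R R'] [Field κ] [Algebra R κ]
    (hκ : Function.Surjective (algebraMap R κ)) {ι : Type} [Fintype ι] (K : ι → Type)
    [∀ i, Field (K i)] [∀ i, Algebra κ (K i)] [∀ i, Algebra R (K i)]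
    [∀ i, IsScalarTower R κ (K i)] (ρ : ∀ i, R' →ₐ[R] K i)
    (hρ : ∀ i, Function.Surjective (ρ i))
    (hinj : Function.Injective fun i => RingHom.ker (ρ i))
    (hR' : Function.Injective (algebraMap R R')) (t : R) (ht : t ∈ maximalIdeal R)
    [IsArtinianRing (R ⧸ Ideal.span {t})] (htR' : IsSMulRegular R' t) (n : ℕ)
    (hn : ∀ z : R', t ^ n • z ∈ (algebraMap R R').range) :
    (∀ i, Module.Finite κ (K i)) ∧
      ((∑ i, Module.finrank κ (K i) : ℕ) : ℕ∞) ≤ Module.length R (R ⧸ Ideal.span {t}) := by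
  have hfin (i) : Module.Finite κ (K i) := by
    have : Module.Finite R (K i) := Module.Finite.of_surjective (ρ i).toLinearMap (hρ i)
    exact .of_restrictScalars_finite R _ _
  refine ⟨hfin, ?_⟩
  rw [← length_quotient_smul_eq (Algebra.linearMap R R') hR' t ht htR' n hn]
  have hlen : ((∑ i, Module.finrank κ (K i) : ℕ) : ℕ∞) = Module.length R (∀ i, K i) := by
    rw [Module.length_pi_of_fintype, Nat.cast_sum]
    refine Finset.sum_congr rfl fun i _ => ?_
    rw [Module.length_eq_of_surjective (R := κ) hκ, Module.length_eq_finrank]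
  rw [hlen]
  let Φ : R' →ₗ[R] (∀ i, K i) := LinearMap.pi fun i => (ρ i).toLinearMap
  have hΦ : Function.Surjective Φ := by
    intro y
    choose r hr using fun i => hρ i (y i)
    have hmax (i) : (RingHom.ker (ρ i)).IsMaximal := RingHom.ker_isMaximal_of_surjective _ (hρ i)
    obtain ⟨x, hx⟩ := Ideal.exists_forall_sub_mem_ideal (I := fun i => RingHom.ker (ρ i))
      (fun i j hij => Ideal.isCoprime_of_isMaximal fun h => hij (hinj h)) r
    refine ⟨x, funext fun i => ?_⟩
    have := RingHom.mem_ker.mp (hx i)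
    rw [map_sub, hr, sub_eq_zero] at this
    exact this
  have ht0 : algebraMap R κ t = 0 := by
    have := RingHom.ker_isMaximal_of_surjective _ hκ
    rw [← RingHom.mem_ker, eq_maximalIdeal this]
    exact ht
  refine Module.length_le_of_surjective (Submodule.liftQ _ Φ ?_) ?_
  · rintro _ ⟨z, rfl⟩
    refine funext fun i => ?_
    change ρ i (t • z) = 0
    rw [map_smul, Algebra.smul_def, IsScalarTower.algebraMap_apply R κ (K i), ht0, map_zero,
      zero_mul]
  · intro y
    obtain ⟨x, hx⟩ := hΦ y
    exact ⟨Submodule.Quotient.mk x, hx⟩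

/-! ### Smooth curves -/

/-- The local rings of a smooth curve at its closed points are discrete valuation rings: the
cotangent space is identified with the fibre of the module of differentials, which is a line. -/
theorem isDiscreteValuationRing_of_isStandardSmooth (k A O : Type) [Field k] [IsAlgClosed k]
    [CommRing A] [IsDomain A] [Algebra k A] [Algebra.IsStandardSmoothOfRelativeDimension 1 k A]
    (p : Ideal A) [p.IsMaximal] [CommRing O] [IsDomain O] [Algebra A O]
    [IsLocalization.AtPrime O p] : IsDiscreteValuationRing O := by
  have : Algebra.IsStandardSmooth k A :=
    Algebra.IsStandardSmoothOfRelativeDimension.isStandardSmooth 1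
  have : Algebra.FiniteType k A := inferInstance
  have : IsNoetherianRing A := Algebra.FiniteType.isNoetherianRing k A
  have : IsNoetherianRing O := IsLocalization.isNoetherianRing p.primeCompl O ‹_›
  have : IsLocalRing O := IsLocalization.AtPrime.isLocalRing O p
  let κ := A ⧸ p
  let : Field κ := Ideal.Quotient.field p
  have : Algebra.FiniteType k κ := Algebra.FiniteType.of_surjective
    (Ideal.Quotient.mkₐ k p) Ideal.Quotient.mk_surjective
  have : Module.Finite k κ := finite_of_finite_type_of_isJacobsonRing k κ
  have hbij : Function.Bijective (algebraMap k κ) :=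
    IsAlgClosed.algebraMap_bijective_of_isIntegral
  have : Algebra.FormallySmooth k κ :=
    .of_equiv (AlgEquiv.ofBijective (Algebra.ofId k κ) hbij)
  have : Algebra.FormallySmooth k A := inferInstance
  have hsurj : Function.Surjective (algebraMap A κ) := Ideal.Quotient.mk_surjective
  have hker : RingHom.ker (algebraMap A κ) = p := Ideal.mk_ker
  have hφi : Function.Injective (KaehlerDifferential.kerCotangentToTensor k A κ) :=
    (Algebra.FormallySmooth.kerCotangentToTensor_injective_iff hsurj).mpr inferInstance
  have hΩ : Subsingleton (Ω[κ⁄k]) :=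
    KaehlerDifferential.subsingleton_of_surjective k κ hbij.surjective
  have hφs : Function.Surjective (KaehlerDifferential.kerCotangentToTensor k A κ) := by
    rw [← LinearMap.range_eq_top, KaehlerDifferential.range_kerCotangentToTensor k A κ hsurj,
      eq_top_iff]
    exact fun x _ => Subsingleton.elim _ _
  have hrank : Module.finrank κ (κ ⊗[A] Ω[A⁄k]) = 1 := by
    rw [Module.finrank_baseChange, Module.finrank,
      Algebra.IsStandardSmoothOfRelativeDimension.rank_kaehlerDifferential 1]
    simp
  obtain ⟨w, hw, hgen⟩ := finrank_eq_one_iff'.mp hrank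
  obtain ⟨c, rfl⟩ := hφs w
  obtain ⟨a, rfl⟩ := Ideal.toCotangent_surjective _ c
  have hap : (a : A) ∈ p := hker.le a.2
  have ha0 : (a : A) ≠ 0 := fun h => hw (by
    rw [show a = 0 from Subtype.ext h, map_zero, map_zero])
  have hle : p ≤ Ideal.span {(a : A)} ⊔ p ^ 2 := by
    intro x hx
    obtain ⟨r, hr⟩ := hgen (KaehlerDifferential.kerCotangentToTensor k A κ
      (Ideal.toCotangent _ ⟨x, hker.symm ▸ hx⟩))
    obtain ⟨r, rfl⟩ := hsurj r
    rw [algebraMap_smul, ← map_smul, ← map_smul] at hr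
    have h := (Ideal.toCotangent_eq _).mp (hφi hr)
    have h : r * (a : A) - x ∈ RingHom.ker (algebraMap A κ) ^ 2 := h
    have h := Ideal.pow_right_mono hker.le 2 h
    have h2 : x = r * a + -(r * a - x) := by ring
    rw [h2]
    refine Submodule.add_mem_sup (Ideal.mul_mem_left _ _ (Ideal.mem_span_singleton_self _)) ?_
    exact neg_mem h
  have hO : maximalIdeal O = Ideal.span {algebraMap A O a} := by
    have hm := IsLocalization.AtPrime.map_eq_maximalIdeal p O
    refine le_antisymm ?_ ?_
    · refine Submodule.le_of_le_smul_of_le_jacobson_bot (I := maximalIdeal O)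
        (Ideal.fg_of_isNoetherianRing _) (maximalIdeal_le_jacobson _) ?_
      have := Ideal.map_mono (f := algebraMap A O) hle
      rwa [Ideal.map_sup, Ideal.map_pow, hm, Ideal.map_span, Set.image_singleton, sq] at this
    · rw [Ideal.span_singleton_le_iff_mem, ← hm]
      exact Ideal.mem_map_of_mem _ hap
  have hne : algebraMap A O a ≠ 0 := fun h => ha0 <|
    (map_eq_zero_iff _ (IsLocalization.injective O p.primeCompl_le_nonZeroDivisors)).mp h
  have hF : ¬ IsField O := by
    rw [isField_iff_maximalIdeal_eq, hO, Ideal.span_singleton_eq_bot]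
    exact hne
  have hpr : (maximalIdeal O).IsPrincipal := ⟨_, hO⟩
  exact ((IsDiscreteValuationRing.TFAE O hF).out 0 4).mpr hpr

/-- The local rings of a smooth curve over `ℂ` at its closed points are discrete valuation
rings. -/
theorem isDiscreteValuationRing_stalk {T : Scheme.{0}} (s : T ⟶ Spec (CommRingCat.of ℂ))
    [IsIntegral T] [SmoothOfRelativeDimension 1 s] (t₀ : T) (ht₀ : IsClosed ({t₀} : Set T)) :
    IsDiscreteValuationRing (T.presheaf.stalk t₀) := by
  obtain ⟨U, hU, V, hV, htV, e, h⟩ :=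
    SmoothOfRelativeDimension.exists_isStandardSmoothOfRelativeDimension (n := 1) (f := s) t₀
  obtain rfl : U = ⊤ := by
    refine top_le_iff.mp fun x _ => ?_
    rw [Subsingleton.elim (α := PrimeSpectrum ℂ) x (s t₀)]
    exact e htV
  let g : ℂ →+* Γ(T, V) := (s.appLE ⊤ V e).hom.comp
    (Scheme.ΓSpecIso (CommRingCat.of ℂ)).symm.commRingCatIsoToRingEquiv.toRingHom
  have hg : g.IsStandardSmoothOfRelativeDimension 1 :=
    (RingHom.isStandardSmoothOfRelativeDimension_respectsIso (n := 1)).2 _ _ h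
  let := g.toAlgebra
  have : Algebra.IsStandardSmoothOfRelativeDimension 1 ℂ Γ(T, V) := hg
  have : Nonempty V := ⟨⟨t₀, htV⟩⟩
  let : Algebra Γ(T, V) (T.presheaf.stalk t₀) := (T.presheaf.germ V t₀ htV).hom.toAlgebra
  have : IsLocalization.AtPrime (T.presheaf.stalk t₀) (hV.primeIdealOf ⟨t₀, htV⟩).asIdeal :=
    hV.isLocalization_stalk ⟨t₀, htV⟩
  have := hV.primeIdealOf_isMaximal_of_isClosed ⟨t₀, htV⟩ ht₀
  exact isDiscreteValuationRing_of_isStandardSmooth ℂ Γ(T, V) (T.presheaf.stalk t₀)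
    (hV.primeIdealOf ⟨t₀, htV⟩).asIdeal

/-! ### Stalk maps and fibres -/

/-- The map of local rings induced by `ν` at `x'`, with source the local ring at a point `x` that
is only propositionally equal to `ν x'`. -/
noncomputable def stalkMapTo {X' X : Scheme.{0}} (ν : X' ⟶ X) (x' : X') (x : X) (e : ν x' = x) :
    X.presheaf.stalk x →+* X'.presheaf.stalk x' :=
  (X.presheaf.stalkSpecializes (specializes_of_eq e) ≫ ν.stalkMap x').hom

theorem stalkMapTo_rfl {X' X : Scheme.{0}} (ν : X' ⟶ X) (x' : X') :
    stalkMapTo ν x' (ν x') rfl = (ν.stalkMap x').hom := by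
  simp [stalkMapTo]

instance isLocalHom_stalkMapTo {X' X : Scheme.{0}} (ν : X' ⟶ X) (x' : X') (x : X)
    (e : ν x' = x) : IsLocalHom (stalkMapTo ν x' x e) := by
  subst e
  rw [stalkMapTo_rfl]
  infer_instance

theorem stalkMapTo_comp {X'' X' X : Scheme.{0}} (g : X'' ⟶ X') (ν : X' ⟶ X) (x'' : X'') (x' : X')
    (x : X) (e : g x'' = x') (e' : ν x' = x) (h : (g ≫ ν) x'' = x) :
    stalkMapTo (g ≫ ν) x'' x h = (stalkMapTo g x'' x' e).comp (stalkMapTo ν x' x e') := by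
  subst e e'
  rw [stalkMapTo_rfl, stalkMapTo_rfl]
  exact (stalkMapTo_rfl (g ≫ ν) x'').trans
    (congrArg CommRingCat.Hom.hom (Scheme.Hom.stalkMap_comp g ν x''))

theorem stalkMapTo_congr {X' X : Scheme.{0}} {ν μ : X' ⟶ X} (h : ν = μ) (x' : X') (x : X)
    (e : ν x' = x) (e' : μ x' = x) : stalkMapTo ν x' x e = stalkMapTo μ x' x e' := by
  subst h
  rfl

theorem stalkMapTo_germ {X' X : Scheme.{0}} (ν : X' ⟶ X) (x' : X') (x : X) (e : ν x' = x)
    (U : X.Opens) (hx : x ∈ U) (b : Γ(X, U)) :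
    stalkMapTo ν x' x e (X.presheaf.germ U x hx b) =
      X'.presheaf.germ (ν ⁻¹ᵁ U) x' (e ▸ hx : ν x' ∈ U) (ν.app U b) := by
  subst e
  rw [stalkMapTo_rfl]
  exact ν.germ_stalkMap_apply U x' hx b

/-- Stalk maps commute with specialization. -/
theorem stalkSpecializes_stalkMapTo {X T : Scheme.{0}} (f : X ⟶ T) {x₁ x : X} (h : x₁ ⤳ x) (t₀ : T)
    (e : f x = t₀) (e₁ : f x₁ = t₀) (r : T.presheaf.stalk t₀) :
    stalkMapTo f x₁ t₀ e₁ r = X.presheaf.stalkSpecializes h (stalkMapTo f x t₀ e r) := by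
  subst e
  rw [stalkMapTo_rfl]
  exact Scheme.Hom.stalkSpecializes_stalkMap_apply f x₁ x h r

theorem flat_stalkMapTo {X T : Scheme.{0}} (f : X ⟶ T) [Flat f] (x : X) (t₀ : T) (e : f x = t₀) :
    (stalkMapTo f x t₀ e).Flat := by
  subst e
  rw [stalkMapTo_rfl]
  exact Flat.stalkMap f x

/-- A morphism from the spectrum of a local ring factors through the local ring at the image of
the closed point. -/
theorem exists_SpecMap_fromSpecStalk_eq {X : Scheme.{0}} (R : CommRingCat.{0}) [IsLocalRing R]
    (g : Spec R ⟶ X) (y : X) (h : g (closedPoint R) = y) :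
    ∃ ψ : X.presheaf.stalk y ⟶ R, Spec.map ψ ≫ X.fromSpecStalk y = g := by
  subst h
  exact ⟨_, Scheme.Spec_stalkClosedPointTo_fromSpecStalk g⟩

theorem SpecMap_fromSpecStalk_closedPoint {X : Scheme.{0}} {R : CommRingCat.{0}} [IsLocalRing R]
    {x : X} (φ : X.presheaf.stalk x ⟶ R) [IsLocalHom φ.hom] :
    (Spec.map φ ≫ X.fromSpecStalk x) (closedPoint R) = x :=
  (congrArg (X.fromSpecStalk x) Spec_closedPoint).trans Scheme.fromSpecStalk_closedPoint

theorem SpecMap_stalkMapTo_fromSpecStalk {X' X : Scheme.{0}} (ν : X' ⟶ X) (x' : X') (x : X)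
    (e : ν x' = x) :
    Spec.map (CommRingCat.ofHom (stalkMapTo ν x' x e)) ≫ X.fromSpecStalk x =
      X'.fromSpecStalk x' ≫ ν := by
  subst e
  rw [stalkMapTo_rfl]
  exact Scheme.SpecMap_stalkMap_fromSpecStalk ν

section fiber
variable {X T : Scheme.{0}} (f : X ⟶ T) (t₀ : T)

theorem apply_fiberι (y : f.fiber t₀) : f (f.fiberι t₀ y) = t₀ := by
  have : f.fiberι t₀ y ∈ Set.range (f.fiberι t₀) := ⟨y, rfl⟩
  rwa [Scheme.Hom.range_fiberι] at this

theorem fiberι_injective : Function.Injective (f.fiberι t₀) := (f.fiberι t₀).isEmbedding.injective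

theorem stalkMapTo_fiberι_surjective (y : f.fiber t₀) (x : X) (e : f.fiberι t₀ y = x) :
    Function.Surjective (stalkMapTo (f.fiberι t₀) y x e) := by
  subst e
  rw [stalkMapTo_rfl]
  exact (f.fiberι t₀).stalkMap_surjective y

/-- The local ring of the fibre over `t₀` is the quotient of the local ring of the total space by
the image of the maximal ideal at `t₀`. -/
theorem ker_stalkMapTo_fiberι (y : f.fiber t₀) (x : X) (e : f.fiberι t₀ y = x) (e' : f x = t₀)
    (ϖ : T.presheaf.stalk t₀) (hϖ : maximalIdeal (T.presheaf.stalk t₀) = Ideal.span {ϖ}) :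
    RingHom.ker (stalkMapTo (f.fiberι t₀) y x e) = Ideal.span {stalkMapTo f x t₀ e' ϖ} := by
  have hϖm : ϖ ∈ maximalIdeal (T.presheaf.stalk t₀) := hϖ ▸ Ideal.mem_span_singleton_self ϖ
  apply le_antisymm
  · intro r hr
    set t := stalkMapTo f x t₀ e' ϖ
    have ht : t ∈ maximalIdeal (X.presheaf.stalk x) :=
      map_maximalIdeal_le (stalkMapTo f x t₀ e') (Ideal.mem_map_of_mem _ hϖm)
    let Q := X.presheaf.stalk x ⧸ Ideal.span {t}
    have : Nontrivial Q := Ideal.Quotient.nontrivial_iff.mpr fun h =>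
      (maximalIdeal.isMaximal _).ne_top
        (top_le_iff.mp (h ▸ (Ideal.span_singleton_le_iff_mem _).mpr ht))
    have : IsLocalRing Q := .of_surjective' (Ideal.Quotient.mk _) Ideal.Quotient.mk_surjective
    have hloc : IsLocalHom (Ideal.Quotient.mk (Ideal.span {t})) :=
      .of_surjective _ Ideal.Quotient.mk_surjective
    let q : X.presheaf.stalk x →+* Q := Ideal.Quotient.mk (Ideal.span {t})
    let mk : X.presheaf.stalk x ⟶ CommRingCat.of Q := CommRingCat.ofHom q
    have hkill : ∀ a ∈ maximalIdeal (T.presheaf.stalk t₀),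
        ((Ideal.Quotient.mk (Ideal.span {t})).comp (stalkMapTo f x t₀ e')) a = 0 := by
      intro a ha
      rw [hϖ] at ha
      obtain ⟨c, rfl⟩ := Ideal.mem_span_singleton'.mp ha
      rw [map_mul, RingHom.comp_apply _ _ ϖ]
      have : Ideal.Quotient.mk (Ideal.span {t}) (stalkMapTo f x t₀ e' ϖ) = 0 :=
        Ideal.Quotient.eq_zero_iff_mem.mpr (Ideal.mem_span_singleton_self t)
      rw [this, mul_zero]
    let κ₀ : ResidueField (T.presheaf.stalk t₀) →+* Q := Ideal.Quotient.lift
      (maximalIdeal (T.presheaf.stalk t₀))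
      ((Ideal.Quotient.mk (Ideal.span {t})).comp (stalkMapTo f x t₀ e')) hkill
    let κQ : T.residueField t₀ ⟶ CommRingCat.of Q := CommRingCat.ofHom κ₀
    have hκ : T.residue t₀ ≫ κQ = CommRingCat.ofHom (stalkMapTo f x t₀ e') ≫ mk := by
      ext a
      rfl
    -- `Spec (R ⧸ (t))` maps to the fibre, so the elements of the kernel vanish in `R ⧸ (t)`
    let g : Spec (CommRingCat.of Q) ⟶ f.fiber t₀ :=
      Limits.pullback.lift (Spec.map mk ≫ X.fromSpecStalk x) (Spec.map κQ) (by
        rw [Category.assoc, ← SpecMap_stalkMapTo_fromSpecStalk f x t₀ e', ← Category.assoc,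
          ← Spec.map_comp, ← hκ, Spec.map_comp, Category.assoc]
        rfl)
    have hg : g ≫ f.fiberι t₀ = Spec.map mk ≫ X.fromSpecStalk x := Limits.pullback.lift_fst _ _ _
    have hmk : IsLocalHom mk.hom := hloc
    have hgy : g (closedPoint (CommRingCat.of Q)) = y := by
      apply fiberι_injective f t₀
      rw [e]
      exact (congrArg (fun m : Spec (CommRingCat.of Q) ⟶ X => m (closedPoint Q)) hg).trans
        (SpecMap_fromSpecStalk_closedPoint mk)
    obtain ⟨ψ, hψ⟩ := exists_SpecMap_fromSpecStalk_eq (CommRingCat.of Q) g y hgy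
    have h2 : CommRingCat.ofHom (stalkMapTo (f.fiberι t₀) y x e) ≫ ψ = mk := by
      apply Spec.map_injective
      rw [← cancel_mono (X.fromSpecStalk x), Spec.map_comp, Category.assoc,
        SpecMap_stalkMapTo_fromSpecStalk, ← Category.assoc, hψ, hg]
    rw [← Ideal.Quotient.eq_zero_iff_mem]
    change mk.hom r = 0
    rw [← h2]
    change ψ.hom (stalkMapTo (f.fiberι t₀) y x e r) = 0
    rw [RingHom.mem_ker.mp hr, map_zero]
  · rw [Ideal.span_singleton_le_iff_mem, RingHom.mem_ker, ← RingHom.comp_apply,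
      ← stalkMapTo_comp _ _ _ _ _ _ _ (by rw [Scheme.Hom.comp_apply, e, e'])]
    have hc : f.fiberι t₀ ≫ f = f.fiberToSpecResidueField t₀ ≫ T.fromSpecResidueField t₀ :=
      Limits.pullback.condition
    let z : Spec (T.residueField t₀) := closedPoint (T.residueField t₀)
    have hz : T.fromSpecResidueField t₀ z = t₀ := T.fromSpecResidueField_apply t₀ z
    have hyz : f.fiberToSpecResidueField t₀ y = z := f.fiberToSpecResidueField_apply t₀ y
    rw [stalkMapTo_congr hc _ _ _ (by rw [Scheme.Hom.comp_apply, hyz, hz]),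
      stalkMapTo_comp _ _ _ z _ hyz hz, RingHom.comp_apply]
    have hfield : IsField ((Spec (T.residueField t₀)).presheaf.stalk z) :=
      (stalkClosedPointIso (T.residueField t₀)).commRingCatIsoToRingEquiv.toMulEquiv.isField
        (Field.toIsField (T.residueField t₀))
    have h0 : stalkMapTo (T.fromSpecResidueField t₀) z t₀ hz ϖ = 0 := by
      have := map_maximalIdeal_le (stalkMapTo (T.fromSpecResidueField t₀) z t₀ hz)
        (Ideal.mem_map_of_mem _ hϖm)
      rwa [isField_iff_maximalIdeal_eq.mp hfield] at this
    rw [h0, map_zero]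

end fiber

/-! ### Generizations of a point, reducedness and dimension -/

/-- The prime ideal of the local ring at `x` corresponding to a generization `x₁` of `x`. -/
noncomputable def primeOfSpecializes {X : Scheme.{0}} {x₁ x : X} (h : x₁ ⤳ x) :
    PrimeSpectrum (X.presheaf.stalk x) :=
  PrimeSpectrum.comap (X.presheaf.stalkSpecializes h).hom (closedPoint (X.presheaf.stalk x₁))

theorem fromSpecStalk_primeOfSpecializes {X : Scheme.{0}} {x₁ x : X} (h : x₁ ⤳ x) :
    X.fromSpecStalk x (primeOfSpecializes h) = x₁ := by
  have := congrArg (fun m : Spec (X.presheaf.stalk x₁) ⟶ X => m (closedPoint _))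
    (Scheme.SpecMap_stalkSpecializes_fromSpecStalk h)
  exact this.trans Scheme.fromSpecStalk_closedPoint

theorem fromSpecStalk_specializes {X : Scheme.{0}} (x : X)
    (q : PrimeSpectrum (X.presheaf.stalk x)) : X.fromSpecStalk x q ⤳ x := by
  have : X.fromSpecStalk x q ∈ Set.range (X.fromSpecStalk x) := ⟨q, rfl⟩
  rwa [Scheme.range_fromSpecStalk] at this

theorem primeOfSpecializes_fromSpecStalk {X : Scheme.{0}} (x : X)
    (q : PrimeSpectrum (X.presheaf.stalk x)) :
    primeOfSpecializes (fromSpecStalk_specializes x q) = q :=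
  (X.fromSpecStalk x).isEmbedding.injective (fromSpecStalk_primeOfSpecializes _)

/-- If `T` is a local ring that is a localization of `B`, and `S` is an intermediate localization,
then `T` is a localization of `S`. -/
theorem isLocalization_atPrime_comap_maximalIdeal {B S T : Type*} [CommRing B] [CommRing S]
    [CommRing T] [IsLocalRing T] [Algebra B S] [Algebra B T] [Algebra S T] [IsScalarTower B S T]
    (M : Submonoid B) [IsLocalization M S] (P : Ideal B) [P.IsPrime]
    [IsLocalization.AtPrime T P] :
    IsLocalization.AtPrime T ((maximalIdeal T).comap (algebraMap S T)) := by
  have hle : M ≤ P.primeCompl := by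
    intro b hb hbP
    have hu := (IsLocalization.map_units S (⟨b, hb⟩ : M)).map (algebraMap S T)
    rw [← IsScalarTower.algebraMap_apply] at hu
    exact (IsLocalization.AtPrime.isUnit_to_map_iff T P b).mp hu hbP
  have h3 := IsLocalization.isLocalization_of_submonoid_le S T M P.primeCompl hle
  refine IsLocalization.of_le (P.primeCompl.map (algebraMap B S)) _ ?_ fun r hr => ?_
  · rintro _ ⟨b, hb, rfl⟩ hb₁
    have hu := IsLocalization.map_units T (⟨b, hb⟩ : P.primeCompl)
    rw [IsScalarTower.algebraMap_apply B S T] at hu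
    exact (mem_maximalIdeal _).mp hb₁ hu
  · by_contra hu
    exact hr ((mem_maximalIdeal _).mpr hu)

/-- The local ring at a generization of `x` is a localization of the local ring at `x`. -/
theorem isLocalization_stalkSpecializes {X : Scheme.{0}} {x₁ x : X} (h : x₁ ⤳ x) :
    letI := (X.presheaf.stalkSpecializes h).hom.toAlgebra
    IsLocalization.AtPrime (X.presheaf.stalk x₁) (primeOfSpecializes h).asIdeal := by
  let : Algebra (X.presheaf.stalk x) (X.presheaf.stalk x₁) :=
    (X.presheaf.stalkSpecializes h).hom.toAlgebra
  obtain ⟨_, ⟨U, hU, rfl⟩, hxU, -⟩ := X.isBasis_affineOpens.exists_subset_of_mem_open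
    (Set.mem_univ x) isOpen_univ
  have hU : IsAffineOpen U := hU
  have hxU : x ∈ U := hxU
  have hx₁U : x₁ ∈ U := h.mem_open U.2 hxU
  let : Algebra Γ(X, U) (X.presheaf.stalk x) := (X.presheaf.germ U x hxU).hom.toAlgebra
  let : Algebra Γ(X, U) (X.presheaf.stalk x₁) := (X.presheaf.germ U x₁ hx₁U).hom.toAlgebra
  have h1 : IsLocalization.AtPrime (X.presheaf.stalk x) (hU.primeIdealOf ⟨x, hxU⟩).asIdeal :=
    hU.isLocalization_stalk ⟨x, hxU⟩
  have h2 : IsLocalization.AtPrime (X.presheaf.stalk x₁) (hU.primeIdealOf ⟨x₁, hx₁U⟩).asIdeal :=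
    hU.isLocalization_stalk ⟨x₁, hx₁U⟩
  have htower : IsScalarTower Γ(X, U) (X.presheaf.stalk x) (X.presheaf.stalk x₁) :=
    IsScalarTower.of_algebraMap_eq' (congrArg CommRingCat.Hom.hom
      (X.presheaf.germ_stalkSpecializes hxU h)).symm
  exact isLocalization_atPrime_comap_maximalIdeal (hU.primeIdealOf ⟨x, hxU⟩).asIdeal.primeCompl
    (hU.primeIdealOf ⟨x₁, hx₁U⟩).asIdeal

/-- A nonzero parameter at `t₀` is a nonzerodivisor in the local rings above `t₀`. -/
theorem isSMulRegular_stalkMapTo {X T : Scheme.{0}} (f : X ⟶ T) [Flat f] (x : X) (t₀ : T)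
    [IsDomain (T.presheaf.stalk t₀)] (e : f x = t₀) (ϖ : T.presheaf.stalk t₀) (hϖ : ϖ ≠ 0) :
    IsSMulRegular (X.presheaf.stalk x) (stalkMapTo f x t₀ e ϖ) := by
  algebraize [stalkMapTo f x t₀ e]
  have : Module.Flat (T.presheaf.stalk t₀) (X.presheaf.stalk x) := flat_stalkMapTo f x t₀ e
  intro a b hab
  refine smul_right_injective (X.presheaf.stalk x) hϖ ?_
  change ϖ • a = ϖ • b
  rw [Algebra.smul_def, Algebra.smul_def]
  exact hab

/-- The parameter vanishes at the generizations of `x` that lie over `t₀`. -/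
theorem stalkMapTo_mem_of_apply_eq {X T : Scheme.{0}} (f : X ⟶ T) {x₁ x : X} (h : x₁ ⤳ x) (t₀ : T)
    (e : f x = t₀) (e₁ : f x₁ = t₀) (ϖ : T.presheaf.stalk t₀)
    (hϖ : ϖ ∈ maximalIdeal (T.presheaf.stalk t₀)) :
    stalkMapTo f x t₀ e ϖ ∈ (primeOfSpecializes h).asIdeal := by
  change X.presheaf.stalkSpecializes h (stalkMapTo f x t₀ e ϖ) ∈ maximalIdeal _
  rw [← stalkSpecializes_stalkMapTo f h t₀ e e₁]
  exact map_maximalIdeal_le (stalkMapTo f x₁ t₀ e₁) (Ideal.mem_map_of_mem _ hϖ)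

/-- The nilpotents of a scheme that is flat over a curve cannot be supported on a fibre. -/
theorem isReduced_of_isDomain_stalk {X T : Scheme.{0}} (f : X ⟶ T) [Flat f] (t₀ : T)
    [IsDomain (T.presheaf.stalk t₀)] (ϖ : T.presheaf.stalk t₀)
    (hϖm : ϖ ∈ maximalIdeal (T.presheaf.stalk t₀)) (hϖ : ϖ ≠ 0)
    (h : ∀ x : X, f x ≠ t₀ → IsDomain (X.presheaf.stalk x)) : IsReduced X := by
  suffices ∀ x : X, _root_.IsReduced (X.presheaf.stalk x) from isReduced_of_isReduced_stalk X
  intro x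
  by_cases e : f x = t₀
  swap
  · have := h x e
    infer_instance
  refine ⟨fun z hz => ?_⟩
  set t := stalkMapTo f x t₀ e ϖ with ht
  have htreg : IsSMulRegular (X.presheaf.stalk x) t := isSMulRegular_stalkMapTo f x t₀ e ϖ hϖ
  -- if no power of `t` kills the nilpotent `z`, then `z` survives at a point outside of the fibre
  by_cases hd : Disjoint ((Ideal.span {z}).annihilator : Set (X.presheaf.stalk x))
      (Submonoid.powers t)
  · obtain ⟨q, hq, hle, hqt⟩ := Ideal.exists_le_prime_disjoint _ _ hd
    let x₁ := X.fromSpecStalk x ⟨q, hq⟩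
    have hsp : x₁ ⤳ x := fromSpecStalk_specializes x ⟨q, hq⟩
    have hprime : primeOfSpecializes hsp = ⟨q, hq⟩ := primeOfSpecializes_fromSpecStalk x ⟨q, hq⟩
    have hx₁ : f x₁ ≠ t₀ := by
      intro e₁
      have := stalkMapTo_mem_of_apply_eq f hsp t₀ e e₁ ϖ hϖm
      rw [hprime] at this
      exact Set.disjoint_left.mp hqt this (Submonoid.mem_powers t)
    have := h x₁ hx₁
    let := (X.presheaf.stalkSpecializes hsp).hom.toAlgebra
    have hloc := isLocalization_stalkSpecializes hsp
    rw [hprime] at hloc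
    have hz0 : algebraMap (X.presheaf.stalk x) (X.presheaf.stalk x₁) z = 0 :=
      (hz.map (algebraMap (X.presheaf.stalk x) (X.presheaf.stalk x₁))).eq_zero
    obtain ⟨s, hs⟩ := (IsLocalization.map_eq_zero_iff q.primeCompl _ z).mp hz0
    exact absurd (hle (Submodule.mem_annihilator_span_singleton _ _ |>.mpr hs)) s.2
  · obtain ⟨_, hr, n, rfl⟩ := Set.not_disjoint_iff.mp hd
    have h0 : t ^ n • z = 0 := Submodule.mem_annihilator_span_singleton _ _ |>.mp hr
    exact (htreg.pow n) (h0.trans (smul_zero _).symm)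

theorem ringKrullDim_stalk_le {X : Scheme.{0}} (x : X) :
    ringKrullDim (X.presheaf.stalk x) ≤ topologicalKrullDim X := by
  rw [← PrimeSpectrum.topologicalKrullDim_eq_ringKrullDim]
  exact (X.fromSpecStalk x).isEmbedding.isInducing.topologicalKrullDim_le

/-- Dividing a two-dimensional local domain by a nonzero element lowers the dimension. -/
theorem krullDimLE_one_of_ker_eq {R R₀ : Type*} [CommRing R] [IsDomain R] [CommRing R₀]
    [IsLocalRing R₀] (hR : ringKrullDim R ≤ 2) (π : R →+* R₀) (hπ : Function.Surjective π) (t : R)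
    (ht : t ≠ 0) (hker : RingHom.ker π = Ideal.span {t}) : Ring.KrullDimLE 1 R₀ := by
  rw [Ring.krullDimLE_one_iff]
  intro P hP
  by_contra! hcon
  obtain ⟨Q, hQ, hQP⟩ := Ideal.exists_minimalPrimes_le (J := P) bot_le
  have := hQ.1.1
  have h1 : Q < P := lt_of_le_of_ne hQP fun h => hcon.1 (h ▸ hQ)
  have h2 : P < maximalIdeal R₀ := lt_of_le_of_ne (le_maximalIdeal hP.ne_top) fun h =>
    hcon.2 (h ▸ inferInstance)
  have hlt {I J : Ideal R₀} (h : I < J) : I.comap π < J.comap π :=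
    lt_of_le_of_ne (Ideal.comap_mono h.le) fun he =>
      h.ne (Ideal.comap_injective_of_surjective π hπ he)
  have h0 : (⊥ : Ideal R) < Q.comap π := bot_lt_iff_ne_bot.mpr fun h => ht <| by
    have : t ∈ Q.comap π := (Ideal.comap_mono bot_le : RingHom.ker π ≤ _)
      (hker.ge (Ideal.mem_span_singleton_self t))
    rwa [h] at this
  let l : LTSeries (PrimeSpectrum R) :=
    ⟨3, ![⟨⊥, Ideal.isPrime_bot⟩, ⟨Q.comap π, inferInstance⟩, ⟨P.comap π, inferInstance⟩,
      ⟨(maximalIdeal R₀).comap π, inferInstance⟩], fun i => by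
        fin_cases i
        · exact h0
        · exact hlt h1
        · exact hlt h2⟩
  have := (Order.le_krullDim_iff.mpr ⟨l, rfl⟩).trans hR
  change ((3 : ℕ) : WithBot ℕ∞) ≤ 2 at this
  exact absurd this (by decide)

/-! ### Birational integral morphisms -/

section
variable {X' X : Scheme.{0}} [IsIntegral X'] [IsIntegral X] (ν : X' ⟶ X) {U : X.Opens}
  (hU : Dense (U : Set X)) [IsIso (ν ∣_ U)]

include hU in
theorem apply_genericPoint_of_isIso : ν (genericPoint X') = genericPoint X := by
  have hη : genericPoint X ∈ U := by
    refine ((genericPoint_spec X).mem_open_set_iff U.2).mpr ?_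
    rw [Set.univ_inter]
    exact hU.nonempty
  obtain ⟨z, hz⟩ := (ν ∣_ U).homeomorph.surjective ⟨genericPoint X, hη⟩
  have hz' : ν z.1 = genericPoint X := by
    rw [← morphismRestrict_base_coe]
    exact congrArg Subtype.val hz
  have h1 : ν (genericPoint X') ⤳ genericPoint X := by
    rw [← hz']
    exact ((genericPoint_spec X').specializes trivial).map ν.continuous
  exact h1.antisymm ((genericPoint_spec X).specializes trivial) |>.eq

include hU in
theorem bijective_stalkMapTo_genericPoint (e : ν (genericPoint X') = genericPoint X) :
    Function.Bijective (stalkMapTo ν (genericPoint X') (genericPoint X) e) := by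
  have hη : ν (genericPoint X') ∈ U := by
    rw [e]
    refine ((genericPoint_spec X).mem_open_set_iff U.2).mpr ?_
    rw [Set.univ_inter]
    exact hU.nonempty
  have : IsIso (ν.stalkMap (genericPoint X')) := by
    let z : (ν ⁻¹ᵁ U).toScheme := ⟨genericPoint X', hη⟩
    have h := morphismRestrictStalkMap ν U z
    have hz : IsIso ((ν ∣_ U).stalkMap z) := inferInstance
    exact ((MorphismProperty.isomorphisms CommRingCat).arrow_mk_iso_iff h).mp hz
  have h2 : IsIso (X.presheaf.stalkSpecializes (specializes_of_eq e)) :=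
    inferInstanceAs (IsIso (X.presheaf.stalkCongr (.of_eq e.symm)).hom)
  exact ConcreteCategory.bijective_of_isIso
    (X.presheaf.stalkSpecializes (specializes_of_eq e) ≫ ν.stalkMap (genericPoint X'))

include hU in
theorem isFractionRing_functionField (V : X.Opens) (hV : IsAffineOpen V) [Nonempty V]
    [Nonempty (ν ⁻¹ᵁ V)] :
    letI := ((X'.germToFunctionField (ν ⁻¹ᵁ V)).hom.comp (ν.app V).hom).toAlgebra
    IsFractionRing Γ(X, V) X'.functionField := by
  let : Algebra Γ(X, V) X'.functionField :=
    ((X'.germToFunctionField (ν ⁻¹ᵁ V)).hom.comp (ν.app V).hom).toAlgebra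
  have e := apply_genericPoint_of_isIso ν hU
  have := functionField_isFractionRing_of_isAffineOpen X V hV
  have hη : genericPoint X ∈ V := ((genericPoint_spec X).mem_open_set_iff V.2).mpr (by
    rw [Set.univ_inter]; exact Set.nonempty_coe_sort.mp ‹_›)
  refine IsLocalization.isLocalization_of_algEquiv (S := X.functionField) _
    (AlgEquiv.ofBijective
      { toRingHom := stalkMapTo ν (genericPoint X') (genericPoint X) e
        commutes' := fun b => stalkMapTo_germ ν _ _ e V hη b }
      (bijective_stalkMapTo_genericPoint ν hU e))

include hU in
/-- An integral birational morphism to a variety is finite. -/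
theorem finite_app_of_isIntegralHom (s : X ⟶ Spec (CommRingCat.of ℂ)) [LocallyOfFiniteType s]
    [IsIntegralHom ν] (V : X.Opens) (hV : IsAffineOpen V) [Nonempty (ν ⁻¹ᵁ V)] :
    (ν.app V).hom.Finite := by
  have : Nonempty V := ‹Nonempty (ν ⁻¹ᵁ V)›.elim fun z => ⟨⟨ν z.1, z.2⟩⟩
  let : Algebra Γ(X, V) X'.functionField :=
    ((X'.germToFunctionField (ν ⁻¹ᵁ V)).hom.comp (ν.app V).hom).toAlgebra
  have := isFractionRing_functionField ν hU V hV
  have hft : (s.appLE ⊤ V le_top).hom.FiniteType :=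
    LocallyOfFiniteType.finiteType_appLE s (isAffineOpen_top _) hV _
  let g : ℂ →+* Γ(X, V) := (s.appLE ⊤ V le_top).hom.comp
    (Scheme.ΓSpecIso (CommRingCat.of ℂ)).symm.commRingCatIsoToRingEquiv.toRingHom
  have hg : g.FiniteType := hft.comp <| .of_surjective _
    (Scheme.ΓSpecIso (CommRingCat.of ℂ)).symm.commRingCatIsoToRingEquiv.surjective
  algebraize [g, (ν.app V).hom]
  have : IsScalarTower Γ(X, V) Γ(X', ν ⁻¹ᵁ V) X'.functionField :=
    IsScalarTower.of_algebraMap_eq fun _ => rfl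
  have : Algebra.IsIntegral Γ(X, V) Γ(X', ν ⁻¹ᵁ V) := ⟨IsIntegralHom.isIntegral_app ν V hV⟩
  exact finite_of_isIntegral_of_injective ℂ Γ(X, V) Γ(X', ν ⁻¹ᵁ V) X'.functionField
    (X'.germToFunctionField_injective (ν ⁻¹ᵁ V))
end

/-! ### The semilocal ring of a finite birational morphism at a point -/

/-- The semilocal ring of `X'` along the fibre of a finite birational morphism `ν : X' ⟶ X` over a
point `x`: a finite extension of the local ring at `x` inside the function field, whose
localizations at its maximal ideals are the local rings of `X'` at the points over `x`. -/
structure SemilocalRing {X' X : Scheme.{0}} [IsIntegral X'] (ν : X' ⟶ X) (x : X) where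
  /-- the underlying type of the ring -/
  ring : Type
  [commRing : CommRing ring]
  [algebra : Algebra (X.presheaf.stalk x) ring]
  [finite : Module.Finite (X.presheaf.stalk x) ring]
  /-- the embedding in the function field -/
  toFunctionField : ring →+* X'.functionField
  toFunctionField_injective : Function.Injective toFunctionField
  isFractionRing :
    letI := (toFunctionField.comp (algebraMap (X.presheaf.stalk x) ring)).toAlgebra
    IsFractionRing (X.presheaf.stalk x) X'.functionField
  /-- the localization maps -/
  toStalk (x' : X') (e : ν x' = x) : ring →+* X'.presheaf.stalk x'
  toStalk_comp (x' : X') (e : ν x' = x) :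
    (toStalk x' e).comp (algebraMap (X.presheaf.stalk x) ring) = stalkMapTo ν x' x e
  isLocalization (x' : X') (e : ν x' = x) :
    letI := (toStalk x' e).toAlgebra
    IsLocalization.AtPrime (X'.presheaf.stalk x') ((maximalIdeal _).comap (toStalk x' e))
  exists_eq_comap (n : Ideal ring) (hn : n.IsMaximal) :
    ∃ (x' : X') (e : ν x' = x), n = (maximalIdeal _).comap (toStalk x' e)
  eq_of_comap_eq (x' x'' : X') (e : ν x' = x) (e' : ν x'' = x)
    (h : (maximalIdeal _).comap (toStalk x' e) = (maximalIdeal _).comap (toStalk x'' e')) :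
    x' = x''

attribute [instance] SemilocalRing.commRing SemilocalRing.algebra SemilocalRing.finite

open Algebra in
theorem nonempty_semilocalRing {X' X : Scheme.{0}} [IsIntegral X'] [IsIntegral X] (ν : X' ⟶ X)
    {U : X.Opens} (hU : Dense (U : Set X)) [IsIso (ν ∣_ U)]
    (s : X ⟶ Spec (CommRingCat.of ℂ)) [LocallyOfFiniteType s] [IsIntegralHom ν] (x : X) :
    Nonempty (SemilocalRing ν x) := by
  obtain ⟨_, ⟨V, hV, rfl⟩, hxV, -⟩ := X.isBasis_affineOpens.exists_subset_of_mem_open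
    (Set.mem_univ x) isOpen_univ
  have hV : IsAffineOpen V := hV
  have hxV : x ∈ V := hxV
  have : Nonempty V := ⟨⟨x, hxV⟩⟩
  have hηV : genericPoint X ∈ V := ((genericPoint_spec X).mem_open_set_iff V.2).mpr (by
    rw [Set.univ_inter]; exact ⟨x, hxV⟩)
  have : Nonempty (ν ⁻¹ᵁ V) := ⟨⟨genericPoint X', by
    change ν (genericPoint X') ∈ V
    rwa [apply_genericPoint_of_isIso ν hU]⟩⟩
  have hV' : IsAffineOpen (ν ⁻¹ᵁ V) := hV.preimage ν
  let B := Γ(X, V)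
  let B' := Γ(X', ν ⁻¹ᵁ V)
  let R := X.presheaf.stalk x
  let K := X'.functionField
  let p := (hV.primeIdealOf ⟨x, hxV⟩).asIdeal
  let : Algebra B B' := (ν.app V).hom.toAlgebra
  have hfin : Module.Finite B B' := finite_app_of_isIntegralHom ν hU s V hV
  let : Algebra B R := (X.presheaf.germ V x hxV).hom.toAlgebra
  have hloc : IsLocalization.AtPrime R p := hV.isLocalization_stalk ⟨x, hxV⟩
  let : Algebra B K := ((X'.germToFunctionField (ν ⁻¹ᵁ V)).hom.comp (ν.app V).hom).toAlgebra
  have hBK : IsFractionRing B K := isFractionRing_functionField ν hU V hV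
  have hB'K : IsFractionRing B' K := functionField_isFractionRing_of_isAffineOpen X' (ν ⁻¹ᵁ V) hV'
  have : IsScalarTower B B' K := IsScalarTower.of_algebraMap_eq fun _ => rfl
  let M := algebraMapSubmonoid B' p.primeCompl
  let R' := Localization M
  let : Algebra R R' := localizationAlgebra p.primeCompl B'
  have htow : IsScalarTower B R R' := IsScalarTower.of_algebraMap_eq fun b => by
    rw [IsScalarTower.algebraMap_apply B B' R']
    exact (IsLocalization.map_eq (M := p.primeCompl) (T := M) (g := algebraMap B B')
      (Submonoid.le_comap_map _) b).symm
  have : Module.Finite R R' := Module.Finite.of_isLocalization B B' p.primeCompl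
  have hint : Algebra.IsIntegral R R' := inferInstance
  have hBB' : Function.Injective (algebraMap B B') := by
    have h := IsFractionRing.injective B K
    rw [IsScalarTower.algebraMap_eq B B' K] at h
    exact Function.Injective.of_comp h
  have hM : M ≤ nonZeroDivisors B' := by
    rintro _ ⟨b, hb, rfl⟩
    refine mem_nonZeroDivisors_of_ne_zero ((map_ne_zero_iff _ hBB').mpr fun h => hb ?_)
    rw [h]
    exact zero_mem p
  have hMK (y : M) : IsUnit (algebraMap B' K y) :=
    IsLocalization.map_units K (⟨y.1, hM y.2⟩ : nonZeroDivisors B')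
  let toK : R' →+* K := IsLocalization.lift hMK
  let : Algebra R' K := toK.toAlgebra
  have : IsScalarTower B' R' K := IsScalarTower.of_algebraMap_eq fun b =>
    (IsLocalization.lift_eq hMK b).symm
  have hR'K : IsFractionRing R' K :=
    IsFractionRing.isFractionRing_of_isDomain_of_isLocalization M R' K
  let : Algebra R K := (toK.comp (algebraMap R R')).toAlgebra
  have : IsScalarTower R R' K := IsScalarTower.of_algebraMap_eq fun _ => rfl
  have : IsScalarTower B R K := IsScalarTower.of_algebraMap_eq fun b => by
    rw [IsScalarTower.algebraMap_apply R R' K, ← IsScalarTower.algebraMap_apply B R R',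
      IsScalarTower.algebraMap_apply B B' R', ← IsScalarTower.algebraMap_apply B' R' K]
    rfl
  have hRK : IsFractionRing R K :=
    IsFractionRing.isFractionRing_of_isDomain_of_isLocalization p.primeCompl R K
  have hmem (x' : X') (e : ν x' = x) : x' ∈ ν ⁻¹ᵁ V := by
    change ν x' ∈ V
    rw [e]
    exact hxV
  have hunit (x' : X') (e : ν x' = x) (y : M) :
      IsUnit ((X'.presheaf.germ (ν ⁻¹ᵁ V) x' (hmem x' e)).hom y) := by
    obtain ⟨_, b, hb, rfl⟩ := y
    have := (IsLocalization.map_units R (⟨b, hb⟩ : p.primeCompl)).map (stalkMapTo ν x' x e)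
    exact (stalkMapTo_germ ν x' x e V hxV b) ▸ this
  let toStalk (x' : X') (e : ν x' = x) : R' →+* X'.presheaf.stalk x' :=
    IsLocalization.lift (hunit x' e)
  have htoStalk (x' : X') (e : ν x' = x) (b : B') : toStalk x' e (algebraMap B' R' b) =
      X'.presheaf.germ (ν ⁻¹ᵁ V) x' (hmem x' e) b := IsLocalization.lift_eq (hunit x' e) b
  -- the contraction to `B'` of the maximal ideal belonging to a point over `x`
  have hcomap (x' : X') (e : ν x' = x) :
      ((maximalIdeal _).comap (toStalk x' e)).comap (algebraMap B' R') =
        (hV'.primeIdealOf ⟨x', hmem x' e⟩).asIdeal := by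
    rw [hV'.primeIdealOf_eq_map_closedPoint, Ideal.comap_comap]
    exact congrArg (fun g => Ideal.comap g (maximalIdeal (X'.presheaf.stalk x')))
      (RingHom.ext (htoStalk x' e))
  have hinj := (IsLocalization.orderEmbedding M R').injective
  refine ⟨{
    ring := R'
    toFunctionField := toK
    toFunctionField_injective := IsFractionRing.injective R' K
    isFractionRing := hRK
    toStalk := toStalk
    toStalk_comp := fun x' e => IsLocalization.ringHom_ext p.primeCompl (RingHom.ext fun b => ?_)
    isLocalization := fun x' e => ?_
    exists_eq_comap := fun n hn => ?_
    eq_of_comap_eq := fun x' x'' e e' h => ?_ }⟩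
  · change toStalk x' e (algebraMap R R' (algebraMap B R b)) = _
    rw [← IsScalarTower.algebraMap_apply B R R', IsScalarTower.algebraMap_apply B B' R', htoStalk x' e]
    exact (stalkMapTo_germ ν x' x e V hxV b).symm
  · let : Algebra R' (X'.presheaf.stalk x') := (toStalk x' e).toAlgebra
    let : Algebra B' (X'.presheaf.stalk x') :=
      (X'.presheaf.germ (ν ⁻¹ᵁ V) x' (hmem x' e)).hom.toAlgebra
    have : IsScalarTower B' R' (X'.presheaf.stalk x') := IsScalarTower.of_algebraMap_eq fun b =>
      (htoStalk x' e b).symm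
    have : IsLocalization.AtPrime (X'.presheaf.stalk x')
      (hV'.primeIdealOf ⟨x', hmem x' e⟩).asIdeal :=
        hV'.isLocalization_stalk ⟨x', hmem x' e⟩
    exact isLocalization_atPrime_comap_maximalIdeal M
      (hV'.primeIdealOf ⟨x', hmem x' e⟩).asIdeal
  · let P : PrimeSpectrum B' := ⟨n.comap (algebraMap B' R'), inferInstance⟩
    let x' : X' := hV'.fromSpec P
    have hx' : x' ∈ ν ⁻¹ᵁ V := by
      have : x' ∈ Set.range hV'.fromSpec := ⟨P, rfl⟩
      rwa [hV'.range_fromSpec] at this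
    have hP : hV'.primeIdealOf ⟨x', hx'⟩ = P := hV'.fromSpec.isOpenEmbedding.injective
      (hV'.fromSpec_primeIdealOf ⟨x', hx'⟩)
    have hn' : n.comap (algebraMap R R') = maximalIdeal R :=
      eq_maximalIdeal (Ideal.isMaximal_comap_of_isIntegral_of_isMaximal n)
    have e : ν x' = x := by
      have h1 := IsAffineOpen.comap_primeIdealOf_appLE (f := ν) V hV _ hV' le_rfl hx'
      rw [hP] at h1
      have h2 : PrimeSpectrum.comap (ν.appLE V (ν ⁻¹ᵁ V) le_rfl).hom P =
          hV.primeIdealOf ⟨x, hxV⟩ := by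
        ext1
        rw [hV.primeIdealOf_eq_map_closedPoint, ← Scheme.Hom.app_eq_appLE]
        change (n.comap (algebraMap B' R')).comap (algebraMap B B') =
          (maximalIdeal R).comap (algebraMap B R)
        rw [← hn', Ideal.comap_comap, Ideal.comap_comap, ← IsScalarTower.algebraMap_eq,
          ← IsScalarTower.algebraMap_eq]
      have h3 := congrArg hV.fromSpec (h1.symm.trans h2)
      rwa [hV.fromSpec_primeIdealOf, hV.fromSpec_primeIdealOf] at h3
    refine ⟨x', e, hinj ?_⟩
    change n.comap (algebraMap B' R') = ((maximalIdeal _).comap (toStalk x' e)).comap _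
    rw [hcomap x' e, hP]
  · have h1 := congrArg (Ideal.comap (algebraMap B' R')) h
    rw [hcomap x' e, hcomap x'' e'] at h1
    have h3 := congrArg hV'.fromSpec (PrimeSpectrum.ext h1)
    rwa [hV'.fromSpec_primeIdealOf, hV'.fromSpec_primeIdealOf] at h3

/-! ### Finite extensions inside the fraction field -/

/-- If a Noetherian domain `R` is integrally closed away from `t`, then a power of `t` conducts any
finite extension of `R` inside its fraction field into `R`. -/
theorem exists_pow_smul_mem_range {R R' K : Type*} [CommRing R] [IsDomain R] [CommRing R']
    [Algebra R R'] [Module.Finite R R'] [Field K] [Algebra R' K] [Algebra R K]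
    [IsScalarTower R R' K] [IsFractionRing R K] (hK : Function.Injective (algebraMap R' K)) (t : R)
    (h : ∀ (q : Ideal R) [q.IsPrime], t ∉ q → IsIntegrallyClosed (Localization.AtPrime q)) :
    ∃ n : ℕ, ∀ z : R', t ^ n • z ∈ (algebraMap R R').range := by
  let Q := R' ⧸ LinearMap.range (Algebra.linearMap R R')
  have ht : t ∈ (Module.annihilator R Q).radical := by
    rw [Ideal.radical_eq_sInf, Ideal.mem_sInf]
    rintro q ⟨hle, hq⟩
    -- off `t` the ring `R` is integrally closed, so `R' ⧸ R` has no support there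
    by_contra htq
    have hsupp : (⟨q, hq⟩ : PrimeSpectrum R) ∈ Module.support R Q :=
      Module.mem_support_iff_of_finite.mpr hle
    obtain ⟨z, hz⟩ := Module.mem_support_iff'.mp hsupp
    obtain ⟨z, rfl⟩ := Submodule.mkQ_surjective _ z
    have hqK (s : q.primeCompl) : IsUnit (algebraMap R K s) :=
      ((map_ne_zero_iff _ (IsFractionRing.injective R K)).mpr
        (fun h0 => s.2 (by rw [h0]; exact zero_mem q))).isUnit
    let : Algebra (Localization.AtPrime q) K := (IsLocalization.lift hqK).toAlgebra
    have : IsScalarTower R (Localization.AtPrime q) K := IsScalarTower.of_algebraMap_eq fun r =>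
      (IsLocalization.lift_eq hqK r).symm
    have : IsFractionRing (Localization.AtPrime q) K :=
      IsFractionRing.isFractionRing_of_isDomain_of_isLocalization q.primeCompl _ K
    have hint : IsIntegral (Localization.AtPrime q) (algebraMap R' K z) :=
      IsIntegral.tower_top (R := R)
        ((Algebra.IsIntegral.isIntegral (R := R) z).map (IsScalarTower.toAlgHom R R' K))
    obtain ⟨y, hy⟩ := (isIntegrallyClosed_iff K).mp (h q htq) hint
    obtain ⟨⟨a, s⟩, has⟩ := IsLocalization.surj q.primeCompl y
    refine hz s s.2 ?_
    rw [← map_smul]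
    refine (Submodule.Quotient.mk_eq_zero _).mpr ⟨a, hK ?_⟩
    change algebraMap R' K (algebraMap R R' a) = _
    rw [← IsScalarTower.algebraMap_apply, Algebra.smul_def, map_mul,
      ← IsScalarTower.algebraMap_apply, ← hy, mul_comm,
      IsScalarTower.algebraMap_apply R (Localization.AtPrime q) K (s : R), ← map_mul]
    exact (congrArg (algebraMap _ K) has).symm ▸ IsScalarTower.algebraMap_apply R _ K a
  obtain ⟨n, hn⟩ := ht
  refine ⟨n, fun z => ?_⟩
  have := Module.mem_annihilator.mp hn (Submodule.Quotient.mk z)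
  rw [← Submodule.Quotient.mk_smul, Submodule.Quotient.mk_eq_zero] at this
  exact this

/-- Localizing an integral extension at a prime does not raise the dimension above that of the
base. -/
theorem ringKrullDim_le_of_isIntegral_of_isLocalization {R R' S : Type*} [CommRing R] [CommRing R']
    [CommRing S] [Algebra R R'] [Algebra.IsIntegral R R'] [Algebra R' S] (M : Submonoid R')
    [IsLocalization M S] : ringKrullDim S ≤ ringKrullDim R := by
  refine Order.krullDim_le_of_strictMono
    (fun p => PrimeSpectrum.comap (algebraMap R R') (PrimeSpectrum.comap (algebraMap R' S) p)) ?_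
  intro p q hpq
  exact Ideal.IsIntegral.comap_lt_comap ((IsLocalization.orderEmbedding M S).lt_iff_lt.mpr hpq)

/-- The residue field of the local ring at a maximal ideal is a quotient of the original ring. -/
theorem residue_comp_algebraMap_surjective {R' S : Type*} [CommRing R'] [CommRing S] [IsLocalRing S]
    [Algebra R' S] (m : Ideal R') [hm : m.IsMaximal] [IsLocalization.AtPrime S m] :
    Function.Surjective ((residue S).comp (algebraMap R' S)) := by
  intro x
  obtain ⟨y, hy⟩ := (IsLocalization.AtPrime.equivQuotMaximalIdeal m S).surjective x
  obtain ⟨z, rfl⟩ := Ideal.Quotient.mk_surjective y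
  exact ⟨z, hy⟩

/-- A local domain with a nonmaximal prime containing a nonzero element has dimension at least
two. -/
theorem two_le_ringKrullDim {R : Type*} [CommRing R] [IsLocalRing R] [IsDomain R] (q : Ideal R)
    [hq : q.IsPrime] (hqm : q ≠ maximalIdeal R) (t : R) (ht : t ∈ q) (ht0 : t ≠ 0) :
    2 ≤ ringKrullDim R := by
  let p₀ : PrimeSpectrum R := ⟨⊥, Ideal.isPrime_bot⟩
  let p₁ : PrimeSpectrum R := ⟨q, hq⟩
  have h01 : p₀ < p₁ := (PrimeSpectrum.asIdeal_lt_asIdeal _ _).mp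
    (bot_lt_iff_ne_bot.mpr fun h => ht0 (by
      have h : q = ⊥ := h
      rwa [h] at ht))
  have h12 : p₁ < closedPoint R := (PrimeSpectrum.asIdeal_lt_asIdeal _ _).mp
    ((le_maximalIdeal hq.ne_top).lt_of_ne hqm)
  exact Order.le_krullDim_iff.mpr ⟨(⟨2, ![p₀, p₁, closedPoint R], fun i => by
    fin_cases i
    · exact h01
    · exact h12⟩ : LTSeries (PrimeSpectrum R)), rfl⟩

/-! ### The local properties of the morphism between central fibres -/

/-- The contraction of primes of completed local rings along `h : C' ⟶ C`, where `h y' = y`. -/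
noncomputable def branchMapTo {C' C : Scheme.{0}} (h : C' ⟶ C) (y' : C') (y : C) (e : h y' = y)
    (b : PrimeSpectrum (CompletedStalk C' y')) : PrimeSpectrum (CompletedStalk C y) :=
  PrimeSpectrum.comap (completionMap (stalkMapTo h y' y e)) b

theorem branchMapTo_rfl {C' C : Scheme.{0}} (h : C' ⟶ C) (y' : C')
    (b : PrimeSpectrum (CompletedStalk C' y')) :
    branchMapTo h y' (h y') rfl b = branchMap h y' b := by
  have key (φ ψ : C.presheaf.stalk (h y') →+* C'.presheaf.stalk y') [IsLocalHom φ] [IsLocalHom ψ]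
      (hφψ : φ = ψ) : completionMap φ = completionMap ψ := by
    subst hφψ
    rfl
  exact congrArg (fun φ => PrimeSpectrum.comap φ b) (key _ _ (stalkMapTo_rfl h y'))

/-- The local properties at a point `y` of a morphism `h : C' ⟶ C` of curves on which the
comparison of the two intersection graphs rests. -/
structure IsBranchConnectedAt {C' C : Scheme.{0}} (h : C' ⟶ C) (y : C) : Prop where
  finite : {y' | h y' = y}.Finite
  isNoetherianRing : IsNoetherianRing (C.presheaf.stalk y)
  krullDimLE : Ring.KrullDimLE 1 (C.presheaf.stalk y)
  isNoetherianRing_above (y' : C') (e : h y' = y) : IsNoetherianRing (C'.presheaf.stalk y')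
  krullDimLE_above (y' : C') (e : h y' = y) : Ring.KrullDimLE 1 (C'.presheaf.stalk y')
  isIntegral (y' : C') (e : h y' = y) : (completionMap (stalkMapTo h y' y e)).IsIntegral
  /-- every branch at `y` lies under a branch of `C'` -/
  exists_branchMapTo_eq (b : PrimeSpectrum (CompletedStalk C y)) (hb : b ∈ branches C y) :
    ∃ (y' : C') (e : h y' = y), ∃ b' ∈ branches C' y', branchMapTo h y' y e b' = b
  /-- the points over `y` connect the branches at `y` -/
  exists_separated (I : Set (PrimeSpectrum (CompletedStalk C y)))
    (b₁ b₂ : PrimeSpectrum (CompletedStalk C y)) (hb₁ : b₁ ∈ branches C y) (hb₂ : b₂ ∈ branches C y)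
    (h₁ : b₁ ∈ I) (h₂ : b₂ ∉ I) :
    ∃ (y' : C') (e : h y' = y), (∃ b' ∈ branches C' y', branchMapTo h y' y e b' ∈ I) ∧
      ∃ b' ∈ branches C' y', branchMapTo h y' y e b' ∉ I
  /-- generic points of `C'` lie over generic points of `C` -/
  krullDimLE_zero (y' : C') (e : h y' = y) (hy' : Ring.KrullDimLE 0 (C'.presheaf.stalk y')) :
    Ring.KrullDimLE 0 (C.presheaf.stalk y)
  /-- the degree over a component is at most its multiplicity -/
  residueDegree_pos (hy : Ring.KrullDimLE 0 (C.presheaf.stalk y)) (y' : C') (e : h y' = y) :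
    0 < h.residueDegree y'
  sum_residueDegree_le (hy : Ring.KrullDimLE 0 (C.presheaf.stalk y)) :
    ∑ᶠ y' ∈ {y' | h y' = y}, h.residueDegree y' ≤ multiplicity C y

/-- The residue degree at `y'`, computed over the residue field at a point that is only
propositionally equal to `h y'`. -/
theorem residueDegree_eq {C' C : Scheme.{0}} (h : C' ⟶ C) (y' : C') (y : C) (e : h y' = y) :
    letI := (ResidueField.map (stalkMapTo h y' y e)).toAlgebra
    h.residueDegree y' = Module.finrank (ResidueField (C.presheaf.stalk y))
      (ResidueField (C'.presheaf.stalk y')) := by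
  subst e
  have key (φ ψ : C.presheaf.stalk (h y') →+* C'.presheaf.stalk y') [IsLocalHom φ] [IsLocalHom ψ]
      (hφψ : φ = ψ) : ResidueField.map φ = ResidueField.map ψ := by
    subst hφψ
    rfl
  rw [key _ _ (stalkMapTo_rfl h y')]
  rfl

theorem fiberMap_fiberι {X' X T : Scheme.{0}} (ν : X' ⟶ X) (f : X ⟶ T) (t₀ : T) :
    fiberMap ν f t₀ ≫ f.fiberι t₀ = (ν ≫ f).fiberι t₀ ≫ ν :=
  Limits.pullback.lift_fst _ _ _

section
variable {T X X' : Scheme.{0}} (ν : X' ⟶ X) (f : X ⟶ T) (t₀ : T)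

theorem apply_fiberι_of_fiberMap {y' : (ν ≫ f).fiber t₀} {y : f.fiber t₀}
    (e : fiberMap ν f t₀ y' = y) : ν ((ν ≫ f).fiberι t₀ y') = f.fiberι t₀ y := by
  rw [← e]
  exact (congrArg (fun m : (ν ≫ f).fiber t₀ ⟶ X => m y') (fiberMap_fiberι ν f t₀)).symm

/-- The points of the fibre above `y` are the points of `X'` above the corresponding point. -/
theorem exists_fiberι_eq {y : f.fiber t₀} {x' : X'} (e : ν x' = f.fiberι t₀ y) :
    ∃ y', fiberMap ν f t₀ y' = y ∧ (ν ≫ f).fiberι t₀ y' = x' := by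
  have : x' ∈ Set.range ((ν ≫ f).fiberι t₀) := by
    rw [Scheme.Hom.range_fiberι]
    exact (congrArg f e).trans (apply_fiberι f t₀ y)
  obtain ⟨y', rfl⟩ := this
  refine ⟨y', fiberι_injective f t₀ ?_, rfl⟩
  rw [← e]
  exact (apply_fiberι_of_fiberMap ν f t₀ rfl).symm

variable [IsIntegral X'] [IsIntegral X] [IsLocallyNoetherian X] [Flat f] [IsIntegralHom ν]
  {U : X.Opens} (hU : Dense (U : Set X)) [IsIso (ν ∣_ U)]
  (s : X ⟶ Spec (CommRingCat.of ℂ)) [LocallyOfFiniteType s]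
  [IsDomain (T.presheaf.stalk t₀)] [IsDiscreteValuationRing (T.presheaf.stalk t₀)]

include hU s in
/-- The local analysis of a partial normalization of an S2 surface along a fibre. It compares the
local ring `R` of the surface with the semilocal ring `R'` over it, where `t` is a parameter on the
base: a power of `t` conducts `R'` into `R`, and `R` has depth two at nongeneric points of the
fibre. -/
theorem isBranchConnectedAt_fiberMap (hdim : topologicalKrullDim X ≤ 2) (hS2 : IsS2 X)
    (hnormal : ∀ x : X, f x ≠ t₀ → IsIntegrallyClosed (X.presheaf.stalk x)) (y : f.fiber t₀) :
    IsBranchConnectedAt (fiberMap ν f t₀) y := by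
  let x : X := f.fiberι t₀ y
  have hfx : f x = t₀ := apply_fiberι f t₀ y
  let R := X.presheaf.stalk x
  have : IsNoetherianRing R := inferInstanceAs (IsNoetherianRing (X.presheaf.stalk x))
  obtain ⟨ϖ, hϖ⟩ := IsDiscreteValuationRing.exists_irreducible (T.presheaf.stalk t₀)
  have hϖ' := hϖ.maximalIdeal_eq
  have hϖm : ϖ ∈ maximalIdeal (T.presheaf.stalk t₀) := hϖ' ▸ Ideal.mem_span_singleton_self ϖ
  let t : R := stalkMapTo f x t₀ hfx ϖ
  have htreg : IsSMulRegular R t := isSMulRegular_stalkMapTo f x t₀ hfx ϖ hϖ.ne_zero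
  have ht0 : t ≠ 0 := fun h => one_ne_zero (htreg (by simp [h]) : (1 : R) = 0)
  have htm : t ∈ maximalIdeal R :=
    map_maximalIdeal_le (stalkMapTo f x t₀ hfx) (Ideal.mem_map_of_mem _ hϖm)
  -- the semilocal ring over `x`
  obtain ⟨M⟩ := nonempty_semilocalRing ν hU s x
  let R' := M.ring
  let K := X'.functionField
  let : Algebra R' K := M.toFunctionField.toAlgebra
  let : Algebra R K := (M.toFunctionField.comp (algebraMap R R')).toAlgebra
  have : IsFractionRing R K := M.isFractionRing
  have : IsScalarTower R R' K := IsScalarTower.of_algebraMap_eq fun _ => rfl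
  have : IsDomain R' := M.toFunctionField_injective.isDomain M.toFunctionField
  have hR' : Function.Injective (algebraMap R R') :=
    Function.Injective.of_comp (f := algebraMap R' K) (IsFractionRing.injective R K)
  have : FaithfulSMul R R' := (faithfulSMul_iff_algebraMap_injective R R').mpr hR'
  obtain ⟨n, hn⟩ := exists_pow_smul_mem_range (K := K) (R' := R') M.toFunctionField_injective t (by
    intro q hq htq
    have hspec := fromSpecStalk_specializes x ⟨q, hq⟩
    let : Algebra R (X.presheaf.stalk (X.fromSpecStalk x ⟨q, hq⟩)) :=
      (X.presheaf.stalkSpecializes hspec).hom.toAlgebra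
    have hp := primeOfSpecializes_fromSpecStalk x ⟨q, hq⟩
    have hloc := isLocalization_stalkSpecializes hspec
    have hne : f (X.fromSpecStalk x ⟨q, hq⟩) ≠ t₀ := fun h => htq (by
      have := stalkMapTo_mem_of_apply_eq f hspec t₀ hfx h ϖ hϖm
      rwa [hp] at this)
    have hloc' : IsLocalization q.primeCompl (X.presheaf.stalk (X.fromSpecStalk x ⟨q, hq⟩)) := by
      have hq' : (primeOfSpecializes hspec).asIdeal.primeCompl = q.primeCompl := by
        rw [hp]
      rw [← hq']
      exact hloc
    have := hnormal _ hne
    exact IsIntegrallyClosed.of_equiv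
      (IsLocalization.algEquiv q.primeCompl (X.presheaf.stalk (X.fromSpecStalk x ⟨q, hq⟩))
        (Localization.AtPrime q)).toRingEquiv)
  -- the points over `y` and their local rings
  let ι := {y' // fiberMap ν f t₀ y' = y}
  have hν (i : ι) : ν ((ν ≫ f).fiberι t₀ i.1) = x := apply_fiberι_of_fiberMap ν f t₀ i.2
  let S (i : ι) : Type := X'.presheaf.stalk ((ν ≫ f).fiberι t₀ i.1)
  let (i : ι) : Algebra R (S i) := (stalkMapTo ν _ x (hν i)).toAlgebra
  let (i : ι) : Algebra R' (S i) := (M.toStalk _ (hν i)).toAlgebra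
  have htow (i : ι) : IsScalarTower R R' (S i) :=
    IsScalarTower.of_algebraMap_eq' (M.toStalk_comp _ (hν i)).symm
  have hloc (i : ι) : IsLocalHom (algebraMap R (S i)) := isLocalHom_stalkMapTo ν _ x (hν i)
  let m (i : ι) : Ideal R' := (maximalIdeal (S i)).comap (algebraMap R' (S i))
  have hmR (i : ι) : (m i).comap (algebraMap R R') = maximalIdeal R := by
    rw [Ideal.comap_comap, ← IsScalarTower.algebraMap_eq]
    exact ((local_hom_TFAE (algebraMap R (S i))).out 0 4).mp (hloc i)
  have hmm (i : ι) : (m i).IsMaximal := Ideal.isMaximal_of_isIntegral_of_isMaximal_comap (R := R) _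
    (by rw [hmR]; infer_instance)
  have hSloc (i : ι) : IsLocalization.AtPrime (S i) (m i) := M.isLocalization _ (hν i)
  have hmax (n : Ideal R') (hn : n.IsMaximal) : ∃ i, n = m i := by
    obtain ⟨x', e, h⟩ := M.exists_eq_comap n hn
    obtain ⟨y', e', rfl⟩ := exists_fiberι_eq ν f t₀ e
    exact ⟨⟨y', e'⟩, h⟩
  have hinj : Function.Injective m := fun i j hij =>
    Subtype.ext (fiberι_injective (ν ≫ f) t₀ (M.eq_of_comap_eq _ _ (hν i) (hν j) hij))
  have hι : Finite ι := by
    have := (Algebra.QuasiFinite.finite_primesOver (S := R') (maximalIdeal R)).to_subtype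
    exact Finite.of_injective (β := (maximalIdeal R).primesOver R')
      (fun i => ⟨m i, (hmm i).isPrime, ⟨(hmR i).symm⟩⟩) fun i j hij => hinj (congrArg Subtype.val hij)
  have : IsNoetherianRing R' := IsNoetherianRing.of_finite R R'
  have hSnoeth (i : ι) : IsNoetherianRing (S i) :=
    IsLocalization.isNoetherianRing (m i).primeCompl _ inferInstance
  -- the local rings of the fibres
  let R₀ := (f.fiber t₀).presheaf.stalk y
  let S₀ (i : ι) : Type := ((ν ≫ f).fiber t₀).presheaf.stalk i.1
  let π : R →+* R₀ := stalkMapTo (f.fiberι t₀) y x rfl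
  let π' (i : ι) : S i →+* S₀ i := stalkMapTo ((ν ≫ f).fiberι t₀) i.1 _ rfl
  let φ₀ (i : ι) : R₀ →+* S₀ i := stalkMapTo (fiberMap ν f t₀) i.1 y i.2
  have hπ : Function.Surjective π := stalkMapTo_fiberι_surjective f t₀ y x rfl
  have hπ' (i : ι) : Function.Surjective (π' i) :=
    stalkMapTo_fiberι_surjective (ν ≫ f) t₀ i.1 _ rfl
  have hkπ : RingHom.ker π = Ideal.span {t} := ker_stalkMapTo_fiberι f t₀ y x rfl hfx ϖ hϖ'
  have hkπ' (i : ι) : RingHom.ker (π' i) = Ideal.span {algebraMap R (S i) t} := by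
    refine (ker_stalkMapTo_fiberι (ν ≫ f) t₀ i.1 _ rfl ((congrArg f (hν i)).trans hfx) ϖ hϖ').trans ?_
    exact congrArg (fun g => Ideal.span {g ϖ}) (stalkMapTo_comp ν f _ x t₀ (hν i) hfx _)
  have hcomm (i : ι) : (φ₀ i).comp π = (π' i).comp (algebraMap R (S i)) := by
    have h1 := stalkMapTo_comp (fiberMap ν f t₀) (f.fiberι t₀) i.1 y x i.2 rfl
      (congrArg (f.fiberι t₀) i.2)
    have h2 := stalkMapTo_comp ((ν ≫ f).fiberι t₀) ν i.1 _ x rfl (hν i) (hν i)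
    exact h1.symm.trans ((stalkMapTo_congr (fiberMap_fiberι ν f t₀) _ _ _ _).trans h2)
  have hR₀ : IsNoetherianRing R₀ := isNoetherianRing_of_surjective R R₀ π hπ
  have hS₀ (i : ι) : IsNoetherianRing (S₀ i) := isNoetherianRing_of_surjective _ _ (π' i) (hπ' i)
  have hR2 : ringKrullDim R ≤ 2 := (ringKrullDim_stalk_le x).trans hdim
  have hR₀1 : Ring.KrullDimLE 1 R₀ := krullDimLE_one_of_ker_eq hR2 π hπ t ht0 hkπ
  have hSinj (i : ι) : Function.Injective (algebraMap R (S i)) := by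
    rw [IsScalarTower.algebraMap_eq R R' (S i)]
    exact (IsLocalization.injective (S i) (m i).primeCompl_le_nonZeroDivisors).comp hR'
  have hS₀1 (i : ι) : Ring.KrullDimLE 1 (S₀ i) := by
    refine krullDimLE_one_of_ker_eq (R := S i) ?_ (π' i) (hπ' i) _
      ((map_ne_zero_iff _ (hSinj i)).mpr ht0) (hkπ' i)
    exact (ringKrullDim_le_of_isIntegral_of_isLocalization (R := R) (m i).primeCompl).trans hR2
  -- if `y` is not generic, then the local ring at `x` has depth two
  have hdepth (h0 : ¬ Ring.KrullDimLE 0 R₀) : ∃ a b : R, a ∈ maximalIdeal R ∧ b ∈ maximalIdeal R ∧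
      RingTheory.Sequence.IsWeaklyRegular R [a, b] ∧ IsSMulRegular R' a := by
    rw [Ring.krullDimLE_zero_iff] at h0
    push Not at h0
    obtain ⟨q, hq, hqm⟩ := h0
    have h2 : 2 ≤ ringKrullDim R := by
      refine two_le_ringKrullDim (q.comap π) (fun h => hqm ?_) t ?_ ht0
      · rw [← Ideal.map_comap_of_surjective π hπ q, h, map_maximalIdeal_of_surjective π hπ]
        infer_instance
      · rw [Ideal.mem_comap, (RingHom.mem_ker (f := π)).mp (hkπ ▸ Ideal.mem_span_singleton_self t)]
        exact zero_mem q
    obtain ⟨rs, hlen, hmem, hreg⟩ := hS2 x 2 le_rfl h2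
    obtain ⟨a, b, rfl⟩ := List.length_eq_two.mp hlen
    refine ⟨a, b, hmem a (by simp), hmem b (by simp), hreg.toIsWeaklyRegular, ?_⟩
    have ha : IsSMulRegular R a := ((RingTheory.Sequence.isWeaklyRegular_cons_iff R a [b]).mp
      hreg.toIsWeaklyRegular).1
    have ha0 : a ≠ 0 := fun h => one_ne_zero (ha (by simp [h]) : (1 : R) = 0)
    exact fun z w hzw => smul_right_injective R' ha0 hzw
  have hzero (i : ι) (hi : Ring.KrullDimLE 0 (S₀ i)) : Ring.KrullDimLE 0 R₀ := by
    by_contra h0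
    obtain ⟨a, b, ha, hb, hab, haR'⟩ := hdepth h0
    exact h0 (krullDimLE_zero_of_depth S m S₀ π π' hmax hinj hR' t hπ hkπ hπ' hkπ' n hn a b
      ha hb hab haR' i hi)
  have hdeg (h0 : Ring.KrullDimLE 0 R₀) : (∀ i : ι, 0 < (fiberMap ν f t₀).residueDegree i.1) ∧
      ∑ᶠ i : ι, (fiberMap ν f t₀).residueDegree i.1 ≤ multiplicity (f.fiber t₀) y := by
    let κ := ResidueField R₀
    let k (i : ι) : Type := ResidueField (S₀ i)
    let : Algebra R R₀ := π.toAlgebra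
    let : Algebra R κ := ((residue R₀).comp π).toAlgebra
    let (i : ι) : Algebra κ (k i) := (ResidueField.map (φ₀ i)).toAlgebra
    let (i : ι) : Algebra R (k i) := ((ResidueField.map (φ₀ i)).comp ((residue R₀).comp π)).toAlgebra
    have (i : ι) : IsScalarTower R κ (k i) := IsScalarTower.of_algebraMap_eq fun _ => rfl
    let ρ (i : ι) : R' →ₐ[R] k i :=
      { toRingHom := (residue (S₀ i)).comp ((π' i).comp (algebraMap R' (S i)))
        commutes' := fun r => by
          change residue (S₀ i) (π' i (algebraMap R' (S i) (algebraMap R R' r))) = _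
          rw [← IsScalarTower.algebraMap_apply]
          exact congrArg (residue (S₀ i)) (congrArg (fun g : R →+* S₀ i => g r) (hcomm i)).symm }
    have hker (i : ι) : RingHom.ker (ρ i) = m i := by
      ext z
      change residue (S₀ i) (π' i (algebraMap R' (S i) z)) = 0 ↔ _
      rw [residue_eq_zero_iff, ← Ideal.mem_comap (f := π' i)]
      have hloc : IsLocalHom (π' i) := isLocalHom_stalkMapTo _ _ _ _
      have h : (maximalIdeal (S₀ i)).comap (π' i) = maximalIdeal (S i) :=
        ((local_hom_TFAE (π' i)).out 0 4).mp hloc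
      rw [h]
      rfl
    have hρ (i : ι) : Function.Surjective (ρ i) := by
      intro z
      obtain ⟨z, rfl⟩ := residue_surjective z
      obtain ⟨z, rfl⟩ := hπ' i z
      obtain ⟨w, hw⟩ := residue_comp_algebraMap_surjective (S := S i) (m i) (residue _ z)
      exact ⟨w, congrArg (ResidueField.map (π' i)) hw⟩
    have := Fintype.ofFinite ι
    have hart₀ : IsArtinianRing R₀ := isArtinianRing_iff_isNoetherianRing_krullDimLE_zero.mpr ⟨hR₀, h0⟩
    let e : (R ⧸ Ideal.span {t}) ≃+* R₀ :=
      (Ideal.quotEquivOfEq hkπ.symm).trans (RingHom.quotientKerEquivOfSurjective hπ)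
    have hart : IsArtinianRing (R ⧸ Ideal.span {t}) := e.symm.isArtinianRing
    have htR' : IsSMulRegular R' t := fun z w hzw => smul_right_injective R' ht0 hzw
    have hκ : Function.Surjective (algebraMap R κ) :=
      Function.Surjective.comp (g := residue R₀) residue_surjective hπ
    obtain ⟨hfin, hle⟩ := sum_finrank_le_length hκ k ρ hρ
      (by simp only [hker]; exact hinj) hR' t htm htR' n hn
    have hlen : Module.length R (R ⧸ Ideal.span {t}) = Module.length R₀ R₀ := by
      let el : (R ⧸ Ideal.span {t}) ≃ₗ[R] R₀ :=
        { e.toAddEquiv with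
          map_smul' := fun r z => by
            obtain ⟨z, rfl⟩ := Ideal.Quotient.mk_surjective z
            exact map_mul π r z }
      rw [el.length_eq]
      exact Module.length_eq_of_surjective hπ
    have hres (i : ι) : (fiberMap ν f t₀).residueDegree i.1 = Module.finrank κ (k i) :=
      residueDegree_eq (fiberMap ν f t₀) i.1 y i.2
    refine ⟨fun i => ?_, ?_⟩
    · rw [hres]
      have := hfin i
      exact Module.finrank_pos
    · rw [finsum_eq_sum_of_fintype]
      simp only [hres]
      rw [hlen] at hle
      have htop : Module.length R₀ R₀ ≠ ⊤ := Module.length_ne_top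
      rw [← ENat.natCast_toNat htop] at hle
      exact_mod_cast hle
  refine
    { finite := Set.finite_coe_iff.mp hι
      isNoetherianRing := hR₀
      krullDimLE := hR₀1
      isNoetherianRing_above := fun y' e => hS₀ ⟨y', e⟩
      krullDimLE_above := fun y' e => hS₀1 ⟨y', e⟩
      isIntegral := fun y' e => ?_
      exists_branchMapTo_eq := fun b hb => ?_
      exists_separated := fun I b₁ b₂ hb₁ hb₂ h₁ h₂ => ?_
      krullDimLE_zero := fun y' e => hzero ⟨y', e⟩
      residueDegree_pos := fun hy y' e => (hdeg hy).1 ⟨y', e⟩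
      sum_residueDegree_le := fun hy => ?_ }
  · exact isIntegral_completionMap_of_comm (algebraMap R (S ⟨y', e⟩)) π (π' ⟨y', e⟩) (φ₀ ⟨y', e⟩)
      (hcomm ⟨y', e⟩) (hπ' ⟨y', e⟩) (completionMap_isIntegral S m hmax hinj ⟨y', e⟩)
  · obtain ⟨i, q, hq, hqb⟩ := exists_branch_above S m S₀ π π' φ₀ hmax hinj hR' t hcomm hπ hkπ hπ' hkπ'
      b.asIdeal hb
    exact ⟨i.1, i.2, ⟨q, hq.1.1⟩, hq, PrimeSpectrum.ext hqb⟩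
  · have h0 : ¬ Ring.KrullDimLE 0 R₀ := fun h0 => h₂ (by
      rw [← krullDimLE_zero_adicCompletion_iff, Ring.krullDimLE_zero_iff] at h0
      have : b₂ = b₁ := PrimeSpectrum.ext ((eq_maximalIdeal (h0 _ b₂.2)).trans
        (eq_maximalIdeal (h0 _ b₁.2)).symm)
      rwa [this])
    obtain ⟨a, b, ha, hb, hab, haR'⟩ := hdepth h0
    obtain ⟨i, ⟨q₁, hq₁, hI₁⟩, q₂, hq₂, hI₂⟩ := exists_branches_separated S m S₀ π π' φ₀ hmax hinj hR' t
      hcomm hπ hkπ hπ' hkπ' n hn a b ha hb hab haR' (PrimeSpectrum.asIdeal '' I) b₁.asIdeal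
      b₂.asIdeal hb₁ hb₂ ⟨b₁, h₁, rfl⟩ (by
        rintro ⟨b, hb, hbb⟩
        exact h₂ (PrimeSpectrum.ext hbb ▸ hb))
    refine ⟨i.1, i.2, ⟨⟨q₁, hq₁.1.1⟩, hq₁, ?_⟩, ⟨⟨q₂, hq₂.1.1⟩, hq₂, fun h => hI₂ ⟨_, h, rfl⟩⟩⟩
    obtain ⟨b, hb, hbb⟩ := hI₁
    rw [← PrimeSpectrum.ext (y := branchMapTo (fiberMap ν f t₀) i.1 y i.2 ⟨q₁, hq₁.1.1⟩) hbb]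
    exact hb
  · have := (hdeg hy).2
    rwa [← finsum_set_coe_eq_finsum_mem]
end

/-! ### Generic points and finiteness of the set of multibranch points -/

/-- The generic points are the points without proper generizations. -/
theorem mem_greenVertices_iff_specializes {C : Scheme.{0}} {y : C} :
    y ∈ greenVertices C ↔ ∀ z : C, z ⤳ y → z = y := by
  constructor
  · intro h z hzy
    have hle := h.2 (y := closure {z}) isIrreducible_singleton.closure hzy.closure_subset
    exact (specializes_iff_closure_subset.mpr hle).antisymm hzy |>.eq.symm
  · intro h
    refine ⟨isIrreducible_singleton.closure, fun Z hZ hyZ => ?_⟩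
    obtain ⟨z, hz⟩ := QuasiSober.sober hZ.closure isClosed_closure
    have hzy : z ⤳ y := by
      rw [specializes_iff_mem_closure, hz.def]
      exact subset_closure (hyZ (subset_closure rfl))
    rw [← h z hzy, hz.def]
    exact subset_closure

theorem mem_greenVertices_iff {C : Scheme.{0}} {y : C} :
    y ∈ greenVertices C ↔ Ring.KrullDimLE 0 (C.presheaf.stalk y) := by
  rw [mem_greenVertices_iff_specializes, Ring.krullDimLE_zero_iff]
  have hy : C.fromSpecStalk y (closedPoint _) = y := Scheme.fromSpecStalk_closedPoint
  constructor
  · intro h q hq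
    have h1 := h _ (fromSpecStalk_specializes y ⟨q, hq⟩)
    have h2 : (⟨q, hq⟩ : PrimeSpectrum (C.presheaf.stalk y)) = closedPoint _ :=
      (C.fromSpecStalk y).isEmbedding.injective (h1.trans hy.symm)
    have h3 : q = maximalIdeal _ := congrArg PrimeSpectrum.asIdeal h2
    exact h3 ▸ inferInstance
  · intro h z hz
    have h2 : primeOfSpecializes hz = closedPoint _ :=
      PrimeSpectrum.ext (eq_maximalIdeal (h _ (primeOfSpecializes hz).2))
    rw [← fromSpecStalk_primeOfSpecializes hz, h2, hy]

/-- Minimal primes of the local ring at a point are generic points of components. -/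
theorem fromSpecStalk_mem_greenVertices {C : Scheme.{0}} (y : C)
    (q : PrimeSpectrum (C.presheaf.stalk y)) (hq : q.asIdeal ∈ minimalPrimes _) :
    C.fromSpecStalk y q ∈ greenVertices C := by
  rw [mem_greenVertices_iff_specializes]
  intro z hz
  have hzy := hz.trans (fromSpecStalk_specializes y q)
  have hz' := fromSpecStalk_primeOfSpecializes hzy
  rw [← hz'] at hz ⊢
  have hle : primeOfSpecializes hzy ≤ q :=
    (PrimeSpectrum.le_iff_specializes _ _).mpr
      ((C.fromSpecStalk y).isEmbedding.isInducing.specializes_iff.mp hz)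
  exact congrArg _ (le_antisymm hle (hq.2 ⟨(primeOfSpecializes hzy).2, bot_le⟩ hle))

theorem branches_nonempty {C : Scheme.{0}} (y : C) [IsNoetherianRing (C.presheaf.stalk y)] :
    (branches C y).Nonempty := by
  obtain ⟨q, hq, -⟩ :=
    Ideal.exists_minimalPrimes_le (J := maximalIdeal (CompletedStalk C y)) bot_le
  exact ⟨⟨q, hq.1.1⟩, hq⟩

theorem finite_branches {C : Scheme.{0}} (y : C) [IsNoetherianRing (C.presheaf.stalk y)] :
    (branches C y).Finite :=
  (minimalPrimes.finite_of_isNoetherianRing (CompletedStalk C y)).preimage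
    (fun _ _ _ _ h => PrimeSpectrum.ext h)

/-- An affine chart has dimension at most one if all its local rings have. -/
theorem krullDimLE_one_of_isLocalization {B : Type*} [CommRing B]
    (h : ∀ (p : Ideal B) [p.IsPrime], Ring.KrullDimLE 1 (Localization.AtPrime p)) :
    Ring.KrullDimLE 1 B := by
  rw [Ring.krullDimLE_one_iff]
  intro P hP
  by_contra! hcon
  obtain ⟨n, hn, hPn⟩ := Ideal.exists_le_maximal P hP.ne_top
  obtain ⟨q, hq, hqP⟩ := Ideal.exists_minimalPrimes_le (J := P) bot_le
  have := hq.1.1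
  let A := Localization.AtPrime n
  have hdisj {I : Ideal B} (hI : I ≤ n) : Disjoint (n.primeCompl : Set B) (I : Set B) :=
    Set.disjoint_left.mpr fun x hx hxI => hx (hI hxI)
  have hPA := IsLocalization.isPrime_of_isPrime_disjoint n.primeCompl A P hP (hdisj hPn)
  have hqA := IsLocalization.isPrime_of_isPrime_disjoint n.primeCompl A q ‹_› (hdisj (hqP.trans hPn))
  have hcP := IsLocalization.under_map_of_isPrime_disjoint n.primeCompl A hP (hdisj hPn)
  have hcq := IsLocalization.under_map_of_isPrime_disjoint n.primeCompl A ‹q.IsPrime›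
    (hdisj (hqP.trans hPn))
  rcases Ring.krullDimLE_one_iff.mp (h n) _ hPA with h1 | h1
  · have := h1.2 ⟨hqA, bot_le⟩ (Ideal.map_mono hqP)
    have h2 : P ≤ q := by
      rw [← hcP, ← hcq]
      exact Ideal.comap_mono this
    exact hcon.1 (le_antisymm h2 hqP ▸ hq)
  · have h2 := eq_maximalIdeal h1
    refine hcon.2 ?_
    rw [← hcP, h2]
    have : (maximalIdeal A).under B = n := IsLocalization.AtPrime.under_maximalIdeal A n
    rwa [this]

/-- A curve of finite type over a field of characteristic zero has finitely many points with more
than one branch. -/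
theorem finite_yellowVertices (k : CommRingCat.{0}) (hk : IsField k) [CharZero k] {C : Scheme.{0}}
    (g : C ⟶ Spec k) [LocallyOfFiniteType g] [CompactSpace C]
    (hdim : ∀ y : C, Ring.KrullDimLE 1 (C.presheaf.stalk y)) : (yellowVertices C).Finite := by
  let : Field k := hk.toField
  have hV (V : C.affineOpens) : (yellowVertices C ∩ (V.1 : Set C)).Finite := by
    obtain ⟨V, hV⟩ := V
    have hV : IsAffineOpen V := hV
    let B := Γ(C, V)
    have hft : (g.appLE ⊤ V le_top).hom.FiniteType :=
      LocallyOfFiniteType.finiteType_appLE g (isAffineOpen_top _) hV _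
    let φ : k →+* B := (g.appLE ⊤ V le_top).hom.comp (Scheme.ΓSpecIso k).inv.hom
    have hφ : φ.FiniteType := hft.comp (RingHom.FiniteType.of_surjective _ <|
      (ConcreteCategory.bijective_of_isIso (Scheme.ΓSpecIso k).inv).surjective)
    let : Algebra k B := φ.toAlgebra
    have : Algebra.FiniteType k B := hφ
    have hst (x : V) : letI : Algebra B (C.presheaf.stalk x.1) := (C.presheaf.germ V x.1 x.2).hom.toAlgebra
        IsLocalization.AtPrime (C.presheaf.stalk x.1) (hV.primeIdealOf x).asIdeal :=
      hV.isLocalization_stalk x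
    have : Ring.KrullDimLE 1 B := krullDimLE_one_of_isLocalization fun p hp => by
      let x : C := hV.fromSpec ⟨p, hp⟩
      have hx : x ∈ V := by
        have : x ∈ Set.range hV.fromSpec := ⟨_, rfl⟩
        rwa [hV.range_fromSpec] at this
      have hP : hV.primeIdealOf ⟨x, hx⟩ = ⟨p, hp⟩ := hV.fromSpec.isOpenEmbedding.injective
        (hV.fromSpec_primeIdealOf ⟨x, hx⟩)
      let : Algebra B (C.presheaf.stalk x) := (C.presheaf.germ V x hx).hom.toAlgebra
      have hp' : (hV.primeIdealOf ⟨x, hx⟩).asIdeal.primeCompl = p.primeCompl := by rw [hP]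
      have : IsLocalization p.primeCompl (C.presheaf.stalk x) := hp' ▸ hst ⟨x, hx⟩
      have h1 := hdim x
      rw [Ring.krullDimLE_iff] at h1 ⊢
      rwa [ringKrullDim_eq_of_ringEquiv (IsLocalization.algEquiv p.primeCompl
        (Localization.AtPrime p) (C.presheaf.stalk x)).toRingEquiv]
    obtain ⟨F, hF, hsub⟩ := exists_finite_subsingleton_minimalPrimes k B
    have hinj : Function.Injective fun x : V => (hV.primeIdealOf x).asIdeal := fun x x' h => by
      have h3 := congrArg hV.fromSpec (PrimeSpectrum.ext h)
      rw [hV.fromSpec_primeIdealOf, hV.fromSpec_primeIdealOf] at h3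
      exact Subtype.ext h3
    refine ((hF.preimage hinj.injOn).image Subtype.val).subset ?_
    rintro x ⟨hx, hxV⟩
    refine ⟨⟨x, hxV⟩, ?_, rfl⟩
    by_contra hxF
    let : Algebra B (C.presheaf.stalk x) := (C.presheaf.germ V x hxV).hom.toAlgebra
    have := hst ⟨x, hxV⟩
    obtain ⟨b, hb, b', hb', hne⟩ := hx
    exact hne (PrimeSpectrum.ext (hsub _ hxF (C.presheaf.stalk x) hb hb'))
  obtain ⟨S, hS⟩ := isCompact_univ.elim_finite_subcover (fun V : C.affineOpens => (V.1 : Set C))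
    (fun V => V.1.2) (fun x _ => by
      obtain ⟨_, ⟨V, hV, rfl⟩, hxV, -⟩ := C.isBasis_affineOpens.exists_subset_of_mem_open
        (Set.mem_univ x) isOpen_univ
      exact Set.mem_iUnion.mpr ⟨⟨V, hV⟩, hxV⟩)
  refine (Set.Finite.biUnion S.finite_toSet fun V _ => hV V).subset fun x hx => ?_
  obtain ⟨V, hVS, hxV⟩ := Set.mem_iUnion₂.mp (hS (Set.mem_univ x))
  exact Set.mem_iUnion₂.mpr ⟨V, hVS, hx, hxV⟩

theorem finite_greenVertices (k : CommRingCat.{0}) (hk : IsField k) {C : Scheme.{0}}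
    (g : C ⟶ Spec k) [LocallyOfFiniteType g] [CompactSpace C] : (greenVertices C).Finite := by
  let : Field k := hk.toField
  have : IsNoetherianRing k := inferInstance
  have : IsLocallyNoetherian C := LocallyOfFiniteType.isLocallyNoetherian g
  have : IsNoetherian C := {}
  exact genericPoints.finite finite_irreducibleComponents_of_isNoetherian

/-! ### Connected families of sets -/

/-- If the sets `H i` connect the set `V`, then `V` has at most `1 + ∑ (#H i - 1)` elements. -/
theorem ncard_le_of_connected {α ι : Type*} [Fintype ι] (V : Set α) (hV : V.Nonempty)
    (H : ι → Set α) (hH : ∀ i, (H i).Finite)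
    (hconn : ∀ (I : Set α) (a b : α), a ∈ V → b ∈ V → a ∈ I → b ∉ I →
      ∃ i, (H i ∩ I).Nonempty ∧ ∃ c ∈ H i, c ∉ I) :
    V.ncard ≤ 1 + ∑ i, ((H i).ncard - 1) := by
  classical
  obtain ⟨a, ha⟩ := hV
  -- a maximal subfamily with a union `W` containing `a` that satisfies the bound
  let good (A : Finset ι) : Prop := ∃ W : Set α, W.Finite ∧ a ∈ W ∧ (∀ i ∈ A, H i ⊆ W) ∧
    W.ncard ≤ 1 + ∑ i ∈ A, ((H i).ncard - 1)
  obtain ⟨A, hA⟩ := (Set.toFinite {A | good A}).exists_maximal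
    ⟨∅, {a}, Set.finite_singleton a, rfl, by simp, by simp⟩
  obtain ⟨W, hW, haW, hAW, hcard⟩ := hA.1
  have hVW : V ⊆ W := by
    intro b hb
    by_contra hbW
    obtain ⟨i, ⟨d, hdi, hdW⟩, c, hci, hcW⟩ := hconn W a b ha hb haW hbW
    have hiA : i ∉ A := fun hi => hcW (hAW i hi hci)
    have hle : insert i A ≤ A := by
      refine hA.2 ?_ (Finset.subset_insert i A)
      refine ⟨W ∪ H i, hW.union (hH i), Or.inl haW, fun j hj => ?_, ?_⟩
      · rcases Finset.mem_insert.mp hj with rfl | hj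
        · exact Set.subset_union_right
        · exact (hAW j hj).trans Set.subset_union_left
      · rw [Finset.sum_insert hiA]
        have h1 := Set.ncard_union_add_ncard_inter W (H i) hW (hH i)
        have h2 : 0 < (W ∩ H i).ncard :=
          (Set.ncard_pos (hW.inter_of_left _)).mpr ⟨d, hdW, hdi⟩
        omega
    exact hiA (hle (Finset.mem_insert_self i A))
  calc V.ncard ≤ W.ncard := Set.ncard_le_ncard hVW hW
    _ ≤ _ := hcard
    _ ≤ _ := Nat.add_le_add_left (Finset.sum_le_sum_of_subset (Finset.subset_univ A)) 1

/-! ### Comparison of the intersection graphs -/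

section
variable {C' C : Scheme.{0}} {h : C' ⟶ C}

theorem finite_branches_source (H : ∀ y, IsBranchConnectedAt h y) (y' : C') : (branches C' y').Finite :=
  have := (H _).isNoetherianRing_above y' rfl
  finite_branches y'

theorem branches_nonempty_source (H : ∀ y, IsBranchConnectedAt h y) (y' : C') :
    (branches C' y').Nonempty :=
  have := (H _).isNoetherianRing_above y' rfl
  branches_nonempty y'

theorem not_collapses_iff (H : ∀ y, IsBranchConnectedAt h y) (y' : C') :
    ¬ Collapses h y' ↔ (branchMap h y' '' branches C' y').Nontrivial := by
  rw [← Set.not_subsingleton_iff, not_iff_not]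
  constructor
  · rintro ⟨b, hb⟩ _ ⟨c, hc, rfl⟩ _ ⟨d, hd, rfl⟩
    rw [hb c hc, hb d hd]
  · intro hs
    obtain ⟨b, hb⟩ := branches_nonempty_source H y'
    exact ⟨branchMap h y' b, fun c hc => hs ⟨c, hc, rfl⟩ ⟨b, hb, rfl⟩⟩

theorem mem_yellowVertices_of_not_collapses {y' : C'} (hy' : ¬ Collapses h y')
    (H : ∀ y, IsBranchConnectedAt h y) : y' ∈ yellowVertices C' :=
  Set.nontrivial_of_image _ _ ((not_collapses_iff H y').mp hy')

/-- The branches at a point with several branches map to branches, and these lie on components of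
`C`. The first part uses that `C'` has dimension one at such a point. -/
theorem branchMap_mem_branches (H : ∀ y, IsBranchConnectedAt h y) {y' : C'}
    (hy' : y' ∈ yellowVertices C') {b : PrimeSpectrum (CompletedStalk C' y')}
    (hb : b ∈ branches C' y') : branchMap h y' b ∈ branches C (h y') ∧
      branchComponent C (h y') (branchMap h y' b) ∈ greenVertices C := by
  have := (H (h y')).isNoetherianRing
  have := (H (h y')).krullDimLE
  have := (H (h y')).isNoetherianRing_above y' rfl
  obtain ⟨c, hc, d, hd, hcd⟩ := hy'
  obtain ⟨h1, h2⟩ := comap_mem_minimalPrimes (stalkMapTo h y' (h y') rfl)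
    ((H (h y')).isIntegral y' rfl) ⟨c.asIdeal, hc, d.asIdeal, hd, fun h => hcd (PrimeSpectrum.ext h)⟩
    b.asIdeal hb
  rw [← branchMapTo_rfl]
  refine ⟨h1, fromSpecStalk_mem_greenVertices _ _ ?_⟩
  have := (branchMapTo h y' (h y') rfl b).2
  exact comap_algebraMap_mem_minimalPrimes _ h2

theorem image_branchMapTo_eq (y' : C') :
    branchMapTo h y' (h y') rfl '' branches C' y' = branchMap h y' '' branches C' y' :=
  Set.image_congr fun b _ => branchMapTo_rfl h y' b

theorem apply_mem_yellowVertices (H : ∀ y, IsBranchConnectedAt h y) {y' : C'}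
    (hy' : ¬ Collapses h y') : h y' ∈ yellowVertices C := by
  refine ((not_collapses_iff H y').mp hy').mono ?_
  rintro _ ⟨b, hb, rfl⟩
  exact (branchMap_mem_branches H (mem_yellowVertices_of_not_collapses hy' H) hb).1

theorem apply_mem_greenVertices (H : ∀ y, IsBranchConnectedAt h y) {g : C'}
    (hg : g ∈ greenVertices C') : h g ∈ greenVertices C :=
  mem_greenVertices_iff.mpr ((H (h g)).krullDimLE_zero g rfl (mem_greenVertices_iff.mp hg))

/-- All points above a generic point are generic. -/
theorem mem_greenVertices_of_apply (H : ∀ y, IsBranchConnectedAt h y) {y' : C'}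
    (hy' : h y' ∈ greenVertices C) : y' ∈ greenVertices C' := by
  have := (H (h y')).isNoetherianRing
  have := (H (h y')).isNoetherianRing_above y' rfl
  rw [mem_greenVertices_iff, ← krullDimLE_zero_adicCompletion_iff, Ring.krullDimLE_zero_iff] at *
  exact fun q hq => Ideal.isMaximal_of_isIntegral_of_isMaximal_comap' _
    ((H (h y')).isIntegral y' rfl) q (hy' _ inferInstance)

theorem mapsTo_graphMap (H : ∀ y, IsBranchConnectedAt h y) :
    Set.MapsTo (graphMap h) (cells C') (cells C) := by
  classical
  have hcol {y' : C'} (hy' : y' ∈ yellowVertices C') (hc : Collapses h y') :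
      branchComponent C (h y') hc.choose ∈ greenVertices C := by
    obtain ⟨b, hb⟩ := branches_nonempty_source H y'
    rw [← hc.choose_spec b hb]
    exact (branchMap_mem_branches H hy' hb).2
  rintro (g | y | ⟨y, b⟩) hx
  · exact apply_mem_greenVertices H hx
  · rw [graphMap]
    split_ifs with hc
    · exact hcol hx hc
    · exact apply_mem_yellowVertices H hc
  · rw [graphMap]
    split_ifs with hc
    · exact hcol hx.1 hc
    · exact ⟨apply_mem_yellowVertices H hc, (branchMap_mem_branches H hx.1 hx.2).1⟩

/-- Green vertices are hit because every branch is, and yellow vertices and edges because the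
branches at a point are connected by the points above. -/
theorem surjOn_graphMap (H : ∀ y, IsBranchConnectedAt h y) :
    Set.SurjOn (graphMap h) (cells C') (cells C) := by
  classical
  -- a branch and a second one at the same point lead to a point above that does not collapse
  have key (y : C) (b c : PrimeSpectrum (CompletedStalk C y)) (hb : b ∈ branches C y)
      (hc : c ∈ branches C y) (hbc : c ≠ b) : ∃ (y' : C') (e : h y' = y), ¬ Collapses h y' ∧
        ∃ b' ∈ branches C' y', branchMapTo h y' y e b' = b := by
    obtain ⟨y', e, ⟨b₁, hb₁, h₁⟩, b₂, hb₂, h₂⟩ := (H y).exists_separated {b} b c hb hc rfl hbc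
    refine ⟨y', e, ?_, b₁, hb₁, h₁⟩
    subst e
    rw [not_collapses_iff H, ← image_branchMapTo_eq]
    exact ⟨_, ⟨b₁, hb₁, rfl⟩, _, ⟨b₂, hb₂, rfl⟩, fun h => h₂ (h ▸ h₁)⟩
  rintro (g | y | ⟨y, b⟩) hx
  · have := (H g).isNoetherianRing
    obtain ⟨b, hb⟩ := branches_nonempty g
    obtain ⟨y', rfl, -⟩ := (H g).exists_branchMapTo_eq b hb
    exact ⟨.green y', mem_greenVertices_of_apply H hx, rfl⟩
  · obtain ⟨b, hb, c, hc, hbc⟩ := hx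
    obtain ⟨y', rfl, hn, -⟩ := key y b c hb hc hbc.symm
    exact ⟨.yellow y', mem_yellowVertices_of_not_collapses hn H, dif_neg hn⟩
  · obtain ⟨hy, hb⟩ := hx
    obtain ⟨c, hc, hcb⟩ := hy.exists_ne b
    obtain ⟨y', rfl, hn, b', hb', rfl⟩ := key y b c hb hc hcb
    refine ⟨.edge y' b', ⟨mem_yellowVertices_of_not_collapses hn H, hb'⟩, ?_⟩
    rw [branchMapTo_rfl]
    exact dif_neg hn

/-- The number of branches at `h y'` that are images of branches at `y'`, minus one. This is the
contribution of `y'` to the connections between the branches at `h y'`. -/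
noncomputable def excess (h : C' ⟶ C) (y' : C') : ℕ := (branchMap h y' '' branches C' y').ncard - 1

theorem excess_eq (y' : C') (y : C) (e : h y' = y) :
    excess h y' = (branchMapTo h y' y e '' branches C' y').ncard - 1 := by
  subst e
  rw [image_branchMapTo_eq]
  rfl

theorem excess_eq_zero_of_collapses (H : ∀ y, IsBranchConnectedAt h y) {y' : C'}
    (hy' : Collapses h y') : excess h y' = 0 := by
  have h1 : (branchMap h y' '' branches C' y').Subsingleton := by
    rw [← Set.not_nontrivial_iff, ← not_collapses_iff H]
    exact not_not.mpr hy'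
  have h2 : (branchMap h y' '' branches C' y').ncard ≤ 1 :=
    (Set.ncard_le_one ((finite_branches_source H y').image _)).mpr fun a ha b hb => h1 ha hb
  rw [excess]
  omega

theorem branchFailure_eq_of_not_collapses {y' : C'} (hy' : ¬ Collapses h y') :
    branchFailure h y' =
      (branches C' y').ncard - ((branchMap h y' '' branches C' y').ncard : ℤ) := by
  classical
  rw [branchFailure, if_neg hy', edgesAt, Set.image_image]
  have h1 : (Cell.edge y' '' branches C' y').ncard = (branches C' y').ncard :=
    Set.ncard_image_of_injective _ fun a b hab => by simpa using hab
  have h2 : (fun b => graphMap h (Cell.edge y' b)) '' branches C' y' =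
      Cell.edge (h y') '' (branchMap h y' '' branches C' y') := by
    rw [Set.image_image]
    exact Set.image_congr fun b _ => dif_neg hy'
  have h3 : (Cell.edge (h y') '' (branchMap h y' '' branches C' y')).ncard =
      (branchMap h y' '' branches C' y').ncard :=
    Set.ncard_image_of_injective _ fun a b hab => by simpa using hab
  rw [h1, h2, h3]

theorem branchFailure_nonneg (H : ∀ y, IsBranchConnectedAt h y) (y' : C') :
    0 ≤ branchFailure h y' := by
  by_cases hc : Collapses h y'
  · rw [branchFailure, if_pos hc]
  · rw [branchFailure_eq_of_not_collapses hc]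
    have := Set.ncard_image_le (f := branchMap h y') (finite_branches_source H y')
    omega

theorem excess_le (H : ∀ y, IsBranchConnectedAt h y) (y' : C') :
    (excess h y' : ℤ) ≤ (branches C' y').ncard - 1 - branchFailure h y' := by
  by_cases hc : Collapses h y'
  · rw [excess_eq_zero_of_collapses H hc, branchFailure, if_pos hc]
    have := (Set.ncard_pos (finite_branches_source H y')).mpr (branches_nonempty_source H y')
    omega
  · rw [branchFailure_eq_of_not_collapses hc, excess]
    have := (Set.ncard_pos ((finite_branches_source H y').image (branchMap h y'))).mpr
      ((branches_nonempty_source H y').image _)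
    omega

/-- The branches at `y` are connected by the images of the sets of branches at the points above. -/
theorem ncard_branches_le (H : ∀ y, IsBranchConnectedAt h y) (y : C) :
    (branches C y).ncard ≤ 1 + ∑ y' ∈ (H y).finite.toFinset, excess h y' := by
  have := (H y).isNoetherianRing
  have := (H y).finite.fintype
  have h1 := ncard_le_of_connected (branches C y) (branches_nonempty y)
    (fun i : {y' | h y' = y} => branchMapTo h i.1 y i.2 '' branches C' i.1)
    (fun i => (finite_branches_source H i.1).image _) (fun I a b ha hb haI hbI => by
      obtain ⟨y', e, ⟨b₁, hb₁, h₁⟩, b₂, hb₂, h₂⟩ := (H y).exists_separated I a b ha hb haI hbI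
      exact ⟨⟨y', e⟩, ⟨_, ⟨b₁, hb₁, rfl⟩, h₁⟩, _, ⟨b₂, hb₂, rfl⟩, h₂⟩)
  refine h1.trans (Nat.add_le_add_left (le_of_eq ?_) 1)
  rw [Finset.sum_subtype (H y).finite.toFinset (p := fun y' => y' ∈ {y' | h y' = y})
    fun y' => (H y).finite.mem_toFinset]
  exact Finset.sum_congr rfl fun i _ => (excess_eq i.1 y i.2).symm

/-- The number of edges is the sum of the numbers of branches. -/
theorem ncard_edges {D : Scheme.{0}} (hY : (yellowVertices D).Finite)
    (hb : ∀ y, (branches D y).Finite) :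
    (edges D).Finite ∧ (edges D).ncard = ∑ y ∈ hY.toFinset, (branches D y).ncard := by
  classical
  let E : Finset (Σ y : D, PrimeSpectrum (CompletedStalk D y)) :=
    hY.toFinset.sigma fun y => (hb y).toFinset
  have hE : edges D = E := by
    ext ⟨y, b⟩
    simp [E, edges]
  rw [hE, Set.ncard_coe_finset, Finset.card_sigma]
  exact ⟨E.finite_toSet, Finset.sum_congr rfl fun y _ => (Set.ncard_eq_toFinset_card _ (hb y)).symm⟩

theorem finite_cells {D : Scheme.{0}} (hG : (greenVertices D).Finite)
    (hY : (yellowVertices D).Finite) (hE : (edges D).Finite) : (cells D).Finite := by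
  refine (((hG.image Cell.green).union (hY.image Cell.yellow)).union
    (hE.image fun e => Cell.edge e.1 e.2)).subset ?_
  rintro (g | y | ⟨y, b⟩) hx
  · exact Or.inl (Or.inl ⟨g, hx, rfl⟩)
  · exact Or.inl (Or.inr ⟨y, hx, rfl⟩)
  · exact Or.inr ⟨⟨y, b⟩, hx, rfl⟩

theorem eulerChar_eq {D : Scheme.{0}} (hG : (greenVertices D).Finite)
    (hY : (yellowVertices D).Finite) (hb : ∀ y, (branches D y).Finite) :
    eulerChar D = hG.toFinset.card - ∑ y ∈ hY.toFinset, (((branches D y).ncard : ℤ) - 1) := by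
  rw [eulerChar, (ncard_edges hY hb).2, Set.ncard_eq_toFinset_card _ hG,
    Set.ncard_eq_toFinset_card _ hY, Finset.sum_sub_distrib]
  push_cast
  simp
  ring

/-- The degrees over each component add up to at most its multiplicity; hence the green part of the
inequality of Euler characteristics. -/
theorem sum_residueDegree_le_sum_multiplicity (H : ∀ y, IsBranchConnectedAt h y)
    (hG' : (greenVertices C').Finite) (hG : (greenVertices C).Finite) :
    ∑ g ∈ hG'.toFinset, h.residueDegree g ≤ ∑ g ∈ hG.toFinset, multiplicity C g := by
  classical
  rw [← Finset.sum_fiberwise_of_maps_to (t := hG.toFinset) (g := h) fun g hg => by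
    rw [Set.Finite.mem_toFinset] at hg ⊢
    exact apply_mem_greenVertices H hg]
  refine Finset.sum_le_sum fun g hg => ?_
  have hg := hG.mem_toFinset.mp hg
  refine le_trans (le_of_eq ?_) ((H g).sum_residueDegree_le (mem_greenVertices_iff.mp hg))
  rw [finsum_mem_eq_finite_toFinset_sum _ (H g).finite]
  refine Finset.sum_congr (Finset.ext fun g' => ?_) fun _ _ => rfl
  simp only [Finset.mem_filter, Set.Finite.mem_toFinset, Set.mem_ofPred_eq, and_iff_right_iff_imp]
  rintro rfl
  exact mem_greenVertices_of_apply H hg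

/-- The yellow part of the inequality of Euler characteristics: the points above `y` connect the
branches at `y`. -/
theorem sum_ncard_branches_le (H : ∀ y, IsBranchConnectedAt h y)
    (hY' : (yellowVertices C').Finite) (hY : (yellowVertices C).Finite) :
    ∑ y ∈ hY.toFinset, (((branches C y).ncard : ℤ) - 1) ≤
      ∑ y' ∈ hY'.toFinset, (((branches C' y').ncard : ℤ) - 1 - branchFailure h y') := by
  classical
  calc ∑ y ∈ hY.toFinset, (((branches C y).ncard : ℤ) - 1)
      ≤ ∑ y ∈ hY.toFinset, ∑ y' ∈ hY'.toFinset with h y' = y, (excess h y' : ℤ) := by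
        refine Finset.sum_le_sum fun y _ => ?_
        have h1 := ncard_branches_le H y
        have h2 : ∑ y' ∈ (H y).finite.toFinset, excess h y' =
            ∑ y' ∈ hY'.toFinset with h y' = y, excess h y' := by
          refine (Finset.sum_subset (fun y' hy' => ?_) fun y' hy' hn => ?_).symm
          · simpa using (Finset.mem_filter.mp hy').2
          · refine excess_eq_zero_of_collapses H (by_contra fun hc => hn ?_)
            simpa using ⟨mem_yellowVertices_of_not_collapses hc H, by simpa using hy'⟩
        rw [h2] at h1
        zify at h1
        linarith
    _ ≤ ∑ y' ∈ hY'.toFinset, (excess h y' : ℤ) := by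
        rw [← Finset.sum_biUnion]
        · refine Finset.sum_le_sum_of_subset_of_nonneg ?_ fun _ _ _ => Nat.cast_nonneg _
          intro y' hy'
          obtain ⟨y, -, hy'⟩ := Finset.mem_biUnion.mp hy'
          exact (Finset.mem_filter.mp hy').1
        · intro y _ z _ hyz
          refine Finset.disjoint_left.mpr fun y' h1 h2 => hyz ?_
          exact (Finset.mem_filter.mp h1).2.symm.trans (Finset.mem_filter.mp h2).2
    _ ≤ _ := Finset.sum_le_sum fun y' _ => excess_le H y'

theorem eulerChar_le (H : ∀ y, IsBranchConnectedAt h y)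
    (hG' : (greenVertices C').Finite) (hG : (greenVertices C).Finite)
    (hY' : (yellowVertices C').Finite) (hY : (yellowVertices C).Finite) :
    eulerChar C' ≤ eulerChar C + (∑ᶠ g ∈ greenVertices C, ((multiplicity C g : ℤ) - 1)) -
      (∑ᶠ g ∈ greenVertices C', componentFailure h g) -
      (∑ᶠ y ∈ yellowVertices C', branchFailure h y) := by
  rw [eulerChar_eq hG' hY' (finite_branches_source H), eulerChar_eq hG hY fun y =>
      have := (H y).isNoetherianRing
      finite_branches y,
    finsum_mem_eq_finite_toFinset_sum _ hG, finsum_mem_eq_finite_toFinset_sum _ hG',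
    finsum_mem_eq_finite_toFinset_sum _ hY']
  have h1 := sum_residueDegree_le_sum_multiplicity H hG' hG
  have h2 := sum_ncard_branches_le H hY' hY
  zify at h1
  simp only [componentFailure, Finset.sum_sub_distrib, Finset.sum_const, nsmul_eq_mul,
    mul_one] at h2 ⊢
  linarith

theorem componentFailure_nonneg (H : ∀ y, IsBranchConnectedAt h y) {g : C'}
    (hg : g ∈ greenVertices C') : 0 ≤ componentFailure h g := by
  have := (H (h g)).residueDegree_pos
    (mem_greenVertices_iff.mp (apply_mem_greenVertices H hg)) g rfl
  rw [componentFailure]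
  omega

theorem failure_eq_zero (H : ∀ y, IsBranchConnectedAt h y)
    (hG' : (greenVertices C').Finite) (hG : (greenVertices C).Finite)
    (hY' : (yellowVertices C').Finite) (hY : (yellowVertices C).Finite)
    (heq : eulerChar C' =
      eulerChar C + (∑ᶠ g ∈ greenVertices C, ((multiplicity C g : ℤ) - 1))) :
    (∀ y ∈ yellowVertices C', branchFailure h y = 0) ∧
      (∀ g ∈ greenVertices C', componentFailure h g = 0) := by
  have hle := eulerChar_le H hG' hG hY' hY
  rw [finsum_mem_eq_finite_toFinset_sum _ hG', finsum_mem_eq_finite_toFinset_sum _ hY'] at hle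
  have hn1 (y) (_ : y ∈ hY'.toFinset) : 0 ≤ branchFailure h y := branchFailure_nonneg H y
  have hn2 (g) (hg : g ∈ hG'.toFinset) : 0 ≤ componentFailure h g :=
    componentFailure_nonneg H (hG'.mem_toFinset.mp hg)
  have h1 := Finset.sum_nonneg hn1
  have h2 := Finset.sum_nonneg hn2
  have h3 : ∑ y ∈ hY'.toFinset, branchFailure h y = 0 := by linarith
  have h4 : ∑ g ∈ hG'.toFinset, componentFailure h g = 0 := by linarith
  exact ⟨fun y hy => (Finset.sum_eq_zero_iff_of_nonneg hn1).mp h3 y (hY'.mem_toFinset.mpr hy),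
    fun g hg => (Finset.sum_eq_zero_iff_of_nonneg hn2).mp h4 g (hG'.mem_toFinset.mpr hg)⟩

end

/-! ### The fibres of a surface over a curve -/

/-- An integral birational morphism of integral schemes is finite if the target is locally of finite
type over `ℂ`. -/
theorem isFinite_of_isIntegralHom {X' X : Scheme.{0}} [IsIntegral X'] [IsIntegral X] (ν : X' ⟶ X)
    {U : X.Opens} (hU : Dense (U : Set X)) [IsIso (ν ∣_ U)]
    (s : X ⟶ Spec (CommRingCat.of ℂ)) [LocallyOfFiniteType s] [IsIntegralHom ν] : IsFinite ν where
  finite_app V hV := by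
    by_cases hne : Nonempty (ν ⁻¹ᵁ V)
    · exact finite_app_of_isIntegralHom ν hU s V hV
    · have hbot : ν ⁻¹ᵁ V = ⊥ := by
        ext x
        exact ⟨fun hx => (hne ⟨⟨x, hx⟩⟩).elim, fun hx => hx.elim⟩
      have : Subsingleton Γ(X', ν ⁻¹ᵁ V) := by
        rw [hbot]
        infer_instance
      let : Algebra Γ(X, V) Γ(X', ν ⁻¹ᵁ V) := (ν.app V).hom.toAlgebra
      exact (inferInstance : Module.Finite Γ(X, V) Γ(X', ν ⁻¹ᵁ V))

/-- The fibres of a morphism of finite type over a complex curve have finitely many irreducible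
components, and finitely many multibranch points if they have dimension at most one. -/
theorem finite_vertices_fiber {X T : Scheme.{0}} (s : T ⟶ Spec (CommRingCat.of ℂ)) (f : X ⟶ T)
    [LocallyOfFiniteType f] [QuasiCompact f] (t₀ : T)
    (hdim : ∀ y : f.fiber t₀, Ring.KrullDimLE 1 ((f.fiber t₀).presheaf.stalk y)) :
    (greenVertices (f.fiber t₀)).Finite ∧ (yellowVertices (f.fiber t₀)).Finite := by
  let k := T.residueField t₀
  have hk : IsField k := Field.toIsField (ResidueField (T.presheaf.stalk t₀))
  have : Nontrivial k := hk.nontrivial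
  let c : ℂ →+* k := (Spec.preimage (T.fromSpecResidueField t₀ ≫ s)).hom
  have : CharZero k := charZero_of_injective_ringHom c.injective
  have : LocallyOfFiniteType (f.fiberToSpecResidueField t₀) :=
    inferInstanceAs (LocallyOfFiniteType (Limits.pullback.snd f (T.fromSpecResidueField t₀)))
  exact ⟨finite_greenVertices k hk (f.fiberToSpecResidueField t₀),
    finite_yellowVertices k hk (f.fiberToSpecResidueField t₀) hdim⟩

end IntersectionGraph

theorem mainTheorem7 (T X X' : Scheme.{0})
    (s : T ⟶ Spec (CommRingCat.of ℂ)) [IsIntegral T] [IsSeparated s] [QuasiCompact s]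
    [SmoothOfRelativeDimension 1 s]
    (f : X ⟶ T) [Flat f] [IsSeparated (f ≫ s)] [LocallyOfFiniteType (f ≫ s)]
    [QuasiCompact (f ≫ s)] [IrreducibleSpace X]
    (hdim : topologicalKrullDim X = 2) (hS2 : IntersectionGraph.IsS2 X)
    (t₀ : T) (ht₀ : IsClosed ({t₀} : Set T))
    (hnormal : ∀ x : X, ¬ IntersectionGraph.IsNormalAt X x → f x = t₀)
    (ν : X' ⟶ X) (hν : IntersectionGraph.IsNormalization ν)
    (hred : IsReduced ((ν ≫ f).fiber t₀)) :
    -- the two intersection graphs are finite, and `Γ_ν` is a map between them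
    ((IntersectionGraph.cells ((ν ≫ f).fiber t₀)).Finite ∧
      (IntersectionGraph.cells (f.fiber t₀)).Finite ∧
      Set.MapsTo (IntersectionGraph.graphMap (IntersectionGraph.fiberMap ν f t₀))
        (IntersectionGraph.cells ((ν ≫ f).fiber t₀)) (IntersectionGraph.cells (f.fiber t₀))) ∧
    -- `Γ_ν` is surjective
    Set.SurjOn (IntersectionGraph.graphMap (IntersectionGraph.fiberMap ν f t₀))
      (IntersectionGraph.cells ((ν ≫ f).fiber t₀)) (IntersectionGraph.cells (f.fiber t₀)) ∧
    -- the inequality of Euler characteristics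
    IntersectionGraph.eulerChar ((ν ≫ f).fiber t₀) ≤
      IntersectionGraph.eulerChar (f.fiber t₀) +
        (∑ᶠ g ∈ IntersectionGraph.greenVertices (f.fiber t₀),
          ((IntersectionGraph.multiplicity (f.fiber t₀) g : ℤ) - 1)) -
        (∑ᶠ g ∈ IntersectionGraph.greenVertices ((ν ≫ f).fiber t₀),
          IntersectionGraph.componentFailure (IntersectionGraph.fiberMap ν f t₀) g) -
        (∑ᶠ y ∈ IntersectionGraph.yellowVertices ((ν ≫ f).fiber t₀),
          IntersectionGraph.branchFailure (IntersectionGraph.fiberMap ν f t₀) y) ∧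
    -- the case of equality
    (IntersectionGraph.eulerChar ((ν ≫ f).fiber t₀) =
        IntersectionGraph.eulerChar (f.fiber t₀) +
          (∑ᶠ g ∈ IntersectionGraph.greenVertices (f.fiber t₀),
            ((IntersectionGraph.multiplicity (f.fiber t₀) g : ℤ) - 1)) →
      (∀ y ∈ IntersectionGraph.yellowVertices ((ν ≫ f).fiber t₀),
        IntersectionGraph.branchFailure (IntersectionGraph.fiberMap ν f t₀) y = 0) ∧
      (∀ g ∈ IntersectionGraph.greenVertices ((ν ≫ f).fiber t₀),
        IntersectionGraph.componentFailure (IntersectionGraph.fiberMap ν f t₀) g = 0)) := by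

  have hdvr := IntersectionGraph.isDiscreteValuationRing_stalk s t₀ ht₀
  have : IsDomain (T.presheaf.stalk t₀) := inferInstance
  have : IsLocallyNoetherian X := LocallyOfFiniteType.isLocallyNoetherian (f ≫ s)
  have hnormal' (x : X) (hx : f x ≠ t₀) : IntersectionGraph.IsNormalAt X x :=
    by_contra fun h => hx (hnormal x h)
  obtain ⟨ϖ, hϖ⟩ := IsDiscreteValuationRing.exists_irreducible (T.presheaf.stalk t₀)
  have : IsReduced X := IntersectionGraph.isReduced_of_isDomain_stalk f t₀ ϖ
    (hϖ.maximalIdeal_eq ▸ Ideal.mem_span_singleton_self ϖ) hϖ.ne_zero fun x hx => (hnormal' x hx).1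
  have : IsIntegral X := isIntegral_of_irreducibleSpace_of_isReduced X
  have := hν.isIntegral
  have := hν.isIntegralHom
  obtain ⟨U, hU, hUν⟩ := hν.birational
  have H := IntersectionGraph.isBranchConnectedAt_fiberMap ν f t₀ hU (f ≫ s) hdim.le hS2
    fun x hx => (hnormal' x hx).2
  have : IsFinite ν := IntersectionGraph.isFinite_of_isIntegralHom ν hU (f ≫ s)
  have : LocallyOfFiniteType f := locallyOfFiniteType_of_comp f s
  have : QuasiCompact f := QuasiCompact.of_comp f s
  have hX := IntersectionGraph.finite_vertices_fiber s f t₀ fun y => (H y).krullDimLE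
  have hX' := IntersectionGraph.finite_vertices_fiber s (ν ≫ f) t₀ fun y' =>
    (H _).krullDimLE_above y' rfl
  have hE' := (IntersectionGraph.ncard_edges hX'.2 (IntersectionGraph.finite_branches_source H)).1
  have hE := (IntersectionGraph.ncard_edges hX.2 fun y =>
    have := (H y).isNoetherianRing
    IntersectionGraph.finite_branches y).1
  exact ⟨⟨IntersectionGraph.finite_cells hX'.1 hX'.2 hE',
    IntersectionGraph.finite_cells hX.1 hX.2 hE, IntersectionGraph.mapsTo_graphMap H⟩,
    IntersectionGraph.surjOn_graphMap H,
    IntersectionGraph.eulerChar_le H hX'.1 hX.1 hX'.2 hX.2,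
    IntersectionGraph.failure_eq_zero H hX'.1 hX.1 hX'.2 hX.2⟩
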